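/- Fix $d\ge 1$. For $n\ge 2$ let $\mathcal C_n$ be the cycle with vertex set $\{1,\dots,n\}$ (without multiple edges, so that $\mathcal C_2$ is a single edge), and let $G=\mathcal C_n^d$ be the Cartesian product of $d$ copies of $\mathcal C_n$, with vertex set $V=\{1,\dots,n\}^d\subset\mathbb R^d$; write $d_v$ for the degree of $v\in V$. Let $(B_t)_{t\ge 0}$ be a continuous time simple random walk on $G$: it stays at each vertex for an exponential time with mean $1$ and then jumps to a uniformly chosen neighbor. The law of $B_0$ is arbitrary. The earthworm process $(M^v_t)_{v\in V,\,t\ge 0}$ starts from $M^v_0=1/n^d$ for all $v\in V$; at every jump time $t$ of $B$, with $v=B_t$, the mass $M^v_{t-}$ is shared equally among the neighbors of $v$, i.e. $M^v_t=0$, $M^x_t=M^x_{t-}+M^v_{t-}/d_v$ for every neighbor $x$ of $v$, and the other masses do not change; masses are constant between the jumps of $B$. Let $\mathbf M^n_t=\sum_{v\in V}M^v_t\,\delta_v$, a random measure on $\mathbb R^d$. Weak convergence of random measures means convergence in distribution of random elements of the space of finite measures on $\mathbb R^d$ with the topology of weak convergence. (i) For every $n\ge 2$ the random measures $\mathbf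 M^n_t$ converge weakly, as $t\to\infty$, to a random measure $\mathbf M^n_\infty$, whose law does not depend on the law of $B_0$. (ii) Let $\widehat{\mathbf M}^n_\infty(R)=\mathbf M^n_\infty(nR)$ for Borel sets $R\subset\mathbb R^d$, where $nR=\{ny: y\in R\}$. As $n\to\infty$, the random measures $\widehat{\mathbf M}^n_\infty$ converge weakly to the random measure that is almost surely equal to the uniform probability measure on $[0,1]^d$. -/

import Mathlib

open MeasureTheory ProbabilityTheory Filter Topology
open scoped NNReal BoundedContinuousFunction

namespace Earthworm

/-- The `d`-dimensional discrete torus `C_n^d`: the Cartesian product of `d` copies of the cycle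
graph on `n` vertices. Two vertices are adjacent if they are adjacent in one coordinate and agree
in all the others. -/
def torus (d n : ℕ) : SimpleGraph (Fin d → Fin n) where
  Adj x y := ∃ i, (SimpleGraph.cycleGraph n).Adj (x i) (y i) ∧ ∀ j, j ≠ i → x j = y j
  symm := ⟨fun _ _ ⟨i, hi, hj⟩ => ⟨i, hi.symm, fun j hne => (hj j hne).symm⟩⟩
  loopless := ⟨fun _ ⟨_, hi, _⟩ => hi.ne rfl⟩

instance torusDecidableAdj (d n : ℕ) : DecidableRel (torus d n).Adj := fun x y =>
  inferInstanceAs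
    (Decidable (∃ i, (SimpleGraph.cycleGraph n).Adj (x i) (y i) ∧ ∀ j, j ≠ i → x j = y j))

section Model

variable {Ω V : Type*} [Fintype V] [DecidableEq V]

/-- `B` is a continuous time simple random walk on the finite graph `G`, with successive jump times
`T 1 < T 2 < ⋯` (and `T 0 = 0`): the holding times are independent exponential variables with
mean 1, the walk is constant between jumps, and at each jump it moves to a uniformly chosen
neighbour, independently of the holding times. The law of the initial position is arbitrary. -/
structure IsSimpleRandomWalk [MeasurableSpace Ω] [MeasurableSpace V]
    (G : SimpleGraph V) [DecidableRel G.Adj] (P : Measure Ω)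
    (B : ℝ → Ω → V) (T : ℕ → Ω → ℝ) : Prop where
  measurable_jumpTime : ∀ k, Measurable (T k)
  measurable_skeleton : ∀ k, Measurable (fun ω => B (T k ω) ω)
  jumpTime_zero : ∀ᵐ ω ∂P, T 0 ω = 0
  holding_law : ∀ k, HasLaw (fun ω => T (k + 1) ω - T k ω) (expMeasure 1) P
  holding_indep : iIndepFun (fun k ω => T (k + 1) ω - T k ω) P
  const_between_jumps :
    ∀ᵐ ω ∂P, ∀ k t, T k ω ≤ t → t < T (k + 1) ω → B t ω = B (T k ω) ω
  skeleton_markov : ∀ (k : ℕ) (y : ℕ → V),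
    P.real {ω | ∀ i ≤ k + 1, B (T i ω) ω = y i} =
      P.real {ω | ∀ i ≤ k, B (T i ω) ω = y i} *
        (if G.Adj (y k) (y (k + 1)) then ((G.degree (y k) : ℝ))⁻¹ else 0)
  skeleton_indep_holding :
    IndepFun (fun ω (k : ℕ) => B (T k ω) ω) (fun ω (k : ℕ) => T (k + 1) ω - T k ω) P

/-- Redistribution of the mass at `v`: all the mass at `v` is removed and shared equally among the
neighbours of `v`. -/
noncomputable def redistribute (G : SimpleGraph V) [DecidableRel G.Adj] (v : V) (m : V → ℝ) :
    V → ℝ :=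
  fun x => (if x = v then 0 else m x) + (if G.Adj v x then m v / (G.degree v : ℝ) else 0)

/-- The mass configuration after `k` jumps of the walk whose successive positions are
`b 0, b 1, b 2, …`; the `j`-th jump redistributes the mass of the vertex `b j` it leads to. -/
noncomputable def massAfterJumps (G : SimpleGraph V) [DecidableRel G.Adj] (m₀ : V → ℝ)
    (b : ℕ → V) : ℕ → V → ℝ
  | 0 => m₀
  | k + 1 => redistribute G (b (k + 1)) (massAfterJumps G m₀ b k)

/-- The number of jumps in the time interval `(0, t]`. -/
noncomputable def jumpCount (T : ℕ → Ω → ℝ) (t : ℝ) (ω : Ω) : ℕ :=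
  {k : ℕ | 1 ≤ k ∧ T k ω ≤ t}.ncard

/-- The mass process of the earthworm model driven by the walk `B` with jump times `T`, started
from the mass configuration `m₀`: at each jump time `s` of `B` the mass at `B s` is redistributed
among the neighbours of `B s`, and masses are constant between the jumps of `B`. -/
noncomputable def massProcess (G : SimpleGraph V) [DecidableRel G.Adj] (m₀ : V → ℝ)
    (B : ℝ → Ω → V) (T : ℕ → Ω → ℝ) (t : ℝ) (ω : Ω) : V → ℝ :=
  massAfterJumps G m₀ (fun k => B (T k ω) ω) (jumpCount T t ω)

end Model

/-- The point of `ℝ^d` corresponding to a vertex of `C_n^d`, the cycle `C_n` having vertex set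
`{1, …, n}`. -/
def vertexPoint {d n : ℕ} (v : Fin d → Fin n) : Fin d → ℝ := fun i => ((v i : ℕ) : ℝ) + 1

/-- The measure `∑ v, m v • δ_v` on `ℝ^d` associated with a nonnegative mass configuration. -/
noncomputable def massMeasure {d n : ℕ} (m : (Fin d → Fin n) → ℝ) : FiniteMeasure (Fin d → ℝ) :=
  ∑ v, (m v).toNNReal • (diracProba (vertexPoint v)).toFiniteMeasure

/-- The empirical measure at time `t` of the earthworm process on `C_n^d`, started from mass
`1 / n^d` at every vertex. -/
noncomputable def empiricalMeasure {Ω : Type*} {d n : ℕ} (B : ℝ → Ω → (Fin d → Fin n))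
    (T : ℕ → Ω → ℝ) (t : ℝ) (ω : Ω) : FiniteMeasure (Fin d → ℝ) :=
  massMeasure (massProcess (torus d n) (fun _ => 1 / (n : ℝ) ^ d) B T t ω)

/-- The rescaled measure `R ↦ μ (n R)`, i.e. the image of `μ` under `x ↦ x / n`. -/
noncomputable def rescale {d : ℕ} (n : ℕ) (μ : FiniteMeasure (Fin d → ℝ)) :
    FiniteMeasure (Fin d → ℝ) :=
  μ.map (fun x => (n : ℝ)⁻¹ • x)

/-- The uniform probability measure on `[0,1]^d`. -/
noncomputable def uniformCube (d : ℕ) : FiniteMeasure (Fin d → ℝ) :=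
  ⟨(volume : Measure (Fin d → ℝ)).restrict (Set.Icc 0 1),
    isFiniteMeasure_restrict.2 isCompact_Icc.measure_lt_top.ne⟩

/-- Weak convergence of random measures: `X i` (a random finite measure on `E` defined on the
probability space `(Ω i, P i)`) converges to the random measure `Z` (defined on `(Ω', P')`) in
distribution, with respect to the topology of weak convergence on the finite measures on `E`. -/
structure RandomMeasuresTendsto {ι E Ω' : Type*} {Ω : ι → Type*} [TopologicalSpace E]
    [MeasurableSpace E] [OpensMeasurableSpace E] [∀ i, MeasurableSpace (Ω i)] [MeasurableSpace Ω']
    (X : (i : ι) → Ω i → FiniteMeasure E) (P : (i : ι) → Measure (Ω i)) (l : Filter ι)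
    (Z : Ω' → FiniteMeasure E) (P' : Measure Ω') : Prop where
  aemeasurable : ∀ i, AEMeasurable (X i) (P i)
  aemeasurable_limit : AEMeasurable Z P'
  tendsto : ∀ F : FiniteMeasure E →ᵇ ℝ,
    Tendsto (fun i => ∫ ω, F (X i ω) ∂(P i)) l (𝓝 (∫ ω, F (Z ω) ∂P'))

end Earthworm

set_option linter.unusedSectionVars false

/-! Consider the Markov chain formed by the walker and the mass configuration, a point of the
simplex. Let K be its transition operator on observables and L = (1 + K)/2 the lazy version.

Fixed size. Drive two configurations by the same walker. Redistribution is linear, so their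
difference is a signed configuration of total mass zero; its ℓ¹ norm never increases, and it drops
strictly when mass is pushed onto a neighbour carrying the opposite sign. From any state the walker
can force such a cancellation, and a dipole decomposition makes the gain uniform
(`exists_lazyGauge_contraction`). Combined with a lower bound on the chance of finding the lazy
walker at a given vertex, this contracts Lipschitz constant and oscillation together
(`exists_contraction`). By Stone–Weierstrass, L^j f then tends to a constant for every continuous f
(`exists_tendsto_lazyOp`); that constant is `stationary`, a probability measure by Riesz. Laziness
removes the parity obstruction of bipartite graphs and costs nothing, because e^{-t} e^{tK} =
e^{-2t} e^{2tL}: the configuration at time t is seen through a Poisson number of steps, independent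
of the jump chain.

Growing size. On a Cayley graph with N vertices let φ be a character with eigenvalue 1 - ε, and M =
Σ φ(x) m(x). A push at v changes M by -ε m(v) φ(v), so the one-step change of |M|² contains the term
-2ε m(v) Re(conj M · φ(v)), which has no evident sign. Let h be the Green function centred at the
walker b, normalised as in `IsCorrector`, and W = Σ h(x - b) φ(x) m(x). Adding 2ε Re(conj M · W)
cancels this term and creates the drift -2ε|M|²/(N - 1). The errors are proportional to the mass at
the walker's next vertex, whose stationary mean is exactly 1/(N - 1) (`stationary_massAhead`). Hence
E|M|² ≤ ‖κ‖ + εC + ε/2 with |h| ≤ C (`stationary_normSqFourier_le`). The gradient of h is bounded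
independently of N, so on the torus κ = O(1/n), ε = O(1/n²), C = O(n), and every nontrivial mode
vanishes. Weyl's criterion, with a cutoff near the faces of the cube, gives convergence in mean of
integrals to deterministic values, hence convergence in distribution. -/

namespace Earthworm

/-! ### Redistribution as an ℓ¹ contraction, and cancellation forced by the walker -/

section Redistribution

variable {V : Type*} [Fintype V] [DecidableEq V] (G : SimpleGraph V) [DecidableRel G.Adj]

/-- The `ℓ¹` norm of a configuration. -/
def l1 (δ : V → ℝ) : ℝ := ∑ x, |δ x|

lemma l1_nonneg (δ : V → ℝ) : 0 ≤ l1 δ := Finset.sum_nonneg fun _ _ => abs_nonneg _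

lemma l1_add_le (δ δ' : V → ℝ) : l1 (δ + δ') ≤ l1 δ + l1 δ' := by
  unfold l1
  rw [← Finset.sum_add_distrib]
  exact Finset.sum_le_sum fun x _ => abs_add_le _ _

lemma l1_smul (c : ℝ) (δ : V → ℝ) : l1 (c • δ) = |c| * l1 δ := by
  simp [l1, abs_mul, Finset.mul_sum]

lemma redistribute_add (v : V) (δ δ' : V → ℝ) :
    redistribute G v (δ + δ') = redistribute G v δ + redistribute G v δ' := by
  ext x
  simp only [redistribute, Pi.add_apply]
  split_ifs <;> ring

lemma redistribute_smul (v : V) (c : ℝ) (δ : V → ℝ) :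
    redistribute G v (c • δ) = c • redistribute G v δ := by
  ext x
  simp only [redistribute, Pi.smul_apply, smul_eq_mul]
  split_ifs <;> ring

lemma redistribute_sub (v : V) (δ δ' : V → ℝ) :
    redistribute G v (δ - δ') = redistribute G v δ - redistribute G v δ' := by
  ext x
  simp only [redistribute, Pi.sub_apply]
  split_ifs <;> ring

lemma redistribute_nonneg (v : V) {m : V → ℝ} (hm : ∀ x, 0 ≤ m x) (x : V) :
    0 ≤ redistribute G v m x := by
  unfold redistribute
  have := hm x
  have := hm v
  split_ifs <;> positivity

variable {G}

/-- Summation by parts: a push at `v` sees a test function only through its Laplacian at `v`.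
Constants give conservation of mass; correctors and characters are the later test functions. -/
lemma sum_mul_redistribute (v : V) (f : V → ℝ) (m : V → ℝ) :
    ∑ x, f x * redistribute G v m x =
      ∑ x, f x * m x + m v * ((G.degree v : ℝ)⁻¹ * ∑ x ∈ G.neighborFinset v, f x - f v) := by
  have h1 : ∀ x, f x * redistribute G v m x =
      (f x * m x - if x = v then f v * m v else 0) +
        (if x ∈ G.neighborFinset v then f x * (m v / G.degree v) else 0) := by
    intro x
    simp only [redistribute, SimpleGraph.mem_neighborFinset]
    by_cases h : x = v
    · subst h; simp
    · simp only [h, if_false]; split_ifs <;> ring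
  simp_rw [h1]
  rw [Finset.sum_add_distrib, Finset.sum_sub_distrib, Finset.sum_ite_mem, Finset.univ_inter,
    ← Finset.sum_mul]
  simp only [Finset.sum_ite_eq', Finset.mem_univ, if_true]
  ring

lemma sum_redistribute (hG : ∀ v, 0 < G.degree v) (v : V) (m : V → ℝ) :
    ∑ x, redistribute G v m x = ∑ x, m x := by
  have h := sum_mul_redistribute (G := G) v (fun _ => 1) m
  have hv : (G.degree v : ℝ) ≠ 0 := by exact_mod_cast (hG v).ne'
  simpa [hv] using h

lemma abs_redistribute_le (v : V) (δ : V → ℝ) (x : V) :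
    |redistribute G v δ x| ≤ redistribute G v (fun y => |δ y|) x := by
  unfold redistribute
  refine (abs_add_le _ _).trans (add_le_add ?_ ?_)
  · split_ifs <;> simp
  · split_ifs <;> simp [abs_div]

lemma l1_redistribute_le (hG : ∀ v, 0 < G.degree v) (v : V) (δ : V → ℝ) :
    l1 (redistribute G v δ) ≤ l1 δ := by
  unfold l1
  rw [← sum_redistribute hG v (fun y => |δ y|)]
  exact Finset.sum_le_sum fun x _ => abs_redistribute_le v δ x

/-- The share arriving at `y` meets mass of the opposite sign, so the triangle inequality is strict
there. -/
lemma l1_redistribute_lt (hG : ∀ v, 0 < G.degree v) {v y : V} (hvy : G.Adj v y) {δ : V → ℝ}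
    (hδ : δ v * δ y < 0) : l1 (redistribute G v δ) < l1 δ := by
  unfold l1
  rw [← sum_redistribute hG v (fun y => |δ y|)]
  refine Finset.sum_lt_sum (fun x _ => abs_redistribute_le v δ x) ⟨y, Finset.mem_univ _, ?_⟩
  have hD : (0 : ℝ) < G.degree v := by exact_mod_cast hG v
  simp only [redistribute, hvy.ne', hvy, if_true, if_false]
  rcases mul_neg_iff.1 hδ with ⟨h1, h2⟩ | ⟨h1, h2⟩
  · rw [abs_of_pos h1, abs_of_neg h2]
    have : 0 < δ v / G.degree v := by positivity
    rw [abs_lt]; constructor <;> linarith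
  · rw [abs_of_neg h1, abs_of_pos h2]
    have : 0 < -δ v / G.degree v := div_pos (by linarith) hD
    rw [neg_div] at this ⊢
    rw [abs_lt]; constructor <;> linarith

variable (G)

/-- The average over the neighbours of `b`. -/
noncomputable def nbrAvg (b : V) (g : V → ℝ) : ℝ :=
  (G.degree b : ℝ)⁻¹ * ∑ v ∈ G.neighborFinset b, g v

variable {G}

lemma nbrAvg_mono (b : V) {g g' : V → ℝ} (h : ∀ v, g v ≤ g' v) : nbrAvg G b g ≤ nbrAvg G b g' :=
  mul_le_mul_of_nonneg_left (Finset.sum_le_sum fun v _ => h v) (by positivity)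

lemma nbrAvg_const (hG : ∀ v, 0 < G.degree v) (b : V) (c : ℝ) : nbrAvg G b (fun _ => c) = c := by
  have hv : (G.degree b : ℝ) ≠ 0 := by exact_mod_cast (hG b).ne'
  simp [nbrAvg, hv]

lemma nbrAvg_lt (hG : ∀ v, 0 < G.degree v) {b v : V} (hbv : G.Adj b v) {g : V → ℝ} {c : ℝ}
    (h : ∀ v, g v ≤ c) (hv : g v < c) : nbrAvg G b g < c := by
  have hD : (0 : ℝ) < G.degree b := by exact_mod_cast hG b
  conv_rhs => rw [← nbrAvg_const hG b c]
  exact mul_lt_mul_of_pos_left (Finset.sum_lt_sum (fun v _ => h v)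
    ⟨v, by simpa using hbv, hv⟩) (by positivity)

lemma nbrAvg_add (b : V) (g g' : V → ℝ) :
    nbrAvg G b (fun v => g v + g' v) = nbrAvg G b g + nbrAvg G b g' := by
  simp [nbrAvg, Finset.sum_add_distrib, mul_add]

lemma nbrAvg_mul_left (b : V) (c : ℝ) (g : V → ℝ) :
    nbrAvg G b (fun v => c * g v) = c * nbrAvg G b g := by
  simp only [nbrAvg, ← Finset.mul_sum]; ring

lemma abs_nbrAvg_le (b : V) (g : V → ℝ) : |nbrAvg G b g| ≤ nbrAvg G b (fun v => |g v|) := by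
  unfold nbrAvg
  rw [abs_mul, abs_of_nonneg (by positivity : (0 : ℝ) ≤ (G.degree b : ℝ)⁻¹)]
  exact mul_le_mul_of_nonneg_left (Finset.abs_sum_le_sum_abs _ _) (by positivity)

variable (G)

/-- The mean `ℓ¹` norm of a signed configuration after `r` steps of the lazy walk. -/
noncomputable def lazyGauge : ℕ → V → (V → ℝ) → ℝ
  | 0, _, δ => l1 δ
  | r + 1, b, δ =>
    2⁻¹ * lazyGauge r b δ + 2⁻¹ * nbrAvg G b (fun v => lazyGauge r v (redistribute G v δ))

variable {G}

lemma lazyGauge_succ_le_aux (hG : ∀ v, 0 < G.degree v) (r : ℕ) :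
    ∀ b δ, lazyGauge G (r + 1) b δ ≤ lazyGauge G r b δ := by
  induction r with
  | zero =>
    intro b δ
    have : nbrAvg G b (fun v => l1 (redistribute G v δ)) ≤ l1 δ := by
      rw [← nbrAvg_const hG b (l1 δ)]
      exact nbrAvg_mono b fun v => l1_redistribute_le hG v δ
    simp only [lazyGauge]
    linarith
  | succ r ih =>
    intro b δ
    have h1 := nbrAvg_mono (G := G) b fun v => ih v (redistribute G v δ)
    have h2 := ih b δ
    rw [lazyGauge, show lazyGauge G (r + 1) b δ = 2⁻¹ * lazyGauge G r b δ +
      2⁻¹ * nbrAvg G b (fun v => lazyGauge G r v (redistribute G v δ)) from rfl] at *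
    linarith

/-- Monotonicity lets the contraction times of finitely many starting data be replaced by their
maximum. -/
lemma lazyGauge_antitone (hG : ∀ v, 0 < G.degree v) (b : V) (δ : V → ℝ) :
    Antitone fun r => lazyGauge G r b δ :=
  antitone_nat_of_succ_le fun r => lazyGauge_succ_le_aux hG r b δ

lemma lazyGauge_le (hG : ∀ v, 0 < G.degree v) (r : ℕ) (b : V) (δ : V → ℝ) :
    lazyGauge G r b δ ≤ l1 δ := lazyGauge_antitone hG b δ (Nat.zero_le r)

lemma lazyGauge_nonneg (r : ℕ) : ∀ (b : V) (δ : V → ℝ), 0 ≤ lazyGauge G r b δ := by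
  induction r with
  | zero => intro b δ; exact l1_nonneg δ
  | succ r ih =>
    intro b δ
    have : 0 ≤ nbrAvg G b (fun v => lazyGauge G r v (redistribute G v δ)) :=
      mul_nonneg (by positivity) (Finset.sum_nonneg fun v _ => ih _ _)
    have := ih b δ
    simp only [lazyGauge]
    positivity

lemma lazyGauge_add_le (r : ℕ) : ∀ (b : V) (δ δ' : V → ℝ),
    lazyGauge G r b (δ + δ') ≤ lazyGauge G r b δ + lazyGauge G r b δ' := by
  induction r with
  | zero => intro b δ δ'; exact l1_add_le δ δ'
  | succ r ih =>
    intro b δ δ'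
    simp only [lazyGauge, redistribute_add]
    have h1 := nbrAvg_mono (G := G) b
      fun v => ih v (redistribute G v δ) (redistribute G v δ')
    rw [nbrAvg_add] at h1
    have := ih b δ δ'
    linarith

lemma lazyGauge_smul (r : ℕ) : ∀ (b : V) (c : ℝ) (δ : V → ℝ),
    lazyGauge G r b (c • δ) = |c| * lazyGauge G r b δ := by
  induction r with
  | zero => intro b c δ; exact l1_smul c δ
  | succ r ih =>
    intro b c δ
    simp only [lazyGauge, redistribute_smul, ih, nbrAvg_mul_left]
    ring

lemma lazyGauge_sum_le {ι : Type*} (r : ℕ) (b : V) (s : Finset ι) (δ : ι → V → ℝ) :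
    lazyGauge G r b (∑ i ∈ s, δ i) ≤ ∑ i ∈ s, lazyGauge G r b (δ i) := by
  classical
  induction s using Finset.induction_on with
  | empty => simpa using (lazyGauge_smul (G := G) r b 0 0).le
  | insert i s hi ih =>
    rw [Finset.sum_insert hi, Finset.sum_insert hi]
    exact (lazyGauge_add_le r b _ _).trans (add_le_add le_rfl ih)

/-- Along some continuation of the walk, some cancellation occurs. -/
def Cancels (G : SimpleGraph V) [DecidableRel G.Adj] (b : V) (δ : V → ℝ) : Prop :=
  ∃ r, lazyGauge G r b δ < l1 δ

/-- Every neighbour is chosen with positive probability and no choice increases the norm, so one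
favourable first step suffices. -/
lemma Cancels.of_adj (hG : ∀ v, 0 < G.degree v) {b v : V} (hbv : G.Adj b v) {δ : V → ℝ}
    (h : Cancels G v (redistribute G v δ)) : Cancels G b δ := by
  obtain ⟨r, hr⟩ := h
  refine ⟨r + 1, ?_⟩
  have h1 : nbrAvg G b (fun v => lazyGauge G r v (redistribute G v δ)) < l1 δ :=
    nbrAvg_lt hG hbv
      (fun w => (lazyGauge_le hG r w _).trans (l1_redistribute_le hG w δ))
      (hr.trans_le (l1_redistribute_le hG v δ))
  have := lazyGauge_le hG r b δ
  simp only [lazyGauge]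
  linarith

lemma Cancels.of_lt (hG : ∀ v, 0 < G.degree v) {b v : V} (hbv : G.Adj b v) {δ : V → ℝ}
    (h : l1 (redistribute G v δ) < l1 δ) : Cancels G b δ := by
  refine ⟨1, ?_⟩
  have h1 : nbrAvg G b (fun v => lazyGauge G 0 v (redistribute G v δ)) < l1 δ :=
    nbrAvg_lt hG hbv (fun w => l1_redistribute_le hG w δ) h
  have := lazyGauge_le hG 0 b δ
  simp only [lazyGauge] at *
  linarith

/-- The walker pushes the mass at `x` along a path to `y`. -/
lemma cancels_of_walk (hG : ∀ v, 0 < G.degree v) {x y : V} (p : G.Walk x y) :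
    ∀ (b : V) (δ : V → ℝ), G.Adj b x → δ x * δ y < 0 → Cancels G b δ := by
  induction p with
  | nil => intro b δ _ h; exact absurd h (not_lt.2 (mul_self_nonneg _))
  | @cons x x₁ y hxx p ih =>
    intro b δ hbx h
    -- If `x₁` or `y` is a neighbour of `x` of opposite sign, stepping to `x` cancels at once.
    -- Otherwise the push leaves `y` unchanged and gives `x₁` the sign of `δ x`, while the walker,
    -- now at `x`, is adjacent to `x₁`.
    by_cases h1 : δ x * δ x₁ < 0
    · exact Cancels.of_lt hG hbx (l1_redistribute_lt hG hxx h1)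
    by_cases h2 : G.Adj x y
    · exact Cancels.of_lt hG hbx (l1_redistribute_lt hG h2 h)
    refine Cancels.of_adj hG hbx (ih x _ hxx ?_)
    have hxy : y ≠ x := by rintro rfl; exact absurd h (not_lt.2 (mul_self_nonneg _))
    have hD : (0 : ℝ) < G.degree x := by exact_mod_cast hG x
    simp only [redistribute, hxx.ne', hxx, hxy, h2, if_true, if_false, add_zero]
    have h3 : δ x ≠ 0 := by rintro h0; simp [h0] at h
    -- The factor `(δ x) ^ 2` makes the known products `δ x * δ x₁ ≥ 0` and `δ x * δ y < 0` appear
    -- without splitting on signs.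
    have h4 : (δ x₁ + δ x / G.degree x) * δ y * (δ x) ^ 2 < 0 := by
      have : (δ x₁ + δ x / G.degree x) * δ y * (δ x) ^ 2 =
        (δ x * δ x₁ + δ x ^ 2 / G.degree x) * (δ x * δ y) := by field_simp
      rw [this]
      exact mul_neg_of_pos_of_neg
        (by have := sq_pos_of_ne_zero h3; have := not_lt.1 h1; positivity) h
    by_contra h5
    exact absurd h4 (not_lt.2 (mul_nonneg (not_lt.1 h5) (sq_nonneg _)))

/-- A vertex other than `v` can only receive a share of `δ v`: either the signs are opposite and
mass cancels, or the sign at `z` survives. -/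
lemma redistribute_keeps_sign (hG : ∀ v, 0 < G.degree v) {v z : V} (hvz : z ≠ v) {δ : V → ℝ}
    (hz : δ z ≠ 0) :
    l1 (redistribute G v δ) < l1 δ ∨ 0 < redistribute G v δ z * δ z := by
  by_cases hadj : G.Adj v z
  · by_cases h1 : δ v * δ z < 0
    · exact Or.inl (l1_redistribute_lt hG hadj h1)
    · right
      have hD : (0 : ℝ) < G.degree v := by exact_mod_cast hG v
      simp only [redistribute, hvz, hadj, if_true, if_false]
      have h2 : (δ z + δ v / G.degree v) * δ z = δ z ^ 2 + δ v * δ z / G.degree v := by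
        field_simp
      have := sq_pos_of_ne_zero hz
      have := not_lt.1 h1
      rw [h2]; positivity
  · right
    simp only [redistribute, hvz, hadj, if_false, add_zero]
    exact mul_self_pos.2 hz

lemma cancels_or_keeps_sign (hG : ∀ v, 0 < G.degree v) {b v x y : V} (hbv : G.Adj b v)
    (hx : x ≠ v) (hy : y ≠ v) {δ : V → ℝ} (h : δ x * δ y < 0) :
    Cancels G b δ ∨ redistribute G v δ x * redistribute G v δ y < 0 := by
  have hx0 : δ x ≠ 0 := by rintro h0; simp [h0] at h
  have hy0 : δ y ≠ 0 := by rintro h0; simp [h0] at h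
  rcases redistribute_keeps_sign hG hx hx0 with h1 | h1
  · exact Or.inl (Cancels.of_lt hG hbv h1)
  rcases redistribute_keeps_sign hG hy hy0 with h2 | h2
  · exact Or.inl (Cancels.of_lt hG hbv h2)
  refine Or.inr (not_le.1 fun h3 => ?_)
  have := mul_pos h1 h2
  nlinarith

/-- The walker is brought towards `x`. On the way the signs at `x` and `y` persist unless a
cancellation occurs, and as soon as the next vertex is `x` or `y` its mass can be pushed along a
path to the other one. -/
lemma cancels_of_walk_to (hG : ∀ v, 0 < G.degree v) (hc : G.Preconnected) {b x : V}
    (q : G.Walk b x) : ∀ (y : V) (δ : V → ℝ), δ x * δ y < 0 → Cancels G b δ := by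
  induction q with
  | @nil b =>
    intro y δ h
    -- A walker already at `x` has to step off before it can come back and push the mass there.
    obtain ⟨v, hv⟩ := (G.degree_pos_iff_exists_adj b).1 (hG b)
    obtain ⟨p⟩ := hc b y
    obtain ⟨p'⟩ := hc y b
    by_cases hvy : y = v
    · subst hvy
      exact cancels_of_walk hG p' b δ hv (by rwa [mul_comm])
    rcases cancels_or_keeps_sign hG hv hv.ne hvy h with h1 | h1
    · exact h1
    · exact Cancels.of_adj hG hv (cancels_of_walk hG p v _ hv.symm h1)
  | @cons b c x hbc q ih =>
    intro y δ h
    by_cases hcx : x = c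
    · subst hcx
      obtain ⟨p⟩ := hc x y
      exact cancels_of_walk hG p b δ hbc h
    by_cases hcy : y = c
    · subst hcy
      obtain ⟨p⟩ := hc y x
      exact cancels_of_walk hG p b δ hbc (by rwa [mul_comm])
    rcases cancels_or_keeps_sign hG hbc hcx hcy h with h1 | h1
    · exact h1
    · exact Cancels.of_adj hG hbc (ih y _ h1)

/-- Uniform contraction of the lazy walk on configurations of total mass zero. -/
lemma exists_lazyGauge_contraction (hG : ∀ v, 0 < G.degree v) (hc : G.Preconnected) :
    ∃ γ < 1, 0 ≤ γ ∧ ∃ R, ∀ r ≥ R, ∀ b (δ : V → ℝ), ∑ x, δ x = 0 →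
      lazyGauge G r b δ ≤ γ * l1 δ := by
  -- It is enough to treat dipoles, of norm at most 2: there are finitely many triples (walker,
  -- source, sink), so the largest constant is still below one.
  have hpair : ∀ t : V × V × V, ∃ γ < (1 : ℝ), 0 ≤ γ ∧ ∃ R, ∀ r ≥ R, t.2.1 ≠ t.2.2 →
      lazyGauge G r t.1 (Pi.single t.2.1 1 - Pi.single t.2.2 1) ≤ γ * 2 := by
    rintro ⟨b, x, y⟩
    by_cases hxy : x = y
    · exact ⟨0, one_pos, le_rfl, 0, fun r _ h => absurd hxy h⟩
    obtain ⟨q⟩ := hc b x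
    obtain ⟨R, hR⟩ := cancels_of_walk_to hG hc q y (Pi.single x 1 - Pi.single y 1)
      (by simp [hxy, Ne.symm hxy])
    have h2 : l1 (Pi.single x 1 - Pi.single y 1 : V → ℝ) ≤ 2 := by
      have := l1_add_le (Pi.single x 1 : V → ℝ) ((-1 : ℝ) • Pi.single y 1)
      rw [l1_smul] at this
      have h3 : ∀ z : V, l1 (Pi.single z 1 : V → ℝ) = 1 := by
        intro z
        simp only [l1, Pi.single_apply]
        rw [Finset.sum_eq_single z] <;> simp +contextual
      rw [h3, h3] at this
      norm_num at this
      simpa [sub_eq_add_neg] using this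
    refine ⟨lazyGauge G R b (Pi.single x 1 - Pi.single y 1) / 2, by linarith,
      div_nonneg (lazyGauge_nonneg _ _ _) (by norm_num), R, fun r hr _ => ?_⟩
    have := lazyGauge_antitone hG b (Pi.single x 1 - Pi.single y 1) hr
    simp only at this ⊢
    linarith
  choose γ hγ1 hγ0 R hR using hpair
  rcases isEmpty_or_nonempty V with hV | hV
  · exact ⟨0, one_pos, le_rfl, 0, fun r _ b => hV.elim b⟩
  obtain ⟨t₀, ht₀⟩ := Finite.exists_max γ
  refine ⟨γ t₀, hγ1 t₀, hγ0 t₀, Finset.univ.sup R, fun r hr b δ hδ => ?_⟩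
  set s := ∑ x, (δ x)⁺ with hs
  have hs' : s = ∑ x, (δ x)⁻ := by
    rw [← sub_eq_zero, hs, ← Finset.sum_sub_distrib]
    simpa [posPart_sub_negPart] using hδ
  have hl1 : l1 δ = 2 * s := by
    have : l1 δ = ∑ x, ((δ x)⁺ + (δ x)⁻) :=
      Finset.sum_congr rfl fun x _ => (posPart_add_negPart _).symm
    rw [this, Finset.sum_add_distrib, ← hs, ← hs']; ring
  have hs0 : 0 ≤ s := Finset.sum_nonneg fun x _ => posPart_nonneg _
  rcases hs0.eq_or_lt with h0 | h0
  · have h1 := lazyGauge_le hG r b δ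
    rw [hl1, ← h0] at h1 ⊢
    simpa using h1
  -- Product coupling of the positive and negative parts, both of mass `s`: a combination of dipoles
  -- with nonnegative weights of total `s`, so subadditivity of the gauge loses nothing.
  have hdec : δ = ∑ t : V × V, ((δ t.1)⁺ * (δ t.2)⁻ / s) •
      (Pi.single t.1 1 - Pi.single t.2 1 : V → ℝ) := by
    ext z
    simp only [Finset.sum_apply, Pi.smul_apply, Pi.sub_apply, smul_eq_mul, mul_sub,
      Finset.sum_sub_distrib, Fintype.sum_prod_type, Pi.single_apply, mul_ite, mul_one, mul_zero]
    rw [Finset.sum_comm]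
    simp only [Finset.sum_ite_eq, Finset.mem_univ, if_true, ← Finset.sum_div, ← Finset.mul_sum,
      ← Finset.sum_mul]
    rw [← hs, ← hs']
    conv_lhs => rw [← posPart_sub_negPart (δ z)]
    field_simp
  have hb : ∀ t : V × V, lazyGauge G r b (((δ t.1)⁺ * (δ t.2)⁻ / s) •
      (Pi.single t.1 1 - Pi.single t.2 1 : V → ℝ)) ≤ (δ t.1)⁺ * (δ t.2)⁻ / s * (γ t₀ * 2) := by
    rintro ⟨x, y⟩
    have hc0 : 0 ≤ (δ x)⁺ * (δ y)⁻ / s :=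
      div_nonneg (mul_nonneg (posPart_nonneg _) (negPart_nonneg _)) hs0
    rw [lazyGauge_smul, abs_of_nonneg hc0]
    refine mul_le_mul_of_nonneg_left ?_ hc0
    by_cases hxy : x = y
    · subst hxy
      have := lazyGauge_smul (G := G) r b 0 0
      simp only [zero_smul, abs_zero, zero_mul] at this
      simp [this, hγ0 t₀]
    · refine (hR (b, x, y) r ((Finset.le_sup (Finset.mem_univ _)).trans hr) hxy).trans ?_
      have := ht₀ (b, x, y)
      linarith
  calc lazyGauge G r b δ ≤ ∑ t : V × V, (δ t.1)⁺ * (δ t.2)⁻ / s * (γ t₀ * 2) := by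
        conv_lhs => rw [hdec]
        exact (lazyGauge_sum_le r b _ _).trans (Finset.sum_le_sum fun t _ => hb t)
    _ = γ t₀ * l1 δ := by
        rw [← Finset.sum_mul, Fintype.sum_prod_type]
        simp only [← Finset.sum_div, ← Finset.mul_sum, ← Finset.sum_mul]
        rw [← hs, ← hs', hl1]
        field_simp

end Redistribution

/-! ### Transition operators of the chain (walker, configuration) -/

section StepOperator

variable {V : Type*} [Fintype V] [DecidableEq V] {G : SimpleGraph V} [DecidableRel G.Adj]

/-- Redistribution of the mass at `v`, as a continuous map of the simplex of configurations. -/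
noncomputable def redistributeSimplex (hG : ∀ v, 0 < G.degree v) (v : V) :
    C(stdSimplex ℝ V, stdSimplex ℝ V) where
  toFun m := ⟨redistribute G v m, redistribute_nonneg G v m.2.1,
    (sum_redistribute hG v _).trans m.2.2⟩
  continuous_toFun := by
    refine Continuous.subtype_mk (continuous_pi fun x => ?_) _
    have h : ∀ y : V, Continuous fun m : stdSimplex ℝ V => (m : V → ℝ) y := fun y =>
      (continuous_apply y).comp continuous_subtype_val
    unfold redistribute
    refine Continuous.add ?_ ?_ <;> split_ifs <;>
      first | exact continuous_const | exact h _ | exact (h _).div_const _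

lemma coe_redistributeSimplex (hG : ∀ v, 0 < G.degree v) (v : V) (m : stdSimplex ℝ V) :
    (redistributeSimplex hG v m : V → ℝ) = redistribute G v m := rfl

lemma obs_norm_le {f : V → C(stdSimplex ℝ V, ℝ)} {C : ℝ} (hC : 0 ≤ C) :
    ‖f‖ ≤ C ↔ ∀ b m, |f b m| ≤ C := by
  simp only [pi_norm_le_iff_of_nonneg hC, ContinuousMap.norm_le _ hC, Real.norm_eq_abs]

lemma abs_obs_le (f : V → C(stdSimplex ℝ V, ℝ)) (b : V) (m : stdSimplex ℝ V) :
    |f b m| ≤ ‖f‖ := (obs_norm_le (norm_nonneg f)).1 le_rfl b m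

/-- The transition operator of the chain (walker, configuration). -/
noncomputable def stepOp (hG : ∀ v, 0 < G.degree v) :
    (V → C(stdSimplex ℝ V, ℝ)) →L[ℝ] (V → C(stdSimplex ℝ V, ℝ)) :=
  LinearMap.mkContinuous
    { toFun := fun f b => (G.degree b : ℝ)⁻¹ • ∑ v ∈ G.neighborFinset b,
        (f v).comp (redistributeSimplex hG v)
      map_add' := fun f g => by
        ext b m
        simp [Finset.sum_add_distrib]
      map_smul' := fun c f => by
        ext b m
        simp only [Pi.smul_apply, ContinuousMap.smul_apply, ContinuousMap.sum_apply,
          ContinuousMap.comp_apply, smul_eq_mul, RingHom.id_apply, ← Finset.mul_sum]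
        ring } 1 (fun f => by
      rw [one_mul, obs_norm_le (norm_nonneg f)]
      intro b m
      simp only [LinearMap.coe_mk, AddHom.coe_mk, ContinuousMap.smul_apply,
        ContinuousMap.sum_apply, ContinuousMap.comp_apply, smul_eq_mul]
      refine (abs_nbrAvg_le (G := G) b fun v => f v (redistributeSimplex hG v m)).trans ?_
      rw [← nbrAvg_const hG b ‖f‖]
      exact nbrAvg_mono b fun v => abs_obs_le f v _)

variable (hG : ∀ v, 0 < G.degree v)

lemma stepOp_apply (f : V → C(stdSimplex ℝ V, ℝ)) (b : V) (m : stdSimplex ℝ V) :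
    stepOp hG f b m = nbrAvg G b fun v => f v (redistributeSimplex hG v m) := by
  simp [stepOp, nbrAvg]

/-- The transition operator of the lazy chain. -/
noncomputable def lazyOp : (V → C(stdSimplex ℝ V, ℝ)) →L[ℝ] (V → C(stdSimplex ℝ V, ℝ)) :=
  (2⁻¹ : ℝ) • (1 + stepOp hG)

lemma lazyOp_apply (f : V → C(stdSimplex ℝ V, ℝ)) (b : V) (m : stdSimplex ℝ V) :
    lazyOp hG f b m =
      2⁻¹ * f b m + 2⁻¹ * nbrAvg G b fun v => f v (redistributeSimplex hG v m) := by
  simp [lazyOp, stepOp_apply]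

lemma obs_le {f g : V → C(stdSimplex ℝ V, ℝ)} : f ≤ g ↔ ∀ b m, f b m ≤ g b m := Iff.rfl

lemma obs_le_smul_one {f : V → C(stdSimplex ℝ V, ℝ)} {s : ℝ} :
    f ≤ s • 1 ↔ ∀ b m, f b m ≤ s := by
  simp [obs_le]

lemma smul_one_le_obs {f : V → C(stdSimplex ℝ V, ℝ)} {s : ℝ} :
    s • 1 ≤ f ↔ ∀ b m, s ≤ f b m := by
  simp [obs_le]

lemma lazyOp_mono {f g : V → C(stdSimplex ℝ V, ℝ)} (h : f ≤ g) : lazyOp hG f ≤ lazyOp hG g := by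
  rw [obs_le] at h ⊢
  intro b m
  have h1 := h b m
  have h2 := nbrAvg_mono (G := G) b fun v => h v (redistributeSimplex hG v m)
  rw [lazyOp_apply, lazyOp_apply]
  linarith

lemma lazyOp_pow_mono (j : ℕ) {f g : V → C(stdSimplex ℝ V, ℝ)} (h : f ≤ g) :
    (lazyOp hG ^ j) f ≤ (lazyOp hG ^ j) g := by
  induction j with
  | zero => simpa using h
  | succ j ih => rw [pow_succ']; exact lazyOp_mono hG ih

lemma stepOp_one : stepOp hG 1 = 1 := by
  ext b m
  rw [stepOp_apply]
  simpa using nbrAvg_const hG b 1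

lemma lazyOp_one : lazyOp hG 1 = 1 := by
  simp only [lazyOp, smul_apply, add_apply,
    one_apply_eq_self, stepOp_one]
  rw [← two_smul ℝ, smul_smul]; norm_num

lemma lazyOp_pow_one (j : ℕ) : (lazyOp hG ^ j) 1 = 1 := by
  induction j with
  | zero => simp
  | succ j ih => rw [pow_succ', mul_apply_eq_comp, ih, lazyOp_one]

lemma lazyOp_pow_le {f : V → C(stdSimplex ℝ V, ℝ)} {s : ℝ} (h : f ≤ s • 1) (j : ℕ) :
    (lazyOp hG ^ j) f ≤ s • 1 := by
  have := lazyOp_pow_mono hG j h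
  rwa [map_smul, lazyOp_pow_one] at this

lemma le_lazyOp_pow {f : V → C(stdSimplex ℝ V, ℝ)} {s : ℝ} (h : s • 1 ≤ f) (j : ℕ) :
    s • 1 ≤ (lazyOp hG ^ j) f := by
  have := lazyOp_pow_mono hG j h
  rwa [map_smul, lazyOp_pow_one] at this

lemma abs_lazyOp_pow_le (f : V → C(stdSimplex ℝ V, ℝ)) (j : ℕ) (b : V) (m : stdSimplex ℝ V) :
    |(lazyOp hG ^ j) f b m| ≤ ‖f‖ := by
  have h1 := lazyOp_pow_le hG (obs_le_smul_one.2 fun b m => (abs_le.1 (abs_obs_le f b m)).2) j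
  have h2 := le_lazyOp_pow hG (smul_one_le_obs.2 fun b m => (abs_le.1 (abs_obs_le f b m)).1) j
  exact abs_le.2 ⟨smul_one_le_obs.1 h2 b m, obs_le_smul_one.1 h1 b m⟩

/-- `f` is `c`-Lipschitz in the configuration, for the `ℓ¹` distance. -/
def ObsLipschitz (f : V → C(stdSimplex ℝ V, ℝ)) (c : ℝ) : Prop :=
  ∀ b (m m' : stdSimplex ℝ V), |f b m - f b m'| ≤ c * l1 ((m : V → ℝ) - (m' : V → ℝ))

/-- The oscillation of `f` is at most `O`. -/
def ObsOsc (f : V → C(stdSimplex ℝ V, ℝ)) (O : ℝ) : Prop :=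
  ∀ b m b' m', f b m - f b' m' ≤ O

/-- Coupling: two configurations follow the same walker, and by linearity their difference evolves
as the signed configuration measured by `lazyGauge`. -/
lemma ObsLipschitz.lazyOp_pow {f : V → C(stdSimplex ℝ V, ℝ)} {c : ℝ}
    (hf : ObsLipschitz f c) (r : ℕ) : ∀ b (m m' : stdSimplex ℝ V),
    |(lazyOp hG ^ r) f b m - (lazyOp hG ^ r) f b m'| ≤
      c * lazyGauge G r b ((m : V → ℝ) - (m' : V → ℝ)) := by
  induction r with
  | zero => intro b m m'; simpa [lazyGauge] using hf b m m'
  | succ r ih =>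
    intro b m m'
    rw [pow_succ', mul_apply_eq_comp, lazyOp_apply, lazyOp_apply, lazyGauge]
    set g := (lazyOp hG ^ r) f
    have h1 : |nbrAvg G b (fun v => g v (redistributeSimplex hG v m)) -
        nbrAvg G b (fun v => g v (redistributeSimplex hG v m'))| ≤
        c * nbrAvg G b (fun v =>
          lazyGauge G r v (redistribute G v ((m : V → ℝ) - (m' : V → ℝ)))) := by
      have : nbrAvg G b (fun v => g v (redistributeSimplex hG v m)) -
        nbrAvg G b (fun v => g v (redistributeSimplex hG v m')) =
        nbrAvg G b (fun v => g v (redistributeSimplex hG v m) -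
          g v (redistributeSimplex hG v m')) := by
        simp [nbrAvg, mul_sub]
      rw [this, ← nbrAvg_mul_left]
      refine (abs_nbrAvg_le _ _).trans (nbrAvg_mono _ fun v => ?_)
      rw [redistribute_sub]
      exact ih v _ _
    have h2 := ih b m m'
    rw [abs_le] at h1 h2 ⊢
    constructor <;> linarith [h1.1, h1.2, h2.1, h2.2]

lemma l1_sub_le_two (m m' : stdSimplex ℝ V) : l1 ((m : V → ℝ) - (m' : V → ℝ)) ≤ 2 := by
  have h : ∀ m : stdSimplex ℝ V, l1 (m : V → ℝ) = 1 := fun m => by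
    unfold l1
    rw [← m.2.2]
    exact Finset.sum_congr rfl fun x _ => abs_of_nonneg (m.2.1 x)
  have := l1_add_le (m : V → ℝ) ((-1 : ℝ) • (m' : V → ℝ))
  rw [l1_smul, h, h] at this
  norm_num at this
  simpa [sub_eq_add_neg] using this

/-- The indicator of the position `z`. -/
noncomputable def posIndicator (z : V) : V → C(stdSimplex ℝ V, ℝ) :=
  fun b => if b = z then 1 else 0

lemma posIndicator_nonneg (z : V) : 0 ≤ posIndicator z := by
  rw [obs_le]
  intro b m
  by_cases h : b = z <;> simp [posIndicator, h]

lemma lazyOp_pow_posIndicator_nonneg (z : V) (r : ℕ) (b : V) (m : stdSimplex ℝ V) :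
    0 ≤ (lazyOp hG ^ r) (posIndicator z) b m := by
  simpa using obs_le.1 (lazyOp_pow_mono hG r (posIndicator_nonneg z)) b m

/-- Holding still keeps a positive hitting probability positive at all later times, so one time
serves all starting vertices whatever their parity. -/
lemma exists_lazyOp_pow_posIndicator_ge (hc : G.Preconnected) (z : V) :
    ∃ R, ∀ r ≥ R, ∃ p > 0, ∀ b m, p ≤ (lazyOp hG ^ r) (posIndicator z) b m := by
  have hstay : ∀ r b, (∃ p > 0, ∀ m, p ≤ (lazyOp hG ^ r) (posIndicator z) b m) →
      ∃ p > 0, ∀ m, p ≤ (lazyOp hG ^ (r + 1)) (posIndicator z) b m := by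
    rintro r b ⟨p, hp, h⟩
    refine ⟨2⁻¹ * p, by positivity, fun m => ?_⟩
    rw [pow_succ', mul_apply_eq_comp, lazyOp_apply]
    have h1 := nbrAvg_mono (G := G) b (g := fun _ => 0)
      fun v => lazyOp_pow_posIndicator_nonneg hG z r v (redistributeSimplex hG v m)
    rw [nbrAvg_const hG] at h1
    have := h m
    linarith
  have hmove : ∀ r b v, G.Adj b v → (∃ p > 0, ∀ m, p ≤ (lazyOp hG ^ r) (posIndicator z) v m) →
      ∃ p > 0, ∀ m, p ≤ (lazyOp hG ^ (r + 1)) (posIndicator z) b m := by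
    rintro r b v hbv ⟨p, hp, h⟩
    have hD : (0 : ℝ) < G.degree b := by exact_mod_cast hG b
    refine ⟨2⁻¹ * ((G.degree b : ℝ)⁻¹ * p), by positivity, fun m => ?_⟩
    rw [pow_succ', mul_apply_eq_comp, lazyOp_apply]
    have h1 : (G.degree b : ℝ)⁻¹ * p ≤ nbrAvg G b fun v =>
        (lazyOp hG ^ r) (posIndicator z) v (redistributeSimplex hG v m) := by
      refine mul_le_mul_of_nonneg_left ((h (redistributeSimplex hG v m)).trans ?_) (by positivity)
      exact Finset.single_le_sum
        (f := fun v => (lazyOp hG ^ r) (posIndicator z) v (redistributeSimplex hG v m))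
        (fun w _ => lazyOp_pow_posIndicator_nonneg hG z r w _) (by simpa using hbv)
    have := lazyOp_pow_posIndicator_nonneg hG z r b m
    linarith
  have hwalk : ∀ {b : V}, G.Walk b z → ∃ r, ∃ p > 0, ∀ m,
      p ≤ (lazyOp hG ^ r) (posIndicator z) b m := by
    intro b q
    induction q with
    | @nil b => exact ⟨0, 1, one_pos, fun m => by simp [posIndicator]⟩
    | cons hadj q ih =>
      obtain ⟨r, hr⟩ := ih hstay hmove
      exact ⟨r + 1, hmove r _ _ hadj hr⟩
  choose ρ hρ using fun b => hwalk (hc b z).some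
  refine ⟨Finset.univ.sup ρ, fun r hr => ?_⟩
  have h1 : ∀ b, ∃ p > 0, ∀ m, p ≤ (lazyOp hG ^ r) (posIndicator z) b m := by
    intro b
    have : ρ b ≤ r := (Finset.le_sup (Finset.mem_univ b)).trans hr
    exact Nat.le_induction (hρ b) (fun r _ h => hstay r b h) r this
  choose p hp h2 using h1
  have : Nonempty V := ⟨z⟩
  obtain ⟨b₀, hb₀⟩ := Finite.exists_min p
  exact ⟨p b₀, hp b₀, fun b m => (hb₀ b).trans (h2 b m)⟩

/-! ### Unique ergodicity of the lazy chain -/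

section Ergodic

variable [Nonempty V]

lemma exists_simplex_max (f : C(stdSimplex ℝ V, ℝ)) : ∃ m₀, ∀ m, f m ≤ f m₀ := by
  obtain ⟨m₀, -, h⟩ := isCompact_univ.exists_isMaxOn Set.univ_nonempty f.continuous.continuousOn
  exact ⟨m₀, fun m => h (Set.mem_univ m)⟩

lemma exists_obs_max (f : V → C(stdSimplex ℝ V, ℝ)) : ∃ b₀ m₀, ∀ b m, f b m ≤ f b₀ m₀ := by
  choose M hM using fun b => exists_simplex_max (f b)
  obtain ⟨b₀, hb₀⟩ := Finite.exists_max fun b => f b (M b)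
  exact ⟨b₀, M b₀, fun b m => (hM b m).trans (hb₀ b)⟩

lemma exists_simplex_min (f : C(stdSimplex ℝ V, ℝ)) : ∃ m₀, ∀ m, f m₀ ≤ f m := by
  obtain ⟨m₀, h⟩ := exists_simplex_max (-f)
  exact ⟨m₀, fun m => by simpa using h m⟩

lemma exists_obs_min (f : V → C(stdSimplex ℝ V, ℝ)) : ∃ b₀ m₀, ∀ b m, f b₀ m₀ ≤ f b m := by
  obtain ⟨b₀, m₀, h⟩ := exists_obs_max (-f)
  exact ⟨b₀, m₀, fun b m => by simpa using h b m⟩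

/-- The Lipschitz bound alone cannot compare different walker positions; a Doeblin minorisation at
`z` does. At `z` the observable varies by at most `2 * c`, as the simplex has ℓ¹ diameter at most 2,
so the new oscillation is at most (1 - p) · 4c + p · 2c = 4c(1 - p/2). The ratio 4 between the two
bounds is what leaves this gain. -/
lemma exists_contraction (hc : G.Preconnected) :
    ∃ r, ∃ γ < 1, 0 ≤ γ ∧ ∀ c ≥ 0, ∀ f : V → C(stdSimplex ℝ V, ℝ), ObsLipschitz f c →
      ObsOsc f (4 * c) → ObsLipschitz ((lazyOp hG ^ r) f) (γ * c) ∧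
        ObsOsc ((lazyOp hG ^ r) f) (4 * (γ * c)) := by
  obtain ⟨γ, hγ1, hγ0, R₁, hR₁⟩ := exists_lazyGauge_contraction hG hc
  set z : V := Classical.arbitrary V
  obtain ⟨R₂, hR₂⟩ := exists_lazyOp_pow_posIndicator_ge hG hc z
  obtain ⟨p, hp, hpw⟩ := hR₂ (max R₁ R₂) (le_max_right _ _)
  set r := max R₁ R₂
  refine ⟨r, max γ (1 - p / 2), max_lt hγ1 (by linarith), le_max_of_le_left hγ0,
    fun c hc0 f hL hO => ⟨?_, ?_⟩⟩
  · intro b m m'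
    refine (hL.lazyOp_pow hG r b m m').trans ?_
    have h1 := hR₁ r (le_max_left _ _) b ((m : V → ℝ) - (m' : V → ℝ)) (by
      simp only [Pi.sub_apply, Finset.sum_sub_distrib]
      rw [stdSimplex.sum_eq_one, stdSimplex.sum_eq_one, sub_self])
    have h2 := l1_nonneg ((m : V → ℝ) - (m' : V → ℝ))
    have h3 : γ * l1 ((m : V → ℝ) - (m' : V → ℝ)) ≤
        max γ (1 - p / 2) * l1 ((m : V → ℝ) - (m' : V → ℝ)) :=
      mul_le_mul_of_nonneg_right (le_max_left _ _) h2
    calc c * lazyGauge G r b ((m : V → ℝ) - (m' : V → ℝ))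
        ≤ c * (max γ (1 - p / 2) * l1 ((m : V → ℝ) - (m' : V → ℝ))) :=
          mul_le_mul_of_nonneg_left (h1.trans h3) hc0
      _ = _ := by ring
  · intro b m b' m'
    obtain ⟨b₁, m₁, h1⟩ := exists_obs_max f
    obtain ⟨b₂, m₂, h2⟩ := exists_obs_min f
    obtain ⟨m₃, h3⟩ := exists_simplex_max (f z)
    obtain ⟨m₄, h4⟩ := exists_simplex_min (f z)
    set s := f b₁ m₁
    set i := f b₂ m₂
    set U := f z m₃
    set α := f z m₄
    have hsi : s - i ≤ 4 * c := hO _ _ _ _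
    have hUα : U - α ≤ 2 * c := by
      have h5 := (le_abs_self _).trans (hL z m₃ m₄)
      have h6 := mul_le_mul_of_nonneg_left (l1_sub_le_two m₃ m₄) hc0
      linarith
    have hUs : U ≤ s := h1 _ _
    have hαi : i ≤ α := h2 _ _
    -- With probability at least `p` the walker ends at `z`, where `f` is at most `U` rather than
    -- `s`. The lower bound is symmetric.
    have hup : (lazyOp hG ^ r) f b m ≤ s - (s - U) * p := by
      have h5 : f ≤ s • 1 - (s - U) • posIndicator z := by
        rw [obs_le]
        intro b m
        by_cases hb : b = z
        · subst hb; simpa [posIndicator] using h3 m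
        · simpa [posIndicator, hb] using h1 b m
      have h6 := obs_le.1 (lazyOp_pow_mono hG r h5) b m
      rw [map_sub, map_smul, map_smul, lazyOp_pow_one] at h6
      simp only [Pi.smul_apply, Pi.one_apply, Pi.sub_apply,
        ContinuousMap.smul_apply, ContinuousMap.sub_apply,
        ContinuousMap.one_apply, smul_eq_mul, mul_one] at h6
      have h7 := mul_le_mul_of_nonneg_left (hpw b m) (sub_nonneg.2 hUs)
      linarith
    have hlo : i + (α - i) * p ≤ (lazyOp hG ^ r) f b' m' := by
      have h5 : i • 1 + (α - i) • posIndicator z ≤ f := by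
        rw [obs_le]
        intro b m
        by_cases hb : b = z
        · subst hb; simpa [posIndicator] using h4 m
        · simpa [posIndicator, hb] using h2 b m
      have h6 := obs_le.1 (lazyOp_pow_mono hG r h5) b' m'
      rw [map_add, map_smul, map_smul, lazyOp_pow_one] at h6
      simp only [Pi.smul_apply, Pi.one_apply, Pi.add_apply,
        ContinuousMap.smul_apply, ContinuousMap.add_apply,
        ContinuousMap.one_apply, smul_eq_mul, mul_one] at h6
      have h7 := mul_le_mul_of_nonneg_left (hpw b' m') (sub_nonneg.2 hαi)
      linarith
    have hp1 : p ≤ 1 := (hpw b m).trans (by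
      refine obs_le_smul_one.1 (lazyOp_pow_le hG (obs_le_smul_one.2 fun b m => ?_) r) b m
      by_cases hb : b = z <;> simp [posIndicator, hb])
    have h8 : 4 * ((1 - p / 2) * c) ≤ 4 * (max γ (1 - p / 2) * c) := by
      have := mul_le_mul_of_nonneg_right (le_max_right γ (1 - p / 2)) hc0
      linarith
    have h9 := mul_le_mul_of_nonneg_right hsi (sub_nonneg.2 hp1)
    have h10 := mul_le_mul_of_nonneg_right hUα hp.le
    nlinarith

lemma ObsLipschitz.exists_osc_lt (hc : G.Preconnected) {f : V → C(stdSimplex ℝ V, ℝ)} {c : ℝ}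
    (hf : ObsLipschitz f c) {ε : ℝ} (hε : 0 < ε) : ∃ j, ObsOsc ((lazyOp hG ^ j) f) ε := by
  obtain ⟨r, γ, hγ1, hγ0, H⟩ := exists_contraction hG hc
  -- Including the norm ensures that the initial oscillation, at most `2 * ‖f‖`, is below `4 * C`.
  set C := max c (‖f‖)
  have hC0 : 0 ≤ C := (norm_nonneg f).trans (le_max_right _ _)
  have hk : ∀ k : ℕ, ObsLipschitz ((lazyOp hG ^ (r * k)) f) (γ ^ k * C) ∧
      ObsOsc ((lazyOp hG ^ (r * k)) f) (4 * (γ ^ k * C)) := by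
    intro k
    induction k with
    | zero =>
      refine ⟨?_, ?_⟩
      · intro b m m'
        simpa using (hf b m m').trans (mul_le_mul_of_nonneg_right (le_max_left _ _) (l1_nonneg _))
      · intro b m b' m'
        have h1 := (abs_le.1 (abs_obs_le f b m)).2
        have h2 := (abs_le.1 (abs_obs_le f b' m')).1
        have h3 : ‖f‖ ≤ C := le_max_right _ _
        simp only [mul_zero, pow_zero, one_apply_eq_self]
        linarith
    | succ k ih =>
      have := H _ (by positivity) _ ih.1 ih.2
      rw [← mul_apply_eq_comp, ← pow_add] at this
      rwa [mul_add_one, pow_succ', mul_assoc, add_comm (r * k)]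
  have hlim : Tendsto (fun k : ℕ => 4 * (γ ^ k * C)) atTop (𝓝 (4 * (0 * C))) :=
    ((tendsto_pow_atTop_nhds_zero_of_lt_one hγ0 hγ1).mul_const C).const_mul 4
  rw [zero_mul, mul_zero] at hlim
  obtain ⟨k, hk'⟩ := (hlim.eventually_lt_const hε).exists
  exact ⟨r * k, fun b m b' m' => ((hk k).2 b m b' m').trans hk'.le⟩

/-- Lipschitz functions on the simplex. -/
noncomputable def lipschitzSubalgebra (V : Type*) [Fintype V] :
    Subalgebra ℝ C(stdSimplex ℝ V, ℝ) where
  carrier := {f | ∃ c, ∀ m m' : stdSimplex ℝ V, |f m - f m'| ≤ c * l1 ((m : V → ℝ) - (m' : V → ℝ))}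
  mul_mem' := by
    rintro f g ⟨c, hf⟩ ⟨c', hg⟩
    refine ⟨‖f‖ * c' + ‖g‖ * c, fun m m' => ?_⟩
    have h1 : |f m * (g m - g m')| ≤ ‖f‖ * (c' * l1 ((m : V → ℝ) - (m' : V → ℝ))) := by
      rw [abs_mul]
      exact mul_le_mul (f.norm_coe_le_norm m) (hg m m') (abs_nonneg _) (norm_nonneg _)
    have h2 : |g m' * (f m - f m')| ≤ ‖g‖ * (c * l1 ((m : V → ℝ) - (m' : V → ℝ))) := by
      rw [abs_mul]
      exact mul_le_mul (g.norm_coe_le_norm m') (hf m m') (abs_nonneg _) (norm_nonneg _)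
    have h3 : (f * g) m - (f * g) m' = f m * (g m - g m') + g m' * (f m - f m') := by
      simp only [ContinuousMap.mul_apply]; ring
    rw [h3]
    refine (abs_add_le _ _).trans ?_
    linarith
  add_mem' := by
    rintro f g ⟨c, hf⟩ ⟨c', hg⟩
    refine ⟨c + c', fun m m' => ?_⟩
    have h3 : (f + g) m - (f + g) m' = (f m - f m') + (g m - g m') := by
      simp only [ContinuousMap.add_apply]; ring
    rw [h3, add_mul]
    exact (abs_add_le _ _).trans (add_le_add (hf m m') (hg m m'))
  algebraMap_mem' a := ⟨0, fun m m' => by simp⟩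

lemma lipschitzSubalgebra_closure : (lipschitzSubalgebra V).topologicalClosure = ⊤ := by
  refine ContinuousMap.subalgebra_topologicalClosure_eq_top_of_separatesPoints _ ?_
  intro m m' hne
  have : ∃ x, (m : V → ℝ) x ≠ (m' : V → ℝ) x := by
    by_contra! h
    exact hne (Subtype.ext (funext h))
  obtain ⟨x, hx⟩ := this
  refine ⟨fun m => (m : V → ℝ) x, ⟨⟨fun m => (m : V → ℝ) x,
    (continuous_apply x).comp continuous_subtype_val⟩, ?_, rfl⟩, hx⟩
  refine ⟨1, fun m m' => ?_⟩
  rw [one_mul]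
  exact Finset.single_le_sum (f := fun x => |((m : V → ℝ) - (m' : V → ℝ)) x|)
    (fun _ _ => abs_nonneg _) (Finset.mem_univ x)

lemma exists_osc_lt (hc : G.Preconnected) (f : V → C(stdSimplex ℝ V, ℝ)) {ε : ℝ} (hε : 0 < ε) :
    ∃ j, ObsOsc ((lazyOp hG ^ j) f) ε := by
  have h1 : ∀ b, ∃ g ∈ lipschitzSubalgebra V, dist (f b) g < ε / 3 := by
    intro b
    have : f b ∈ (lipschitzSubalgebra V).topologicalClosure := by
      rw [lipschitzSubalgebra_closure]; trivial
    exact Metric.mem_closure_iff.1 this _ (by positivity)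
  choose g hg hfg using h1
  replace hg : ∀ b, ∃ c, ∀ m m' : stdSimplex ℝ V,
    |g b m - g b m'| ≤ c * l1 ((m : V → ℝ) - (m' : V → ℝ)) := hg
  choose c hc' using hg
  have hL : ObsLipschitz g (∑ b, |c b|) := fun b m m' =>
    (hc' b m m').trans (mul_le_mul_of_nonneg_right ((le_abs_self _).trans
      (Finset.single_le_sum (f := fun b => |c b|) (fun _ _ => abs_nonneg _) (Finset.mem_univ b)))
      (l1_nonneg _))
  obtain ⟨j, hj⟩ := hL.exists_osc_lt hG hc (ε := ε / 3) (by positivity)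
  have hn : ‖f - g‖ ≤ ε / 3 := by
    rw [pi_norm_le_iff_of_nonneg (by positivity)]
    intro b
    have := (hfg b).le
    rwa [dist_eq_norm] at this
  refine ⟨j, fun b m b' m' => ?_⟩
  have h2 : ∀ b m, |(lazyOp hG ^ j) f b m - (lazyOp hG ^ j) g b m| ≤ ε / 3 := by
    intro b m
    have := abs_lazyOp_pow_le hG (f - g) j b m
    rw [map_sub] at this
    exact this.trans hn
  have h3 := abs_le.1 (h2 b m)
  have h4 := abs_le.1 (h2 b' m')
  have := hj b m b' m'
  linarith [h3.1, h3.2, h4.1, h4.2]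

/-- The lazy chain is uniquely ergodic. -/
lemma exists_tendsto_lazyOp (hc : G.Preconnected) (f : V → C(stdSimplex ℝ V, ℝ)) :
    ∃ a : ℝ, ∀ b m, Tendsto (fun j => (lazyOp hG ^ j) f b m) atTop (𝓝 a) := by
  -- Averaging keeps later iterates between the extremes of the `N`-th one, so small oscillation at
  -- a single time is a Cauchy bound uniform in time and starting state.
  have hclose : ∀ ε > 0, ∃ N, ∀ n ≥ N, ∀ n' ≥ N, ∀ b m b' m',
      |(lazyOp hG ^ n) f b m - (lazyOp hG ^ n') f b' m'| ≤ ε := by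
    intro ε hε
    obtain ⟨N, hN⟩ := exists_osc_lt hG hc f hε
    refine ⟨N, fun n hn n' hn' b m b' m' => ?_⟩
    obtain ⟨b₁, m₁, h1⟩ := exists_obs_max ((lazyOp hG ^ N) f)
    obtain ⟨b₂, m₂, h2⟩ := exists_obs_min ((lazyOp hG ^ N) f)
    have h3 : ∀ n ≥ N, ∀ b m, (lazyOp hG ^ n) f b m ≤ (lazyOp hG ^ N) f b₁ m₁ := by
      intro n hn b m
      obtain ⟨k, rfl⟩ := Nat.exists_eq_add_of_le' hn
      rw [pow_add]
      exact obs_le_smul_one.1 (lazyOp_pow_le hG (obs_le_smul_one.2 h1) k) b m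
    have h4 : ∀ n ≥ N, ∀ b m, (lazyOp hG ^ N) f b₂ m₂ ≤ (lazyOp hG ^ n) f b m := by
      intro n hn b m
      obtain ⟨k, rfl⟩ := Nat.exists_eq_add_of_le' hn
      rw [pow_add]
      exact smul_one_le_obs.1 (le_lazyOp_pow hG (smul_one_le_obs.2 h2) k) b m
    have := hN b₁ m₁ b₂ m₂
    rw [abs_le]
    constructor <;> linarith [h3 n hn b m, h3 n' hn' b' m', h4 n hn b m, h4 n' hn' b' m']
  obtain ⟨m₀⟩ := (inferInstance : Nonempty (stdSimplex ℝ V))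
  set b₀ : V := Classical.arbitrary V
  have hcs : CauchySeq fun j => (lazyOp hG ^ j) f b₀ m₀ := by
    rw [Metric.cauchySeq_iff]
    intro ε hε
    obtain ⟨N, hN⟩ := hclose (ε / 2) (by positivity)
    refine ⟨N, fun n hn n' hn' => ?_⟩
    rw [Real.dist_eq]
    have := hN n hn n' hn' b₀ m₀ b₀ m₀
    linarith
  obtain ⟨a, ha⟩ := cauchySeq_tendsto_of_complete hcs
  refine ⟨a, fun b m => ?_⟩
  have h0 : Tendsto (fun j => (lazyOp hG ^ j) f b m - (lazyOp hG ^ j) f b₀ m₀) atTop (𝓝 0) := by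
    rw [Metric.tendsto_atTop]
    intro ε hε
    obtain ⟨N, hN⟩ := hclose (ε / 2) (by positivity)
    refine ⟨N, fun n hn => ?_⟩
    rw [Real.dist_eq, sub_zero]
    have := hN n hn n hn b m b₀ m₀
    linarith
  simpa using h0.add ha

end Ergodic

end StepOperator

/-! ### Poisson averages of convergent sequences -/

section PoissonAveraging

lemma hasSum_poissonWeight (s : ℝ) :
    HasSum (fun j : ℕ => Real.exp (-s) * (s ^ j / j.factorial)) 1 := by
  have h := (NormedSpace.expSeries_div_hasSum_exp (𝔸 := ℝ) s).mul_left (Real.exp (-s))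
  rwa [← Real.exp_eq_exp_ℝ, ← Real.exp_add, neg_add_cancel, Real.exp_zero] at h

lemma tendsto_poissonWeight (j : ℕ) :
    Tendsto (fun s : ℝ => Real.exp (-s) * (s ^ j / j.factorial)) atTop (𝓝 0) := by
  have h := (Real.tendsto_pow_mul_exp_neg_atTop_nhds_zero j).div_const (j.factorial : ℝ)
  rw [zero_div] at h
  exact h.congr fun s => by ring

lemma summable_poissonWeight_mul {a : ℕ → ℝ} {M : ℝ} (hM : ∀ j, |a j| ≤ M) {s : ℝ} (hs : 0 ≤ s) :
    Summable fun j : ℕ => Real.exp (-s) * (s ^ j / j.factorial) * a j := by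
  refine Summable.of_norm_bounded ((hasSum_poissonWeight s).summable.mul_right M) fun j => ?_
  rw [norm_mul, Real.norm_of_nonneg (by positivity)]
  exact mul_le_mul_of_nonneg_left (hM j) (by positivity)

/-- Poisson averages of a convergent sequence converge to the same limit. -/
lemma tendsto_poissonAverage {a : ℕ → ℝ} {A : ℝ} (ha : Tendsto a atTop (𝓝 A)) :
    Tendsto (fun s : ℝ => ∑' j : ℕ, Real.exp (-s) * (s ^ j / j.factorial) * a j) atTop (𝓝 A) := by
  obtain ⟨M, hM⟩ := (Metric.isBounded_range_of_tendsto a ha).exists_norm_le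
  have hM' : ∀ j, |a j| ≤ M := fun j => hM _ ⟨j, rfl⟩
  rw [Metric.tendsto_nhds]
  intro ε hε
  obtain ⟨J, hJ⟩ := Metric.tendsto_atTop.1 ha (ε / 3) (by positivity)
  set C := M + |A|
  have hC : ∀ j, |a j - A| ≤ C := fun j => (abs_sub _ _).trans (add_le_add (hM' j) le_rfl)
  -- The first `J` Poisson weights vanish as `s` grows; all other terms are already within `ε / 3`
  -- of the limit.
  have hfin : Tendsto (fun s : ℝ => ∑ j ∈ Finset.range J,
      Real.exp (-s) * (s ^ j / j.factorial) * C) atTop (𝓝 0) := by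
    have := tendsto_finsetSum (Finset.range J) fun j _ => (tendsto_poissonWeight j).mul_const C
    simpa using this
  filter_upwards [hfin.eventually_lt_const (show (0 : ℝ) < ε / 3 by positivity),
    eventually_ge_atTop 0] with s h1 hs
  have hw : ∀ j : ℕ, 0 ≤ Real.exp (-s) * (s ^ j / j.factorial) := fun j => by positivity
  have hA : HasSum (fun j : ℕ => Real.exp (-s) * (s ^ j / j.factorial) * A) A := by
    simpa using (hasSum_poissonWeight s).mul_right A
  have hdiff : (∑' j : ℕ, Real.exp (-s) * (s ^ j / j.factorial) * a j) - A =
      ∑' j : ℕ, Real.exp (-s) * (s ^ j / j.factorial) * (a j - A) := by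
    conv_lhs => rw [← hA.tsum_eq]
    rw [← (summable_poissonWeight_mul hM' hs).tsum_sub hA.summable]
    exact tsum_congr fun j => by ring
  have hsum : HasSum (fun j : ℕ => Real.exp (-s) * (s ^ j / j.factorial) * (ε / 3) +
      if j ∈ Finset.range J then Real.exp (-s) * (s ^ j / j.factorial) * C else 0)
      (1 * (ε / 3) + ∑ j ∈ Finset.range J, Real.exp (-s) * (s ^ j / j.factorial) * C) := by
    refine ((hasSum_poissonWeight s).mul_right _).add ?_
    have : HasSum (fun j : ℕ => if j ∈ Finset.range J then
      Real.exp (-s) * (s ^ j / j.factorial) * C else 0) _ :=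
      hasSum_sum_of_ne_finset_zero (s := Finset.range J) fun j hj => if_neg hj
    rwa [Finset.sum_congr rfl fun j hj => if_pos hj] at this
  rw [Real.dist_eq, hdiff, ← Real.norm_eq_abs]
  refine (tsum_of_norm_bounded hsum fun j => ?_).trans_lt (by linarith)
  rw [norm_mul, Real.norm_of_nonneg (hw j), Real.norm_eq_abs]
  by_cases hj : j ∈ Finset.range J
  · rw [if_pos hj]
    have := mul_le_mul_of_nonneg_left (hC j) (hw j)
    have := mul_nonneg (hw j) (show 0 ≤ ε / 3 by positivity)
    linarith
  · rw [if_neg hj, add_zero]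
    have := hJ j (by simpa using hj)
    rw [Real.dist_eq] at this
    exact mul_le_mul_of_nonneg_left this.le (hw j)

end PoissonAveraging

/-! ### Exponentials of the lazy and non-lazy operators -/

section OperatorExponential

variable {E : Type*} [NormedAddCommGroup E] [NormedSpace ℝ E]

lemma commute_half_one_add (K : E →L[ℝ] E) : Commute ((2⁻¹ : ℝ) • (1 + K)) K :=
  ((Commute.one_left K).add_left (Commute.refl K)).smul_left _

variable [CompleteSpace E]

/-- The exponent is t + tK with commuting summands. In probabilistic terms, a rate two clock whose
ticks are ignored half of the time is a rate one clock. -/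
lemma exp_smul_half_one_add (K : E →L[ℝ] E) (t : ℝ) :
    NormedSpace.exp ((2 * t) • ((2⁻¹ : ℝ) • (1 + K))) = Real.exp t • NormedSpace.exp (t • K) := by
  have h1 : (2 * t) • ((2⁻¹ : ℝ) • (1 + K)) = t • (1 : E →L[ℝ] E) + t • K := by
    rw [smul_smul, ← smul_add]; congr 1; ring
  have h2 : Commute (t • (1 : E →L[ℝ] E)) (t • K) :=
    ((Commute.one_left _).smul_left _).smul_right _
  have h3 : NormedSpace.exp (t • (1 : E →L[ℝ] E)) = Real.exp t • (1 : E →L[ℝ] E) := by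
    rw [← Algebra.algebraMap_eq_smul_one, ← NormedSpace.algebraMap_exp_comm,
      ← Real.exp_eq_exp_ℝ, Algebra.algebraMap_eq_smul_one]
  let := NormedAlgebra.restrictScalars ℚ ℝ (E →L[ℝ] E)
  rw [h1, NormedSpace.exp_add_of_commute h2, h3, smul_mul_assoc, one_mul]

lemma hasSum_exp_smul_apply (A : E →L[ℝ] E) (f : E) (ℓ : E →L[ℝ] ℝ) (s : ℝ) :
    HasSum (fun j : ℕ => s ^ j / j.factorial * ℓ ((A ^ j) f))
      (ℓ (NormedSpace.exp (s • A) f)) := by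
  have h := (ℓ.comp (ContinuousLinearMap.apply ℝ E f)).hasSum
    (NormedSpace.exp_series_hasSum_exp' (𝕂 := ℝ) (s • A))
  refine h.congr_fun fun j => ?_
  simp only [smul_pow, ContinuousLinearMap.comp_apply, ContinuousLinearMap.apply_apply,
    map_smul, smul_eq_mul]
  ring

/-- A Poisson number of steps of a chain is a Poisson number, with twice the mean, of steps of the
lazy chain. -/
lemma poissonAverage_half_one_add (K : E →L[ℝ] E) (f : E) (ℓ : E →L[ℝ] ℝ) (t : ℝ) :
    ∑' j : ℕ, Real.exp (-(2 * t)) * ((2 * t) ^ j / j.factorial) *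
        ℓ ((((2⁻¹ : ℝ) • (1 + K)) ^ j) f) =
      ∑' j : ℕ, Real.exp (-t) * (t ^ j / j.factorial) * ℓ ((K ^ j) f) := by
  simp_rw [mul_assoc]
  rw [tsum_mul_left, tsum_mul_left, (hasSum_exp_smul_apply _ _ _ _).tsum_eq,
    (hasSum_exp_smul_apply _ _ _ _).tsum_eq, exp_smul_half_one_add, smul_apply, map_smul,
    smul_eq_mul, ← mul_assoc, ← Real.exp_add]
  congr 2
  ring

end OperatorExponential

/-! ### The stationary functional -/

section StationaryFunctional

variable {V : Type*} [Fintype V] [DecidableEq V] {G : SimpleGraph V} [DecidableRel G.Adj]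
  [Nonempty V] (hG : ∀ v, 0 < G.degree v) (hc : G.Preconnected)

/-- Integration against the stationary law of the chain (walker, configuration). -/
noncomputable def stationary : (V → C(stdSimplex ℝ V, ℝ)) →ₗ[ℝ] ℝ where
  toFun f := (exists_tendsto_lazyOp hG hc f).choose
  map_add' f g := by
    obtain ⟨m⟩ := (inferInstance : Nonempty (stdSimplex ℝ V))
    have h1 := (exists_tendsto_lazyOp hG hc f).choose_spec (Classical.arbitrary V) m
    have h2 := (exists_tendsto_lazyOp hG hc g).choose_spec (Classical.arbitrary V) m
    have h3 := (exists_tendsto_lazyOp hG hc (f + g)).choose_spec (Classical.arbitrary V) m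
    refine tendsto_nhds_unique h3 ((h1.add h2).congr fun j => ?_)
    rw [map_add]; rfl
  map_smul' c f := by
    obtain ⟨m⟩ := (inferInstance : Nonempty (stdSimplex ℝ V))
    have h1 := (exists_tendsto_lazyOp hG hc f).choose_spec (Classical.arbitrary V) m
    have h3 := (exists_tendsto_lazyOp hG hc (c • f)).choose_spec (Classical.arbitrary V) m
    refine tendsto_nhds_unique h3 ((h1.const_mul c).congr fun j => ?_)
    rw [map_smul]; rfl

lemma tendsto_stationary (f : V → C(stdSimplex ℝ V, ℝ)) (b : V) (m : stdSimplex ℝ V) :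
    Tendsto (fun j => (lazyOp hG ^ j) f b m) atTop (𝓝 (stationary hG hc f)) :=
  (exists_tendsto_lazyOp hG hc f).choose_spec b m

lemma stationary_one : stationary hG hc 1 = 1 := by
  obtain ⟨m⟩ := (inferInstance : Nonempty (stdSimplex ℝ V))
  refine tendsto_nhds_unique (tendsto_stationary hG hc 1 (Classical.arbitrary V) m) ?_
  simp only [lazyOp_pow_one]
  exact tendsto_const_nhds

lemma stationary_mono {f g : V → C(stdSimplex ℝ V, ℝ)} (h : f ≤ g) :
    stationary hG hc f ≤ stationary hG hc g := by
  obtain ⟨m⟩ := (inferInstance : Nonempty (stdSimplex ℝ V))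
  exact le_of_tendsto_of_tendsto' (tendsto_stationary hG hc f (Classical.arbitrary V) m)
    (tendsto_stationary hG hc g (Classical.arbitrary V) m)
    fun j => obs_le.1 (lazyOp_pow_mono hG j h) _ _

/-- Invariance under a genuine, non-lazy step: `stepOp` commutes with `lazyOp`, and averaging over
neighbours preserves a limit that is the same at every state. All the stationary moment identities
below come from this. -/
lemma stationary_stepOp (f : V → C(stdSimplex ℝ V, ℝ)) :
    stationary hG hc (stepOp hG f) = stationary hG hc f := by
  obtain ⟨m⟩ := (inferInstance : Nonempty (stdSimplex ℝ V))
  set b := Classical.arbitrary V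
  have hcomm : ∀ j, (lazyOp hG ^ j) (stepOp hG f) = stepOp hG ((lazyOp hG ^ j) f) := by
    intro j
    have : Commute (lazyOp hG ^ j) (stepOp hG) :=
      Commute.pow_left (commute_half_one_add (stepOp hG)) j
    exact congrArg (fun A => A f) this.eq
  refine tendsto_nhds_unique (tendsto_stationary hG hc (stepOp hG f) b m) ?_
  simp_rw [hcomm, stepOp_apply]
  rw [← nbrAvg_const hG b (stationary hG hc f)]
  exact (tendsto_finsetSum _ fun v _ => tendsto_stationary hG hc f v _).const_mul _

/-- The continuous time chain converges to stationarity. -/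
lemma tendsto_poissonAverage_stepOp (f : V → C(stdSimplex ℝ V, ℝ)) (b : V) (m : stdSimplex ℝ V) :
    Tendsto (fun t : ℝ => ∑' j : ℕ,
      Real.exp (-t) * (t ^ j / j.factorial) * (stepOp hG ^ j) f b m) atTop
      (𝓝 (stationary hG hc f)) := by
  let ev : (V → C(stdSimplex ℝ V, ℝ)) →L[ℝ] ℝ :=
    (ContinuousMap.evalCLM ℝ m).comp
      (ContinuousLinearMap.proj (R := ℝ) (φ := fun _ : V => C(stdSimplex ℝ V, ℝ)) b)
  exact ((tendsto_poissonAverage (tendsto_stationary hG hc f b m)).comp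
    (tendsto_id.const_mul_atTop (two_pos (α := ℝ)))).congr
    fun t => poissonAverage_half_one_add (stepOp hG) f ev t

end StationaryFunctional

/-! ### Exponential holding times give Poisson counts -/

section ExponentialHoldingTimes

open scoped ENNReal

/-- The function `u ↦ u ^ j` on the nonnegative half-line, extended by zero. -/
noncomputable def truncPow (j : ℕ) (u : ℝ) : ℝ := if 0 ≤ u then u ^ j else 0

lemma measurable_truncPow (j : ℕ) : Measurable (truncPow j) :=
  Measurable.ite measurableSet_Ici (measurable_id.pow_const j) measurable_const

lemma lintegral_expMeasure_one {g : ℝ → ℝ≥0∞} (hg : Measurable g) :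
    ∫⁻ s, g s ∂(expMeasure 1) = ∫⁻ s in Set.Ici 0, ENNReal.ofReal (Real.exp (-s)) * g s := by
  have h : expMeasure 1 = volume.withDensity (exponentialPDF 1) := rfl
  have hm : Measurable (exponentialPDF 1) := (measurable_exponentialPDFReal 1).ennreal_ofReal
  rw [h, lintegral_withDensity_eq_lintegral_mul _ hm hg, ← lintegral_indicator measurableSet_Ici]
  refine lintegral_congr fun s => ?_
  by_cases hs : 0 ≤ s
  · simp [exponentialPDF_of_nonneg hs, hs]
  · simp [exponentialPDF_of_neg (not_le.1 hs), hs]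

lemma ae_expMeasure_nonneg : ∀ᵐ s ∂(expMeasure 1), 0 ≤ s := by
  have h : expMeasure 1 {s | ¬ 0 ≤ s} = 0 := by
    have hm : MeasurableSet {s : ℝ | ¬ 0 ≤ s} := measurableSet_Ici.compl
    rw [← lintegral_indicator_one hm, lintegral_expMeasure_one (measurable_one.indicator hm)]
    refine (setLIntegral_congr_fun measurableSet_Ici fun s hs => ?_).trans lintegral_zero
    simp [Set.mem_Ici.1 hs]
  exact h

/-- The factor `Real.exp s` cancels the exponential density and leaves the integral of (u - s)^j
over [0, u]. -/
lemma lintegral_truncPow_expMeasure (j : ℕ) (u : ℝ) :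
    ∫⁻ s, ENNReal.ofReal (truncPow j (u - s) * Real.exp s) ∂(expMeasure 1) =
      ENNReal.ofReal (truncPow (j + 1) u / (j + 1)) := by
  have hm : Measurable fun s => ENNReal.ofReal (truncPow j (u - s) * Real.exp s) :=
    (((measurable_truncPow j).comp (measurable_const.sub measurable_id)).mul
      Real.measurable_exp).ennreal_ofReal
  rw [lintegral_expMeasure_one hm]
  have h1 : ∀ s ∈ Set.Ici (0 : ℝ), ENNReal.ofReal (Real.exp (-s)) *
      ENNReal.ofReal (truncPow j (u - s) * Real.exp s) =
      (Set.Iic u).indicator (fun s => ENNReal.ofReal ((u - s) ^ j)) s := by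
    intro s _
    rw [← ENNReal.ofReal_mul (Real.exp_nonneg _)]
    have : Real.exp (-s) * (truncPow j (u - s) * Real.exp s) = truncPow j (u - s) := by
      rw [mul_comm, mul_assoc, ← Real.exp_add]; simp
    rw [this]
    by_cases hs : s ≤ u <;> simp [truncPow, hs]
  rw [setLIntegral_congr_fun measurableSet_Ici h1, lintegral_indicator measurableSet_Iic,
    Measure.restrict_restrict measurableSet_Iic, Set.Iic_inter_Ici]
  by_cases hu : 0 ≤ u
  · rw [← ofReal_integral_eq_lintegral_ofReal, integral_Icc_eq_integral_Ioc,
      ← intervalIntegral.integral_of_le hu,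
      intervalIntegral.integral_comp_sub_left (fun s => s ^ j)]
    · simp [truncPow, hu]
    · exact (Continuous.integrableOn_Icc (by fun_prop))
    · refine (ae_restrict_iff' measurableSet_Icc).2 (Eventually.of_forall fun s hs => ?_)
      exact pow_nonneg (sub_nonneg.2 hs.2) j
  · simp [truncPow, hu]

lemma expMeasure_Ioi {u : ℝ} (hu : 0 ≤ u) :
    expMeasure 1 (Set.Ioi u) = ENNReal.ofReal (Real.exp (-u)) := by
  have := isProbabilityMeasure_expMeasure (r := 1) one_pos
  rw [← Set.compl_Iic, prob_compl_eq_one_sub measurableSet_Iic]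
  have h := cdf_expMeasure_eq (r := 1) one_pos u
  rw [if_pos hu, one_mul, cdf_eq_real] at h
  rw [← ENNReal.ofReal_toReal (measure_ne_top (expMeasure 1) (Set.Iic u)), ← measureReal_def, h,
    ← ENNReal.ofReal_one, ← ENNReal.ofReal_sub _ (by simpa using hu)]
  simp

variable {Ω : Type*} [MeasurableSpace Ω] {P : Measure Ω} [IsProbabilityMeasure P]
  {τ : ℕ → Ω → ℝ}

lemma lintegral_partialSum_succ (hτm : ∀ k, Measurable (τ k))
    (hlaw : ∀ k, HasLaw (τ k) (expMeasure 1) P) (hind : iIndepFun τ P) (k : ℕ)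
    {F : ℝ × ℝ → ℝ≥0∞} (hF : Measurable F) :
    ∫⁻ ω, F (∑ i ∈ Finset.range k, τ i ω, τ k ω) ∂P =
      ∫⁻ ω, ∫⁻ s, F (∑ i ∈ Finset.range k, τ i ω, s) ∂(expMeasure 1) ∂P := by
  have := isProbabilityMeasure_expMeasure (r := 1) one_pos
  have hS : Measurable fun ω => ∑ i ∈ Finset.range k, τ i ω :=
    Finset.measurable_sum _ fun i _ => hτm i
  have hi : IndepFun (fun ω => ∑ i ∈ Finset.range k, τ i ω) (τ k) P := by
    have h := hind.indepFun_finsetSum_of_notMem hτm (s := Finset.range k) (i := k) (by simp)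
    convert h using 1
    ext ω; simp
  have hmap := (indepFun_iff_map_prod_eq_prod_map_map hS.aemeasurable (hτm k).aemeasurable).1 hi
  rw [(hlaw k).map_eq] at hmap
  have : IsProbabilityMeasure (P.map fun ω => ∑ i ∈ Finset.range k, τ i ω) :=
    Measure.isProbabilityMeasure_map hS.aemeasurable
  rw [← lintegral_map hF (hS.prodMk (hτm k)), hmap, lintegral_prod _ hF.aemeasurable,
    lintegral_map (Measurable.lintegral_prod_right' hF) hS]

/-- With the weight e^{S_k}, each further holding time merely raises the power by one, so the
induction on `k` closes when `j` is left free and no density of the partial sums is required. -/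
lemma lintegral_truncPow_partialSum (hτm : ∀ k, Measurable (τ k))
    (hlaw : ∀ k, HasLaw (τ k) (expMeasure 1) P) (hind : iIndepFun τ P) {t : ℝ} (ht : 0 ≤ t)
    (k : ℕ) : ∀ j : ℕ,
    ∫⁻ ω, ENNReal.ofReal (truncPow j (t - ∑ i ∈ Finset.range k, τ i ω) *
      Real.exp (∑ i ∈ Finset.range k, τ i ω)) ∂P =
      ENNReal.ofReal (t ^ (k + j) * (j.factorial / (k + j).factorial)) := by
  induction k with
  | zero =>
    intro j
    have : ((j.factorial : ℝ)) ≠ 0 := by exact_mod_cast j.factorial_ne_zero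
    simp [truncPow, ht, this]
  | succ k ih =>
    intro j
    have h := lintegral_partialSum_succ hτm hlaw hind k
      (F := fun p => ENNReal.ofReal (truncPow j (t - (p.1 + p.2)) * Real.exp (p.1 + p.2)))
      ((((measurable_truncPow j).comp (by fun_prop)).mul (by fun_prop)).ennreal_ofReal)
    simp only at h
    simp_rw [Finset.sum_range_succ]
    rw [h]
    have h2 : ∀ x : ℝ, ∫⁻ s, ENNReal.ofReal (truncPow j (t - (x + s)) * Real.exp (x + s))
        ∂(expMeasure 1) = ENNReal.ofReal ((j + 1 : ℝ)⁻¹) *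
          ENNReal.ofReal (truncPow (j + 1) (t - x) * Real.exp x) := by
      intro x
      have h3 : ∀ s, ENNReal.ofReal (truncPow j (t - (x + s)) * Real.exp (x + s)) =
          ENNReal.ofReal (Real.exp x) * ENNReal.ofReal (truncPow j (t - x - s) * Real.exp s) := by
        intro s
        rw [← ENNReal.ofReal_mul (Real.exp_nonneg _), Real.exp_add, sub_add_eq_sub_sub]
        congr 1; ring
      simp_rw [h3]
      rw [lintegral_const_mul' _ _ ENNReal.ofReal_ne_top, lintegral_truncPow_expMeasure,
        ← ENNReal.ofReal_mul (Real.exp_nonneg _), ← ENNReal.ofReal_mul (by positivity)]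
      congr 1; ring
    simp_rw [h2]
    rw [lintegral_const_mul' _ _ ENNReal.ofReal_ne_top, ih (j + 1),
      ← ENNReal.ofReal_mul (by positivity)]
    congr 1
    rw [show k + (j + 1) = k + 1 + j by ring, Nat.factorial_succ j]
    have : ((k + 1 + j).factorial : ℝ) ≠ 0 := by exact_mod_cast (Nat.factorial_ne_zero _)
    push_cast
    field_simp

/-- The number of arrivals of a rate one Poisson process has a Poisson law. -/
lemma measure_arrivals_eq (hτm : ∀ k, Measurable (τ k))
    (hlaw : ∀ k, HasLaw (τ k) (expMeasure 1) P) (hind : iIndepFun τ P) {t : ℝ} (ht : 0 ≤ t)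
    (k : ℕ) :
    P {ω | ∑ i ∈ Finset.range k, τ i ω ≤ t ∧ t < ∑ i ∈ Finset.range (k + 1), τ i ω} =
      ENNReal.ofReal (Real.exp (-t) * (t ^ k / k.factorial)) := by
  have hS : ∀ k, Measurable fun ω => ∑ i ∈ Finset.range k, τ i ω := fun k =>
    Finset.measurable_sum _ fun i _ => hτm i
  have hA : MeasurableSet {p : ℝ × ℝ | p.1 ≤ t ∧ t < p.1 + p.2} :=
    (measurableSet_le measurable_fst measurable_const).inter
      (measurableSet_lt measurable_const (measurable_fst.add measurable_snd))
  have hE : MeasurableSet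
      {ω | ∑ i ∈ Finset.range k, τ i ω ≤ t ∧ t < ∑ i ∈ Finset.range (k + 1), τ i ω} :=
    (measurableSet_le (hS k) measurable_const).inter (measurableSet_lt measurable_const (hS _))
  have h := lintegral_partialSum_succ hτm hlaw hind k (F := Set.indicator _ 1)
    (measurable_one.indicator hA)
  -- After an arrival at `x ≤ t` the next holding time exceeds `t - x` with probability e^{-(t -
  -- x)}; this reduces the claim to the identity above with `j = 0`.
  have h2 : ∀ x : ℝ, ∫⁻ s, Set.indicator {p : ℝ × ℝ | p.1 ≤ t ∧ t < p.1 + p.2} 1 (x, s)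
      ∂(expMeasure 1) =
      ENNReal.ofReal (Real.exp (-t)) * ENNReal.ofReal (truncPow 0 (t - x) * Real.exp x) := by
    intro x
    by_cases hx : x ≤ t
    · have h3 : ∀ s : ℝ, Set.indicator {p : ℝ × ℝ | p.1 ≤ t ∧ t < p.1 + p.2} (1 : ℝ × ℝ → ℝ≥0∞)
          (x, s) = (Set.Ioi (t - x)).indicator 1 s := by
        intro s
        simp only [Set.indicator, Set.mem_ofPred_eq, Set.mem_Ioi, hx, true_and, Pi.one_apply,
          sub_lt_iff_lt_add']
      simp_rw [h3]
      rw [lintegral_indicator_one measurableSet_Ioi, expMeasure_Ioi (sub_nonneg.2 hx),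
        ← ENNReal.ofReal_mul (Real.exp_nonneg _)]
      simp only [truncPow, sub_nonneg.2 hx, if_true, pow_zero, one_mul, ← Real.exp_add]
      congr 2; ring
    · simp [truncPow, hx]
  simp_rw [h2] at h
  rw [lintegral_const_mul' _ _ ENNReal.ofReal_ne_top,
    lintegral_truncPow_partialSum hτm hlaw hind ht, ← ENNReal.ofReal_mul (Real.exp_nonneg _)] at h
  rw [← lintegral_indicator_one hE]
  simp only [add_zero, Nat.factorial_zero, Nat.cast_one, mul_one_div] at h
  rw [← h]
  refine lintegral_congr fun ω => ?_
  simp [Set.indicator, Finset.sum_range_succ]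

end ExponentialHoldingTimes

/-! ### The law of the configuration at time t -/

section WalkLaw

variable {V : Type*} [Fintype V] [DecidableEq V] {G : SimpleGraph V} [DecidableRel G.Adj]
  (hG : ∀ v, 0 < G.degree v)

/-- The mass configuration after `k` jumps, as a point of the simplex. -/
noncomputable def simplexAfterJumps (m₀ : stdSimplex ℝ V) (b : ℕ → V) : ℕ → stdSimplex ℝ V
  | 0 => m₀
  | k + 1 => redistributeSimplex hG (b (k + 1)) (simplexAfterJumps m₀ b k)

lemma coe_simplexAfterJumps (m₀ : stdSimplex ℝ V) (b : ℕ → V) (k : ℕ) :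
    (simplexAfterJumps hG m₀ b k : V → ℝ) = massAfterJumps G m₀ b k := by
  induction k with
  | zero => rfl
  | succ k ih => rw [simplexAfterJumps, coe_redistributeSimplex, ih, massAfterJumps]

lemma simplexAfterJumps_congr (m₀ : stdSimplex ℝ V) {b b' : ℕ → V} {k : ℕ}
    (h : ∀ i ≤ k, b i = b' i) : simplexAfterJumps hG m₀ b k = simplexAfterJumps hG m₀ b' k := by
  induction k with
  | zero => rfl
  | succ k ih =>
    rw [simplexAfterJumps, simplexAfterJumps, ih fun i hi => h i (by omega), h _ le_rfl]

/-- The sequence following the finite path `y` and then constantly equal to `v`. -/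
def extendPath {k : ℕ} (y : Fin (k + 1) → V) (v : V) : ℕ → V :=
  fun i => if h : i < k + 1 then y ⟨i, h⟩ else v

lemma extendPath_of_le {k : ℕ} (y : Fin (k + 1) → V) (v : V) {i : ℕ} (hi : i ≤ k) :
    extendPath y v i = y ⟨i, Nat.lt_succ_of_le hi⟩ := dif_pos _

lemma extendPath_succ {k : ℕ} (y : Fin (k + 1) → V) (v : V) : extendPath y v (k + 1) = v :=
  dif_neg (lt_irrefl _)

lemma norm_stepOp_pow_le (j : ℕ) (f : V → C(stdSimplex ℝ V, ℝ)) :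
    ‖(stepOp hG ^ j) f‖ ≤ ‖f‖ := by
  induction j with
  | zero => simp
  | succ j ih =>
    rw [pow_succ', mul_apply_eq_comp]
    refine (ContinuousLinearMap.le_of_opNorm_le _
      (LinearMap.mkContinuous_norm_le _ zero_le_one _) _).trans ?_
    rwa [one_mul]

variable [MeasurableSpace V] [MeasurableSingletonClass V]

/-- Only the first `k + 1` positions matter and they range over a finite set, so nothing has to be
assumed of `f`. -/
lemma measurable_simplexAfterJumps {β : Type*} [MeasurableSpace β] (m₀ : stdSimplex ℝ V) (k : ℕ)
    (f : V → stdSimplex ℝ V → β) :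
    Measurable fun b : ℕ → V => f (b k) (simplexAfterJumps hG m₀ b k) := by
  have h : (fun b : ℕ → V => f (b k) (simplexAfterJumps hG m₀ b k)) =
      (fun y : Fin (k + 1) → V => f (y (Fin.last k))
        (simplexAfterJumps hG m₀ (extendPath y (y (Fin.last k))) k)) ∘
        fun (b : ℕ → V) (i : Fin (k + 1)) => b i := by
    ext b
    simp only [Function.comp_apply, Fin.val_last]
    congr 1
    exact simplexAfterJumps_congr hG m₀ fun i hi => by rw [extendPath_of_le _ _ hi]
  rw [h]
  exact (measurable_of_finite _).comp (measurable_pi_lambda _ fun i => measurable_pi_apply _)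

variable {Ω : Type*} [MeasurableSpace Ω] {P : Measure Ω} [IsProbabilityMeasure P]

lemma integral_comp_of_finite {α : Type*} [Fintype α] [MeasurableSpace α]
    [MeasurableSingletonClass α] {Z : Ω → α} (hZ : Measurable Z) (H : α → ℝ) :
    ∫ ω, H (Z ω) ∂P = ∑ z, P.real (Z ⁻¹' {z}) * H z := by
  have := Measure.isProbabilityMeasure_map (μ := P) hZ.aemeasurable
  rw [← integral_map hZ.aemeasurable (measurable_of_finite H).aestronglyMeasurable,
    integral_fintype (Integrable.of_finite)]
  refine Finset.sum_congr rfl fun z _ => ?_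
  rw [map_measureReal_apply hZ (measurableSet_singleton z), smul_eq_mul]

variable {B : ℝ → Ω → V} {T : ℕ → Ω → ℝ}

/-- The Markov property of the jump chain, in terms of the transition operator. -/
lemma IsSimpleRandomWalk.integral_succ (h : IsSimpleRandomWalk G P B T) (m₀ : stdSimplex ℝ V)
    (f : V → C(stdSimplex ℝ V, ℝ)) (k : ℕ) :
    ∫ ω, f (B (T (k + 1) ω) ω) (simplexAfterJumps hG m₀ (fun i => B (T i ω) ω) (k + 1)) ∂P =
      ∫ ω, stepOp hG f (B (T k ω) ω) (simplexAfterJumps hG m₀ (fun i => B (T i ω) ω) k) ∂P := by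
  set Φ : Ω → Fin (k + 1) → V := fun ω i => B (T i ω) ω with hΦ
  have hΦm : Measurable Φ := measurable_pi_lambda _ fun i => h.measurable_skeleton i
  set S : (Fin (k + 1) → V) → stdSimplex ℝ V := fun y =>
    simplexAfterJumps hG m₀ (extendPath y (y (Fin.last k))) k with hS
  have hSΦ : ∀ ω, simplexAfterJumps hG m₀ (fun i => B (T i ω) ω) k = S (Φ ω) := fun ω =>
    simplexAfterJumps_congr hG m₀ fun i hi => by rw [extendPath_of_le _ _ hi]
  have hl : ∀ ω, simplexAfterJumps hG m₀ (fun i => B (T i ω) ω) (k + 1) =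
      redistributeSimplex hG (B (T (k + 1) ω) ω) (S (Φ ω)) := fun ω => by
    rw [simplexAfterJumps, hSΦ]
  have hlast : ∀ ω, B (T k ω) ω = Φ ω (Fin.last k) := fun ω => rfl
  simp_rw [hl, hSΦ, hlast]
  rw [integral_comp_of_finite (Z := fun ω => (Φ ω, B (T (k + 1) ω) ω))
    (hΦm.prodMk (h.measurable_skeleton _)) fun z => f z.2 (redistributeSimplex hG z.2 (S z.1)),
    integral_comp_of_finite hΦm fun y => stepOp hG f (y (Fin.last k)) (S y),
    Fintype.sum_prod_type]
  refine Finset.sum_congr rfl fun y _ => ?_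
  -- `skeleton_markov` speaks of infinite sequences but tests only an initial segment, so it is
  -- applied to the finite path `y` continued by `v`.
  have hP : ∀ v, P.real ((fun ω => (Φ ω, B (T (k + 1) ω) ω)) ⁻¹' {(y, v)}) =
      P.real (Φ ⁻¹' {y}) * (if G.Adj (y (Fin.last k)) v then
        (G.degree (y (Fin.last k)) : ℝ)⁻¹ else 0) := by
    intro v
    have h1 := h.skeleton_markov k (extendPath y v)
    have h2 : {ω | ∀ i ≤ k, B (T i ω) ω = extendPath y v i} = Φ ⁻¹' {y} := by
      ext ω
      simp only [Set.mem_ofPred_eq, Set.mem_preimage, Set.mem_singleton_iff, funext_iff, hΦ]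
      constructor
      · intro h3 i
        rw [h3 i (Nat.le_of_lt_succ i.2), extendPath_of_le _ _ (Nat.le_of_lt_succ i.2)]
      · intro h3 i hi
        rw [extendPath_of_le _ _ hi, ← h3]
    have h4 : {ω | ∀ i ≤ k + 1, B (T i ω) ω = extendPath y v i} =
        (fun ω => (Φ ω, B (T (k + 1) ω) ω)) ⁻¹' {(y, v)} := by
      ext ω
      have h5 : ω ∈ {ω | ∀ i ≤ k, B (T i ω) ω = extendPath y v i} ↔ ω ∈ Φ ⁻¹' {y} := by rw [h2]
      simp only [Set.mem_ofPred_eq, Set.mem_preimage, Set.mem_singleton_iff, Prod.mk.injEq] at h5 ⊢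
      rw [← h5]
      constructor
      · intro h6
        exact ⟨fun i hi => h6 i (by omega), by rw [h6 _ le_rfl, extendPath_succ]⟩
      · rintro ⟨h6, h7⟩ i hi
        rcases Nat.le_or_eq_of_le_succ hi with h8 | rfl
        · exact h6 i h8
        · rw [h7, extendPath_succ]
    rw [h2, h4, extendPath_of_le _ _ le_rfl, extendPath_succ] at h1
    exact h1
  simp only [hP]
  rw [stepOp_apply, nbrAvg, Finset.mul_sum, Finset.mul_sum, ← Finset.sum_filter_add_sum_filter_not
    Finset.univ (fun v => G.Adj (y (Fin.last k)) v)]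
  rw [Finset.sum_eq_zero (s := Finset.univ.filter fun v => ¬ G.Adj (y (Fin.last k)) v) (by
    intro v hv; rw [if_neg (Finset.mem_filter.1 hv).2]; ring), add_zero]
  refine Finset.sum_congr ?_ fun v hv => ?_
  · ext v; simp
  · rw [if_pos (by simpa using hv)]; ring

lemma IsSimpleRandomWalk.integral_skeleton (h : IsSimpleRandomWalk G P B T)
    (m₀ : stdSimplex ℝ V) (k : ℕ) : ∀ f : V → C(stdSimplex ℝ V, ℝ),
    ∫ ω, f (B (T k ω) ω) (simplexAfterJumps hG m₀ (fun i => B (T i ω) ω) k) ∂P =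
      ∑ b, P.real {ω | B (T 0 ω) ω = b} * (stepOp hG ^ k) f b m₀ := by
  induction k with
  | zero =>
    intro f
    simp only [simplexAfterJumps, pow_zero, one_apply_eq_self]
    exact integral_comp_of_finite (h.measurable_skeleton 0) fun b => f b m₀
  | succ k ih =>
    intro f
    rw [h.integral_succ hG, ih, pow_succ]
    rfl

lemma measurable_jumpCount (hT : ∀ k, Measurable (T k)) (t : ℝ) : Measurable (jumpCount T t) := by
  have hA : ∀ s : Finset ℕ, MeasurableSet {ω | {k : ℕ | 1 ≤ k ∧ T k ω ≤ t} = ↑s} := by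
    intro s
    have : {ω | {k : ℕ | 1 ≤ k ∧ T k ω ≤ t} = ↑s} =
        ⋂ k : ℕ, {ω | (1 ≤ k ∧ T k ω ≤ t) ↔ k ∈ s} := by
      ext ω
      simp [Set.ext_iff]
    rw [this]
    refine MeasurableSet.iInter fun k => ?_
    have h1 : MeasurableSet {ω | 1 ≤ k ∧ T k ω ≤ t} :=
      (MeasurableSet.const _).inter (measurableSet_le (hT k) measurable_const)
    by_cases hk : k ∈ s
    · simpa [hk] using h1
    · have h2 := h1.compl
      simp only [hk, iff_false]
      exact h2
  have hpos : ∀ n : ℕ, n ≠ 0 → MeasurableSet {ω | jumpCount T t ω = n} := by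
    intro n hn
    have : {ω | jumpCount T t ω = n} =
        ⋃ s : Finset ℕ, ⋃ _ : s.card = n, {ω | {k : ℕ | 1 ≤ k ∧ T k ω ≤ t} = ↑s} := by
      ext ω
      simp only [Set.mem_ofPred_eq, Set.mem_iUnion, exists_prop, jumpCount]
      constructor
      · intro h1
        have hfin := Set.finite_of_ncard_ne_zero (h1 ▸ hn)
        exact ⟨hfin.toFinset, by rw [← h1, Set.ncard_eq_toFinset_card _ hfin], by simp⟩
      · rintro ⟨s, hs, h1⟩
        rw [h1, Set.ncard_coe_finset, hs]
    rw [this]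
    exact MeasurableSet.iUnion fun s => MeasurableSet.iUnion fun _ => hA s
  refine measurable_to_countable' fun n => ?_
  -- `Set.ncard` is also zero on infinite sets, so the fibre over zero is obtained as the complement
  -- of all the others.
  by_cases hn : n = 0
  · subst hn
    have : jumpCount T t ⁻¹' {0} = (⋃ n : ℕ, ⋃ _ : n ≠ 0, {ω | jumpCount T t ω = n})ᶜ := by
      ext ω
      simp only [Set.mem_preimage, Set.mem_singleton_iff, Set.mem_compl_iff, Set.mem_iUnion,
        Set.mem_ofPred_eq, exists_prop, not_exists, not_and]
      exact ⟨fun h1 n hn h2 => hn (h2.symm.trans h1), fun h1 => by_contra fun h2 => h1 _ h2 rfl⟩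
    rw [this]
    exact (MeasurableSet.iUnion fun n => MeasurableSet.iUnion fun hn => hpos n hn).compl
  · exact hpos n hn

lemma jumpCount_eq {ω : Ω} {t : ℝ} {j : ℕ} (hmono : Monotone fun k => T k ω) (h1 : T j ω ≤ t)
    (h2 : t < T (j + 1) ω) : jumpCount T t ω = j := by
  have : {k : ℕ | 1 ≤ k ∧ T k ω ≤ t} = ↑(Finset.Icc 1 j) := by
    ext k
    simp only [Set.mem_ofPred_eq, Finset.coe_Icc, Set.mem_Icc]
    refine and_congr_right fun _ => ⟨fun h3 => ?_, fun h3 => (hmono h3).trans h1⟩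
    by_contra h4
    exact absurd ((hmono (not_le.1 h4 : j + 1 ≤ k)).trans h3) (not_le.2 h2)
  rw [jumpCount, this, Set.ncard_coe_finset]
  simp

lemma IsSimpleRandomWalk.ae_monotone (h : IsSimpleRandomWalk G P B T) :
    ∀ᵐ ω ∂P, Monotone fun k => T k ω := by
  have h1 : ∀ k, ∀ᵐ ω ∂P, 0 ≤ T (k + 1) ω - T k ω := fun k =>
    ((h.holding_law k).ae_iff (p := fun x => 0 ≤ x) (measurableSet_setOfPred.1 measurableSet_Ici)).2
      ae_expMeasure_nonneg
  filter_upwards [ae_all_iff.2 h1] with ω hω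
  exact monotone_nat_of_le_succ fun k => sub_nonneg.1 (hω k)

lemma IsSimpleRandomWalk.ae_jumpTime_eq (h : IsSimpleRandomWalk G P B T) :
    ∀ᵐ ω ∂P, ∀ k, T k ω = ∑ i ∈ Finset.range k, (T (i + 1) ω - T i ω) := by
  filter_upwards [h.jumpTime_zero] with ω hω k
  rw [Finset.sum_range_sub (fun i => T i ω), hω, sub_zero]

lemma IsSimpleRandomWalk.measure_between (h : IsSimpleRandomWalk G P B T) {t : ℝ} (ht : 0 ≤ t)
    (j : ℕ) : P {ω | T j ω ≤ t ∧ t < T (j + 1) ω} =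
      ENNReal.ofReal (Real.exp (-t) * (t ^ j / j.factorial)) := by
  rw [← measure_arrivals_eq (fun k => (h.measurable_jumpTime (k + 1)).sub (h.measurable_jumpTime k))
    h.holding_law h.holding_indep ht j]
  refine measure_congr ?_
  filter_upwards [h.ae_jumpTime_eq] with ω hω
  exact propext (and_congr (by rw [hω j]; rfl) (by rw [hω (j + 1)]; rfl))

/-- Up to a null set the event depends only on the holding times, and the integrand only on the jump
chain; their independence factorises the integral. -/
lemma IsSimpleRandomWalk.setIntegral_between (h : IsSimpleRandomWalk G P B T) {t : ℝ} (ht : 0 ≤ t)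
    (m₀ : stdSimplex ℝ V) (f : C(stdSimplex ℝ V, ℝ)) (j : ℕ) :
    ∫ ω in {ω | T j ω ≤ t ∧ t < T (j + 1) ω},
        f (simplexAfterJumps hG m₀ (fun k => B (T k ω) ω) j) ∂P =
      Real.exp (-t) * (t ^ j / j.factorial) *
        ∫ ω, f (simplexAfterJumps hG m₀ (fun k => B (T k ω) ω) j) ∂P := by
  set E := {ω | T j ω ≤ t ∧ t < T (j + 1) ω} with hE
  have hEm : MeasurableSet E := (measurableSet_le (h.measurable_jumpTime j) measurable_const).inter
    (measurableSet_lt measurable_const (h.measurable_jumpTime _))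
  set A : Set (ℕ → ℝ) := {τ | ∑ i ∈ Finset.range j, τ i ≤ t ∧ t < ∑ i ∈ Finset.range (j + 1), τ i}
  have hA : MeasurableSet A :=
    (measurableSet_le (Finset.measurable_sum _ fun i _ => measurable_pi_apply i)
      measurable_const).inter
      (measurableSet_lt measurable_const (Finset.measurable_sum _ fun i _ => measurable_pi_apply i))
  have hY := measurable_simplexAfterJumps hG m₀ j fun _ m => f m
  have hX : Measurable fun ω (k : ℕ) => B (T k ω) ω :=
    measurable_pi_lambda _ fun k => h.measurable_skeleton k
  have hτ : Measurable fun ω (k : ℕ) => T (k + 1) ω - T k ω :=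
    measurable_pi_lambda _ fun k => (h.measurable_jumpTime (k + 1)).sub (h.measurable_jumpTime k)
  have hA1 : Measurable (A.indicator fun _ => (1 : ℝ)) := measurable_const.indicator hA
  have hi := (h.skeleton_indep_holding.comp hY hA1).integral_fun_mul_eq_mul_integral
    (hY.comp hX).aestronglyMeasurable (hA1.comp hτ).aestronglyMeasurable
  have hae : (fun ω => A.indicator (fun _ => (1 : ℝ)) fun k => T (k + 1) ω - T k ω) =ᵐ[P]
      E.indicator fun _ => 1 := by
    filter_upwards [h.ae_jumpTime_eq] with ω hω
    have : ((fun k => T (k + 1) ω - T k ω) ∈ A) ↔ ω ∈ E := by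
      simp only [hE, A, Set.mem_ofPred_eq]
      rw [← hω j, ← hω (j + 1)]
    by_cases h1 : ω ∈ E
    · rw [Set.indicator_of_mem h1, Set.indicator_of_mem (this.2 h1)]
    · rw [Set.indicator_of_notMem h1, Set.indicator_of_notMem fun h2 => h1 (this.1 h2)]
  simp only [Function.comp_apply] at hi
  rw [integral_congr_ae hae, integral_indicator_const _ hEm, smul_eq_mul, mul_one,
    measureReal_def, h.measure_between ht,
    ENNReal.toReal_ofReal (by positivity)] at hi
  rw [← integral_indicator hEm, mul_comm, ← hi]
  refine integral_congr_ae ?_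
  filter_upwards [hae] with ω hω
  rw [hω]
  by_cases h1 : ω ∈ E <;> simp [h1]

lemma IsSimpleRandomWalk.integral_atTime (h : IsSimpleRandomWalk G P B T) {t : ℝ} (ht : 0 ≤ t)
    (m₀ : stdSimplex ℝ V) (f : C(stdSimplex ℝ V, ℝ)) :
    ∫ ω, f (simplexAfterJumps hG m₀ (fun k => B (T k ω) ω) (jumpCount T t ω)) ∂P =
      ∑' j : ℕ, Real.exp (-t) * (t ^ j / j.factorial) *
        ∫ ω, f (simplexAfterJumps hG m₀ (fun k => B (T k ω) ω) j) ∂P := by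
  set E : ℕ → Set Ω := fun j => {ω | T j ω ≤ t ∧ t < T (j + 1) ω} with hE
  have hEm : ∀ j, MeasurableSet (E j) := fun j =>
    (measurableSet_le (h.measurable_jumpTime j) measurable_const).inter
    (measurableSet_lt measurable_const (h.measurable_jumpTime _))
  have hdis : Pairwise (Function.onFun (AEDisjoint P) E) := by
    have key : ∀ i j, i < j → AEDisjoint P (E i) (E j) := by
      intro i j hij
      refine measure_eq_zero_iff_ae_notMem.2 ?_
      filter_upwards [h.ae_monotone] with ω hω hmem
      have h1 := hmem.1.2
      have h2 := hmem.2.1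
      have h3 : T (i + 1) ω ≤ T j ω := hω hij
      linarith
    intro i j hij
    rcases lt_or_gt_of_ne hij with h1 | h1
    · exact key i j h1
    · exact (key j i h1).symm
  -- The Poisson weights sum to one, so `t` almost surely falls between two consecutive jumps; this
  -- also excludes explosion.
  have hone : P (⋃ j, E j) = 1 := by
    rw [measure_iUnion₀ hdis fun j => (hEm j).nullMeasurableSet]
    simp_rw [hE, h.measure_between ht]
    rw [← ENNReal.ofReal_tsum_of_nonneg (fun j => by positivity) (hasSum_poissonWeight t).summable,
      (hasSum_poissonWeight t).tsum_eq, ENNReal.ofReal_one]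
  have hmeas : Measurable fun ω =>
      f (simplexAfterJumps hG m₀ (fun k => B (T k ω) ω) (jumpCount T t ω)) := by
    have h1 : Measurable fun p : Ω × ℕ =>
        f (simplexAfterJumps hG m₀ (fun k => B (T k p.1) p.1) p.2) :=
      measurable_from_prod_countable_left fun j =>
        (measurable_simplexAfterJumps hG m₀ j fun _ m => f m).comp
          (measurable_pi_lambda _ fun k => h.measurable_skeleton k)
    exact h1.comp (measurable_id.prodMk (measurable_jumpCount h.measurable_jumpTime t))
  have hint : Integrable (fun ω =>
      f (simplexAfterJumps hG m₀ (fun k => B (T k ω) ω) (jumpCount T t ω))) P :=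
    Integrable.of_bound hmeas.aestronglyMeasurable ‖f‖
      (Eventually.of_forall fun ω => f.norm_coe_le_norm _)
  have hfull : ∫ ω, f (simplexAfterJumps hG m₀ (fun k => B (T k ω) ω) (jumpCount T t ω)) ∂P =
      ∫ ω in ⋃ j, E j,
        f (simplexAfterJumps hG m₀ (fun k => B (T k ω) ω) (jumpCount T t ω)) ∂P := by
    rw [Measure.restrict_eq_self_of_ae_mem]
    exact (prob_compl_eq_zero_iff (MeasurableSet.iUnion hEm)).2 hone
  rw [hfull, integral_iUnion_ae (fun j => (hEm j).nullMeasurableSet) hdis hint.integrableOn]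
  refine tsum_congr fun j => ?_
  rw [← h.setIntegral_between hG ht]
  refine setIntegral_congr_ae (hEm j) ?_
  filter_upwards [h.ae_monotone] with ω hω hmem
  rw [jumpCount_eq hω hmem.1 hmem.2]

/-- The law of the mass configuration converges, as time goes to infinity, to the marginal of the
stationary law of the chain. -/
theorem IsSimpleRandomWalk.tendsto_integral (h : IsSimpleRandomWalk G P B T) [Nonempty V]
    (hc : G.Preconnected) (m₀ : stdSimplex ℝ V) (f : C(stdSimplex ℝ V, ℝ)) :
    Tendsto (fun t => ∫ ω,
      f (simplexAfterJumps hG m₀ (fun k => B (T k ω) ω) (jumpCount T t ω)) ∂P) atTop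
      (𝓝 (stationary hG hc fun _ => f)) := by
  have hp : ∑ b, P.real {ω | B (T 0 ω) ω = b} = 1 := by
    have := integral_comp_of_finite (P := P) (h.measurable_skeleton 0) fun _ => 1
    simp only [integral_const, probReal_univ, smul_eq_mul, mul_one] at this
    exact this.symm
  have hlim : Tendsto (fun t : ℝ => ∑ b, P.real {ω | B (T 0 ω) ω = b} * ∑' j : ℕ,
      Real.exp (-t) * (t ^ j / j.factorial) * (stepOp hG ^ j) (fun _ => f) b m₀) atTop
      (𝓝 (∑ b, P.real {ω | B (T 0 ω) ω = b} * stationary hG hc fun _ => f)) :=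
    tendsto_finsetSum _ fun b _ => (tendsto_poissonAverage_stepOp hG hc _ b m₀).const_mul _
  rw [← Finset.sum_mul, hp, one_mul] at hlim
  refine hlim.congr' ?_
  filter_upwards [eventually_ge_atTop 0] with t ht
  rw [h.integral_atTime hG ht]
  simp_rw [h.integral_skeleton hG m₀ _ fun _ => f, Finset.mul_sum]
  have hbd : ∀ (j : ℕ) b, |(stepOp hG ^ j) (fun _ => f) b m₀| ≤ ‖(fun _ : V => f)‖ :=
    fun j b => (abs_obs_le _ b m₀).trans (norm_stepOp_pow_le hG j _)
  rw [Summable.tsum_finsetSum]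
  · refine Finset.sum_congr rfl fun b _ => ?_
    rw [← tsum_mul_left]
    exact tsum_congr fun j => by ring
  · intro b _
    have := (summable_poissonWeight_mul (fun j => hbd j b) ht).mul_left
      (P.real {ω | B (T 0 ω) ω = b})
    exact this.congr fun j => by ring

end WalkLaw

/-! ### The Green function of a finite Cayley graph and its gradient -/

section Corrector

variable {V : Type*} [Fintype V] [DecidableEq V] {G : SimpleGraph V} [DecidableRel G.Adj]

lemma harmonic_const (hG : ∀ v, 0 < G.degree v) (hc : G.Preconnected) {h : V → ℝ}
    (hh : ∀ x, nbrAvg G x h = h x) (x y : V) : h x = h y := by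
  have : Nonempty V := ⟨x⟩
  obtain ⟨x₀, hx₀⟩ := Finite.exists_max h
  have key : ∀ {a b : V}, G.Walk a b → h a = h x₀ → h b = h x₀ := by
    intro a b p
    induction p with
    | nil => exact id
    | @cons u v w huv p ih =>
      intro hu
      refine ih (le_antisymm (hx₀ v) (not_lt.1 fun hv => ?_))
      have := nbrAvg_lt hG huv hx₀ hv
      rw [hh, hu] at this
      exact lt_irrefl _ this
  rw [key (hc x₀ x).some rfl, key (hc x₀ y).some rfl]

variable [AddCommGroup V] {S : Finset V}

lemma neighborFinset_eq_image (hS : ∀ x y, G.Adj x y ↔ y - x ∈ S) (b : V) :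
    G.neighborFinset b = S.image (b + ·) := by
  ext y
  simp only [SimpleGraph.mem_neighborFinset, hS, Finset.mem_image]
  exact ⟨fun h => ⟨y - b, h, by abel⟩, by rintro ⟨s, hs, rfl⟩; simpa using hs⟩

lemma sum_neighborFinset {M : Type*} [AddCommMonoid M] (hS : ∀ x y, G.Adj x y ↔ y - x ∈ S)
    (b : V) (g : V → M) : ∑ v ∈ G.neighborFinset b, g v = ∑ s ∈ S, g (b + s) := by
  rw [neighborFinset_eq_image hS, Finset.sum_image fun x _ y _ h => add_left_cancel h]

lemma degree_eq_card (hS : ∀ x y, G.Adj x y ↔ y - x ∈ S) (b : V) : G.degree b = S.card := by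
  rw [← SimpleGraph.card_neighborFinset_eq_degree, neighborFinset_eq_image hS,
    Finset.card_image_of_injective _ (add_right_injective b)]

lemma nbrAvg_eq (hS : ∀ x y, G.Adj x y ↔ y - x ∈ S) (b : V) (g : V → ℝ) :
    nbrAvg G b g = (S.card : ℝ)⁻¹ * ∑ s ∈ S, g (b + s) := by
  rw [nbrAvg, degree_eq_card hS, sum_neighborFinset hS]

lemma neg_mem_of_mem (hS : ∀ x y, G.Adj x y ↔ y - x ∈ S) {s : V} (hs : s ∈ S) : -s ∈ S := by
  have : G.Adj s 0 := SimpleGraph.Adj.symm (by rw [hS]; simpa using hs)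
  simpa [hS] using this

lemma sum_neg_comp {M : Type*} [AddCommMonoid M] (hS : ∀ x y, G.Adj x y ↔ y - x ∈ S)
    (g : V → M) : ∑ s ∈ S, g (-s) = ∑ s ∈ S, g s :=
  Finset.sum_bij' (fun s _ => -s) (fun s _ => -s) (fun _ h => neg_mem_of_mem hS h)
    (fun _ h => neg_mem_of_mem hS h) (fun _ _ => neg_neg _) (fun _ _ => neg_neg _) fun _ _ => rfl

lemma sum_nbrAvg (hG : ∀ v, 0 < G.degree v) (hS : ∀ x y, G.Adj x y ↔ y - x ∈ S) (g : V → ℝ) :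
    ∑ x, nbrAvg G x g = ∑ x, g x := by
  have hD : (S.card : ℝ) ≠ 0 := by
    rw [← degree_eq_card hS 0]; exact_mod_cast (hG 0).ne'
  simp_rw [nbrAvg_eq hS, ← Finset.mul_sum]
  rw [Finset.sum_comm]
  have : ∀ s ∈ S, ∑ x, g (x + s) = ∑ x, g x := fun s _ =>
    Fintype.sum_equiv (Equiv.addRight s) _ _ fun x => rfl
  rw [Finset.sum_congr rfl this, Finset.sum_const, nsmul_eq_mul, ← mul_assoc, inv_mul_cancel₀ hD,
    one_mul]

/-- Adding the total sum to the Laplacian kills its kernel, the constants, and makes it bijective.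
Summing over all vertices shows that the extra term vanishes when the right-hand side has sum zero.
-/
lemma exists_laplacian_eq (hG : ∀ v, 0 < G.degree v) (hc : G.Preconnected)
    (hS : ∀ x y, G.Adj x y ↔ y - x ∈ S) {g : V → ℝ} (hg : ∑ x, g x = 0) :
    ∃ h : V → ℝ, ∀ x, nbrAvg G x h - h x = g x := by
  have hN : (Fintype.card V : ℝ) ≠ 0 := by
    exact_mod_cast Fintype.card_ne_zero
  let T : (V → ℝ) →ₗ[ℝ] (V → ℝ) :=
    { toFun := fun h x => nbrAvg G x h - h x + ∑ z, h z
      map_add' := fun h h' => by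
        ext x
        have : nbrAvg G x (h + h') = nbrAvg G x h + nbrAvg G x h' := nbrAvg_add x h h'
        simp only [this, Pi.add_apply, Finset.sum_add_distrib]; ring
      map_smul' := fun c h => by
        ext x
        have : nbrAvg G x (c • h) = c * nbrAvg G x h := nbrAvg_mul_left x c h
        simp only [this, Pi.smul_apply, smul_eq_mul, ← Finset.mul_sum, RingHom.id_apply]; ring }
  have hT : ∀ h x, T h x = nbrAvg G x h - h x + ∑ z, h z := fun _ _ => rfl
  have hsum : ∀ h, ∑ x, T h x = Fintype.card V * ∑ z, h z := by
    intro h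
    simp_rw [hT]
    rw [Finset.sum_add_distrib, Finset.sum_sub_distrib, sum_nbrAvg hG hS, sub_self, zero_add]
    simp
  have hinj : Function.Injective T := by
    rw [← LinearMap.ker_eq_bot, LinearMap.ker_eq_bot']
    intro h hh
    have h0 : ∑ z, h z = 0 := by
      have := hsum h
      rw [hh] at this
      simpa [hN] using this.symm
    have hharm : ∀ x, nbrAvg G x h = h x := fun x => by
      have := congrFun hh x
      rw [hT, h0] at this
      simpa [sub_eq_zero] using this
    ext x
    have : ∑ z, h z = Fintype.card V * h x := by
      rw [Finset.sum_congr rfl fun z _ => harmonic_const hG hc hharm z x]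
      simp
    rw [h0] at this
    simpa [hN] using this.symm
  obtain ⟨h, hh⟩ := LinearMap.injective_iff_surjective.1 hinj g
  refine ⟨h, fun x => ?_⟩
  have h0 : ∑ z, h z = 0 := by
    have := hsum h
    rw [hh, hg] at this
    simpa [hN] using this.symm
  have := congrFun hh x
  rwa [hT, h0, add_zero] at this

/-- The normalised Green function: it is `-1` at the origin and has mean zero on its neighbours. -/
def IsCorrector (G : SimpleGraph V) [DecidableRel G.Adj] (h : V → ℝ) : Prop :=
  h 0 = -1 ∧ ∀ x, nbrAvg G x h - h x =
    (if x = 0 then (Fintype.card V : ℝ) * ((Fintype.card V : ℝ) - 1)⁻¹ else 0) -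
      ((Fintype.card V : ℝ) - 1)⁻¹

lemma exists_isCorrector (hG : ∀ v, 0 < G.degree v) (hc : G.Preconnected)
    (hS : ∀ x y, G.Adj x y ↔ y - x ∈ S) : ∃ h, IsCorrector G h := by
  obtain ⟨h, hh⟩ := exists_laplacian_eq hG hc hS (g := fun x =>
    (if x = 0 then (Fintype.card V : ℝ) * ((Fintype.card V : ℝ) - 1)⁻¹ else 0) -
      ((Fintype.card V : ℝ) - 1)⁻¹) (by simp)
  refine ⟨fun x => h x + (-1 - h 0), by ring, fun x => ?_⟩
  rw [← hh x, nbrAvg_add, nbrAvg_const hG]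
  ring

variable {h : V → ℝ}

lemma one_lt_card_of_degree_pos (hG : ∀ v, 0 < G.degree v) : (1 : ℝ) < Fintype.card V := by
  obtain ⟨v, hv⟩ := (G.degree_pos_iff_exists_adj 0).1 (hG 0)
  exact_mod_cast Fintype.one_lt_card_iff.2 ⟨0, v, hv.ne⟩

/-- Flux through a level set: minus the Laplacian of `h` is at most 1/(N - 1) everywhere, so its sum
over {h ≥ h x} is at most N/(N - 1) ≤ 2. This sum dominates the outflow across the boundary, to
which the edge from `x` to `y` contributes (h x - h y)/|S|. The bound does not involve the size of
the graph. -/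
lemma IsCorrector.sub_le (hG : ∀ v, 0 < G.degree v) (hS : ∀ x y, G.Adj x y ↔ y - x ∈ S)
    (hh : IsCorrector G h) {x y : V} (hxy : G.Adj x y) : h x - h y ≤ 2 * S.card := by
  have hN := one_lt_card_of_degree_pos hG
  have hN2 : (2 : ℝ) ≤ Fintype.card V := by
    have : 1 < Fintype.card V := by exact_mod_cast hN
    exact_mod_cast this
  have hcard : ∀ A : Finset V, (A.card : ℝ) ≤ Fintype.card V := fun A => by
    exact_mod_cast Finset.card_le_univ A
  have hΔ := hh.2
  set N := (Fintype.card V : ℝ)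
  have hD : (0 : ℝ) < S.card := by
    rw [← degree_eq_card hS 0]; exact_mod_cast hG 0
  have hD1 : (1 : ℝ) ≤ S.card := by exact_mod_cast (Nat.cast_pos.1 hD)
  rcases le_or_gt (h x) (h y) with hle | hlt
  · linarith
  set A : Finset V := Finset.univ.filter fun z => h x ≤ h z with hA
  set u : V → ℝ := fun z => max (h z) (h x) with hu
  have h1 : ∑ z ∈ A, (h z - nbrAvg G z h) ≤ N * (N - 1)⁻¹ := by
    have hc0 : 0 < (N - 1)⁻¹ := inv_pos.2 (by linarith)
    calc ∑ z ∈ A, (h z - nbrAvg G z h) ≤ ∑ z ∈ A, (N - 1)⁻¹ := by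
          refine Finset.sum_le_sum fun z _ => ?_
          have h2 := hΔ z
          have h3 : 0 ≤ (if z = 0 then N * (N - 1)⁻¹ else 0) := by split_ifs <;> positivity
          linarith
      _ = A.card * (N - 1)⁻¹ := by simp
      _ ≤ N * (N - 1)⁻¹ := by
          exact mul_le_mul_of_nonneg_right (hcard A) hc0.le
  have h2 : N * (N - 1)⁻¹ ≤ 2 := by
    rw [← div_eq_mul_inv, div_le_iff₀ (by linarith)]
    linarith
  have h3 : ∑ z, (u z - nbrAvg G z u) = 0 := by
    rw [Finset.sum_sub_distrib, sum_nbrAvg hG hS, sub_self]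
  -- Outside `A` the truncation `u` is at its minimum; since the total is zero, the part over `A` is
  -- nonnegative.
  have h4 : ∑ z ∈ Finset.univ.filter (fun z => ¬ h x ≤ h z), (u z - nbrAvg G z u) ≤ 0 := by
    refine Finset.sum_nonpos fun z hz => ?_
    have hz' := not_le.1 (Finset.mem_filter.1 hz).2
    have h5 : u z = h x := max_eq_right hz'.le
    have h6 : h x ≤ nbrAvg G z u := by
      rw [← nbrAvg_const hG z (h x)]
      exact nbrAvg_mono z fun v => le_max_right _ _
    linarith
  have h5 : 0 ≤ ∑ z ∈ A, (u z - nbrAvg G z u) := by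
    have := Finset.sum_filter_add_sum_filter_not Finset.univ (fun z => h x ≤ h z)
      fun z => u z - nbrAvg G z u
    rw [h3] at this
    linarith
  have hmono : ∀ z, nbrAvg G z h ≤ nbrAvg G z u := fun z => nbrAvg_mono z fun v => le_max_left _ _
  have hx : (S.card : ℝ)⁻¹ * (h x - h y) ≤ nbrAvg G x u - nbrAvg G x h := by
    have h6 : nbrAvg G x u - nbrAvg G x h = nbrAvg G x fun v => u v - h v := by
      simp [nbrAvg, mul_sub]
    rw [h6, nbrAvg, degree_eq_card hS]
    refine mul_le_mul_of_nonneg_left ?_ (by positivity)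
    have h7 : h x - h y = u y - h y := by rw [hu]; simp [hlt.le]
    rw [h7]
    exact Finset.single_le_sum (f := fun v => u v - h v)
      (fun v _ => sub_nonneg.2 (le_max_left _ _)) (by simpa using hxy)
  have h6 : nbrAvg G x u - nbrAvg G x h ≤ ∑ z ∈ A, (nbrAvg G z u - nbrAvg G z h) :=
    Finset.single_le_sum (f := fun z => nbrAvg G z u - nbrAvg G z h)
      (fun z _ => sub_nonneg.2 (hmono z)) (by simp [hA])
  have h7 : ∑ z ∈ A, (h z - nbrAvg G z h) =
      ∑ z ∈ A, (u z - nbrAvg G z u) + ∑ z ∈ A, (nbrAvg G z u - nbrAvg G z h) := by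
    rw [← Finset.sum_add_distrib]
    refine Finset.sum_congr rfl fun z hz => ?_
    have : u z = h z := max_eq_left (Finset.mem_filter.1 hz).2
    rw [this]; ring
  have h8 : (S.card : ℝ)⁻¹ * (h x - h y) ≤ 2 := by linarith
  rw [inv_mul_le_iff₀ hD] at h8
  linarith

lemma IsCorrector.abs_le_of_walk (hG : ∀ v, 0 < G.degree v) (hS : ∀ x y, G.Adj x y ↔ y - x ∈ S)
    (hh : IsCorrector G h) {x : V} (p : G.Walk 0 x) : |h x| ≤ 1 + 2 * S.card * p.length := by
  have key : ∀ {a b : V} (p : G.Walk a b), |h a - h b| ≤ 2 * S.card * p.length := by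
    intro a b p
    induction p with
    | nil => simp
    | @cons u v w huv p ih =>
      have h1 := hh.sub_le hG hS huv
      have h2 := hh.sub_le hG hS huv.symm
      have h3 := abs_le.1 ih
      rw [SimpleGraph.Walk.length_cons, abs_le]
      push_cast
      constructor <;> linarith [h3.1, h3.2]
  have h1 := abs_le.1 (key p)
  rw [hh.1] at h1
  rw [abs_le]
  constructor <;> linarith [h1.1, h1.2]

/-- The Laplacian at the origin equals 1, which `h 0 = -1` exactly offsets. Hence a push at the
walker's vertex raises the `h`-weighted mass by exactly the mass pushed. -/
lemma IsCorrector.sum_generators (hG : ∀ v, 0 < G.degree v) (hS : ∀ x y, G.Adj x y ↔ y - x ∈ S)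
    (hh : IsCorrector G h) : ∑ s ∈ S, h s = 0 := by
  have hN := one_lt_card_of_degree_pos hG
  have hD : (S.card : ℝ) ≠ 0 := by
    rw [← degree_eq_card hS 0]; exact_mod_cast (hG 0).ne'
  have h1 := hh.2 0
  rw [if_pos rfl, hh.1, nbrAvg_eq hS] at h1
  have h2 : (Fintype.card V : ℝ) * ((Fintype.card V : ℝ) - 1)⁻¹ -
      ((Fintype.card V : ℝ) - 1)⁻¹ = 1 := by
    have : (Fintype.card V : ℝ) - 1 ≠ 0 := by linarith
    field_simp
  rw [h2] at h1
  have h3 : (S.card : ℝ)⁻¹ * ∑ s ∈ S, h (0 + s) = 0 := by linarith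
  simpa [hD] using h3

/-- By symmetry of `S`, moving the walker acts on `h (x - b)` as the Laplacian of `h` at `x - b`. -/
lemma IsCorrector.nbrAvg_sub (hS : ∀ x y, G.Adj x y ↔ y - x ∈ S) (hh : IsCorrector G h) (b x : V) :
    nbrAvg G b (fun v => h (x - v)) = h (x - b) +
      ((if x = b then (Fintype.card V : ℝ) * ((Fintype.card V : ℝ) - 1)⁻¹ else 0) -
      ((Fintype.card V : ℝ) - 1)⁻¹) := by
  have h1 := hh.2 (x - b)
  simp only [sub_eq_zero] at h1
  rw [← h1, nbrAvg_eq hS, nbrAvg_eq hS, ← sum_neg_comp hS]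
  have : ∀ s, x - (b + -s) = x - b + s := fun s => by abel
  simp only [this]
  ring

end Corrector

/-! ### Second moments of Fourier modes under the stationary law -/

section FourierMode

variable {V : Type*} [Fintype V] [DecidableEq V] {G : SimpleGraph V} [DecidableRel G.Adj]

@[fun_prop]
lemma continuous_coord (x : V) : Continuous fun m : stdSimplex ℝ V => m x :=
  (continuous_apply x).comp continuous_subtype_val

lemma sum_mul_redistribute_complex (v : V) (f : V → ℂ) (m : V → ℝ) :
    ∑ x, f x * redistribute G v m x =
      ∑ x, f x * m x + m v * ((G.degree v : ℂ)⁻¹ * ∑ x ∈ G.neighborFinset v, f x - f v) := by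
  have hre := sum_mul_redistribute (G := G) v (fun x => (f x).re) m
  have him := sum_mul_redistribute (G := G) v (fun x => (f x).im) m
  have hcast : ((G.degree v : ℂ))⁻¹ = (((G.degree v : ℝ)⁻¹ : ℝ) : ℂ) := by push_cast; rfl
  rw [hcast]
  apply Complex.ext
  · simpa using hre
  · simpa using him

/-- The Fourier coefficient of a mass configuration with respect to `φ`. -/
noncomputable def massFourier (φ : V → ℂ) (m : V → ℝ) : ℂ := ∑ x, φ x * m x

lemma norm_sum_mul_le {C : ℝ} {f : V → ℂ} (hf : ∀ x, ‖f x‖ ≤ C) (m : stdSimplex ℝ V) :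
    ‖∑ x, f x * ((m x : ℝ) : ℂ)‖ ≤ C := by
  refine (norm_sum_le _ _).trans ?_
  calc ∑ x, ‖f x * ((m x : ℝ) : ℂ)‖ ≤ ∑ x, C * m x := by
        refine Finset.sum_le_sum fun x _ => ?_
        rw [norm_mul, Complex.norm_real, Real.norm_of_nonneg (stdSimplex.zero_le m x)]
        exact mul_le_mul_of_nonneg_right (hf x) (stdSimplex.zero_le m x)
    _ = C := by rw [← Finset.mul_sum, stdSimplex.sum_eq_one, mul_one]

variable [AddCommGroup V] {S : Finset V}

/-- The Fourier coefficient relative to the walker, weighted by the corrector. -/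
noncomputable def weightedFourier (h : V → ℝ) (φ : V → ℂ) (b : V) (m : V → ℝ) : ℂ :=
  ∑ x, ((h (x - b) : ℂ) * φ x) * m x

/-- The mass at the position of the walker. -/
noncomputable def massAtWalker : V → C(stdSimplex ℝ V, ℝ) := fun b => ⟨fun m => m b, by fun_prop⟩

/-- The mean mass at the next position of the walker. -/
noncomputable def massAhead (G : SimpleGraph V) [DecidableRel G.Adj] : V → C(stdSimplex ℝ V, ℝ) :=
  fun b => ⟨fun m => nbrAvg G b fun v => m v, by unfold nbrAvg; fun_prop⟩

noncomputable def normSqFourier (φ : V → ℂ) : C(stdSimplex ℝ V, ℝ) :=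
  ⟨fun m => ‖massFourier φ m‖ ^ 2, by unfold massFourier; fun_prop⟩

noncomputable def crossFourier (h : V → ℝ) (φ : V → ℂ) : V → C(stdSimplex ℝ V, ℝ) :=
  fun b => ⟨fun m => (starRingEnd ℂ (massFourier φ m) * weightedFourier h φ b m).re, by
    unfold massFourier weightedFourier; fun_prop⟩

noncomputable def weightedMass (h : V → ℝ) : V → C(stdSimplex ℝ V, ℝ) :=
  fun b => ⟨fun m => ∑ x, h (x - b) * m x, by fun_prop⟩

variable (hG : ∀ v, 0 < G.degree v) (hc : G.Preconnected)

/-- The vertex just reached by the walker has just been emptied. -/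
lemma stationary_massAtWalker : stationary hG hc massAtWalker = 0 := by
  rw [← stationary_stepOp]
  have : stepOp hG massAtWalker = 0 := by
    ext b m
    rw [stepOp_apply]
    simp only [massAtWalker, ContinuousMap.coe_mk, coe_redistributeSimplex]
    refine Eq.trans ?_ (nbrAvg_const hG b 0)
    congr 1
    ext v
    simp [redistribute]
  rw [this, map_zero]

variable {h : V → ℝ}

/-- Balance for the `h`-weighted mass seen from the walker: the push adds the mass ahead, while
moving the origin subtracts 1/(N - 1) and adds a multiple of the mass at the walker, which has mean
zero. -/
lemma stationary_massAhead (hS : ∀ x y, G.Adj x y ↔ y - x ∈ S) (hh : IsCorrector G h) :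
    stationary hG hc (massAhead G) = ((Fintype.card V : ℝ) - 1)⁻¹ := by
  set c := ((Fintype.card V : ℝ) - 1)⁻¹ with hcdef
  have key : stepOp hG (weightedMass h) = weightedMass h - c • 1 +
      ((Fintype.card V : ℝ) * c) • massAtWalker + massAhead G := by
    ext b m
    have hv : ∀ v, weightedMass h v (redistributeSimplex hG v m) =
        (∑ x, h (x - v) * m x) + m v := by
      intro v
      have h1 := sum_mul_redistribute (G := G) v (fun x => h (x - v)) m
      simp only [sum_neighborFinset hS, add_sub_cancel_left, hh.sum_generators hG hS, sub_self,
        hh.1, mul_zero, zero_sub, neg_neg, mul_one] at h1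
      simpa [weightedMass, coe_redistributeSimplex] using h1
    rw [stepOp_apply]
    simp_rw [hv]
    rw [nbrAvg_add]
    have h2 : nbrAvg G b (fun v => ∑ x, h (x - v) * m x) =
        ∑ x, nbrAvg G b (fun v => h (x - v)) * m x := by
      simp only [nbrAvg, Finset.mul_sum, Finset.sum_mul]
      rw [Finset.sum_comm]
      exact Finset.sum_congr rfl fun x _ => Finset.sum_congr rfl fun v _ => by ring
    rw [h2]
    simp_rw [hh.nbrAvg_sub hS, ← hcdef, add_mul, sub_mul, Finset.sum_add_distrib,
      Finset.sum_sub_distrib, ← Finset.mul_sum, stdSimplex.sum_eq_one, ite_mul, zero_mul]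
    simp only [Finset.sum_ite_eq', Finset.mem_univ, if_true, Pi.add_apply, Pi.sub_apply,
      Pi.smul_apply, Pi.one_apply, ContinuousMap.add_apply, ContinuousMap.sub_apply,
      ContinuousMap.smul_apply, ContinuousMap.one_apply, smul_eq_mul, weightedMass, massAtWalker,
      massAhead, ContinuousMap.coe_mk]
    ring
  have h1 := stationary_stepOp hG hc (weightedMass h)
  rw [key, map_add, map_add, map_sub, map_smul, map_smul, stationary_one,
    stationary_massAtWalker] at h1
  simp only [smul_eq_mul, mul_one, mul_zero, add_zero] at h1
  linarith

variable {φ : V → ℂ} {ε C : ℝ} {κ : ℂ}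

lemma massFourier_redistribute (hS : ∀ x y, G.Adj x y ↔ y - x ∈ S)
    (hadd : ∀ x y, φ (x + y) = φ x * φ y)
    (hε : (S.card : ℂ)⁻¹ * ∑ s ∈ S, φ s = 1 - ε) (v : V) (m : V → ℝ) :
    massFourier φ (redistribute G v m) = massFourier φ m - ε * m v * φ v := by
  rw [massFourier, sum_mul_redistribute_complex, sum_neighborFinset hS, degree_eq_card hS]
  simp_rw [hadd, ← Finset.mul_sum]
  rw [mul_left_comm, hε, massFourier]
  ring

/-- The 1 comes from `h 0 = -1`; `κ` is the defect caused by `φ` not being constant on the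
generators. -/
lemma weightedFourier_redistribute (hS : ∀ x y, G.Adj x y ↔ y - x ∈ S)
    (hadd : ∀ x y, φ (x + y) = φ x * φ y) (hh : IsCorrector G h)
    (hκ : κ = (S.card : ℂ)⁻¹ * ∑ s ∈ S, h s * φ s) (v : V) (m : V → ℝ) :
    weightedFourier h φ v (redistribute G v m) =
      weightedFourier h φ v m + (1 + κ) * m v * φ v := by
  have h1 : ∑ s ∈ S, (h (v + s - v) : ℂ) * φ (v + s) = φ v * ∑ s ∈ S, h s * φ s := by
    rw [Finset.mul_sum]
    refine Finset.sum_congr rfl fun s _ => ?_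
    rw [add_sub_cancel_left, hadd]; ring
  rw [weightedFourier, sum_mul_redistribute_complex, sum_neighborFinset hS, degree_eq_card hS, h1,
    mul_left_comm, ← hκ, sub_self, hh.1, weightedFourier]
  push_cast
  ring

lemma nbrAvg_re_weightedFourier (hS : ∀ x y, G.Adj x y ↔ y - x ∈ S) (hh : IsCorrector G h)
    (z : ℂ) (b : V) (m : V → ℝ) :
    nbrAvg G b (fun v => (z * weightedFourier h φ v m).re) =
      (z * weightedFourier h φ b m).re +
        ((Fintype.card V : ℝ) * ((Fintype.card V : ℝ) - 1)⁻¹) * (z * φ b).re * m b -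
        ((Fintype.card V : ℝ) - 1)⁻¹ * (z * massFourier φ m).re := by
  have h1 : ∀ v, (z * weightedFourier h φ v m).re = ∑ x, h (x - v) * ((z * φ x).re * m x) := by
    intro v
    rw [weightedFourier, Finset.mul_sum, Complex.re_sum]
    refine Finset.sum_congr rfl fun x _ => ?_
    simp only [Complex.mul_re, Complex.mul_im, Complex.ofReal_re, Complex.ofReal_im]
    ring
  have h2 : (z * massFourier φ m).re = ∑ x, (z * φ x).re * m x := by
    rw [massFourier, Finset.mul_sum, Complex.re_sum]
    refine Finset.sum_congr rfl fun x _ => ?_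
    simp only [Complex.mul_re, Complex.mul_im, Complex.ofReal_re, Complex.ofReal_im]
    ring
  have h3 : nbrAvg G b (fun v => ∑ x, h (x - v) * ((z * φ x).re * m x)) =
      ∑ x, nbrAvg G b (fun v => h (x - v)) * ((z * φ x).re * m x) := by
    simp only [nbrAvg, Finset.mul_sum, Finset.sum_mul]
    rw [Finset.sum_comm]
    exact Finset.sum_congr rfl fun x _ => Finset.sum_congr rfl fun v _ => by ring
  simp_rw [h1, h2, h3, hh.nbrAvg_sub hS, add_mul, sub_mul, Finset.sum_add_distrib,
    Finset.sum_sub_distrib, ite_mul, zero_mul, ← Finset.mul_sum]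
  simp only [Finset.sum_ite_eq', Finset.mem_univ, if_true]
  ring

/-- One-step drift of the combined second order functional. -/
lemma stepOp_functional_le (hS : ∀ x y, G.Adj x y ↔ y - x ∈ S)
    (hadd : ∀ x y, φ (x + y) = φ x * φ y) (hnorm : ∀ x, ‖φ x‖ = 1) (hh : IsCorrector G h)
    (hε : (S.card : ℂ)⁻¹ * ∑ s ∈ S, φ s = 1 - ε) (hε0 : 0 ≤ ε)
    (hκ : κ = (S.card : ℂ)⁻¹ * ∑ s ∈ S, h s * φ s) (hC : ∀ x, |h x| ≤ C) :
    stepOp hG ((2 * ε) • crossFourier h φ + fun _ => normSqFourier φ) ≤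
      (2 * ε) • crossFourier h φ + (fun _ => normSqFourier φ) -
        (2 * ε * ((Fintype.card V : ℝ) - 1)⁻¹) • (fun _ => normSqFourier φ) +
        (2 * ε * ((Fintype.card V : ℝ) * ((Fintype.card V : ℝ) - 1)⁻¹)) • massAtWalker +
        (2 * ε * ‖κ‖ + 2 * ε ^ 2 * C + ε ^ 2) • massAhead G := by
  rw [obs_le]
  intro b m
  have hN := one_lt_card_of_degree_pos hG
  set c := ((Fintype.card V : ℝ) - 1)⁻¹ with hcdef
  have hc0 : 0 ≤ c := inv_nonneg.2 (by linarith)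
  set M := massFourier φ m with hM
  have hM1 : ‖M‖ ≤ 1 := norm_sum_mul_le (fun x => (hnorm x).le) m
  have hC0 : 0 ≤ C := (abs_nonneg _).trans (hC 0)
  set A := 2 * ε * ‖κ‖ + 2 * ε ^ 2 * C + ε ^ 2 with hA
  have hstep : ∀ v, ((2 * ε) • crossFourier h φ + fun _ => normSqFourier φ :
        V → C(stdSimplex ℝ V, ℝ)) v
      (redistributeSimplex hG v m) ≤
      (2 * ε * (starRingEnd ℂ M * weightedFourier h φ v m).re + ‖M‖ ^ 2) + A * m v := by
    intro v
    have hm0 : 0 ≤ m v := stdSimplex.zero_le m v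
    have hm1 : m v ≤ 1 := stdSimplex.le_one m v
    set W := weightedFourier h φ v (redistribute G v m) with hW
    have hWC : ‖W‖ ≤ C := by
      refine norm_sum_mul_le (f := fun x => (h (x - v) : ℂ) * φ x) (fun x => ?_)
        (redistributeSimplex hG v m)
      rw [norm_mul, hnorm, mul_one, Complex.norm_real]
      exact hC _
    have hW' : W = weightedFourier h φ v m + (1 + κ) * m v * φ v :=
      weightedFourier_redistribute hS hadd hh hκ v m
    have hval : ((2 * ε) • crossFourier h φ + fun _ => normSqFourier φ :
        V → C(stdSimplex ℝ V, ℝ)) v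
        (redistributeSimplex hG v m) =
        2 * ε * (starRingEnd ℂ (M - ε * m v * φ v) * W).re + ‖M - ε * m v * φ v‖ ^ 2 := by
      have h1 := massFourier_redistribute hS hadd hε v m
      simp only [Pi.add_apply, Pi.smul_apply, ContinuousMap.add_apply, ContinuousMap.smul_apply,
        smul_eq_mul, crossFourier, normSqFourier, ContinuousMap.coe_mk, coe_redistributeSimplex]
      rw [h1]
    have hnsq : ‖M - ε * m v * φ v‖ ^ 2 =
        ‖M‖ ^ 2 - 2 * ε * m v * (starRingEnd ℂ M * φ v).re + ε ^ 2 * m v ^ 2 := by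
      have h1 : ‖φ v‖ ^ 2 = 1 := by rw [hnorm]; norm_num
      rw [← Complex.normSq_eq_norm_sq, Complex.normSq_apply] at h1 ⊢
      rw [← Complex.normSq_eq_norm_sq, Complex.normSq_apply]
      simp only [Complex.sub_re, Complex.sub_im, Complex.mul_re, Complex.mul_im,
        Complex.ofReal_re, Complex.ofReal_im, Complex.conj_re, Complex.conj_im]
      linear_combination (ε ^ 2 * m v ^ 2) * h1
    -- The second term, once multiplied by `2 * ε`, cancels the linear term of `hnsq`; this dictates
    -- the weight of the cross term.
    have hcross : (starRingEnd ℂ (M - ε * m v * φ v) * W).re =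
        (starRingEnd ℂ M * weightedFourier h φ v m).re + m v * (starRingEnd ℂ M * φ v).re +
        m v * (starRingEnd ℂ M * (κ * φ v)).re - ε * m v * (starRingEnd ℂ (φ v) * W).re := by
      have h1 : starRingEnd ℂ (M - ε * m v * φ v) * W =
          starRingEnd ℂ M * W - ((ε * m v : ℝ) : ℂ) * (starRingEnd ℂ (φ v) * W) := by
        simp only [map_sub, map_mul, Complex.conj_ofReal]; push_cast; ring
      have h2 : starRingEnd ℂ M * W = starRingEnd ℂ M * weightedFourier h φ v m +
          (m v : ℂ) * (starRingEnd ℂ M * φ v) + (m v : ℂ) * (starRingEnd ℂ M * (κ * φ v)) := by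
        rw [hW']; ring
      rw [h1, h2, Complex.sub_re, Complex.add_re, Complex.add_re, Complex.re_ofReal_mul,
        Complex.re_ofReal_mul, Complex.re_ofReal_mul]
    have hb1 : (starRingEnd ℂ M * (κ * φ v)).re ≤ ‖κ‖ := by
      refine (Complex.re_le_norm _).trans ?_
      rw [norm_mul, norm_mul, RCLike.norm_conj, hnorm, mul_one]
      exact mul_le_of_le_one_left (norm_nonneg _) hM1
    have hb2 : -(starRingEnd ℂ (φ v) * W).re ≤ C := by
      have := (abs_le.1 (Complex.abs_re_le_norm (starRingEnd ℂ (φ v) * W))).1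
      rw [norm_mul, RCLike.norm_conj, hnorm, one_mul] at this
      linarith
    rw [hval, hnsq, hcross]
    have h1 := mul_le_mul_of_nonneg_left hb1 (show 0 ≤ 2 * ε * m v by positivity)
    have h2 := mul_le_mul_of_nonneg_left hb2 (show 0 ≤ 2 * ε ^ 2 * m v by positivity)
    -- All errors are made linear in `m v`, because only the first moment of the mass ahead is
    -- known.
    have h3 : ε ^ 2 * m v ^ 2 ≤ ε ^ 2 * m v := by
      refine mul_le_mul_of_nonneg_left ?_ (by positivity)
      nlinarith
    rw [hA]
    linarith
  have havg := nbrAvg_mono (G := G) b hstep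
  rw [stepOp_apply]
  refine havg.trans ?_
  rw [nbrAvg_add, nbrAvg_add, nbrAvg_mul_left, nbrAvg_const hG, nbrAvg_mul_left,
    nbrAvg_re_weightedFourier hS hh, ← hcdef, ← hM]
  have hMM : (starRingEnd ℂ M * M).re = ‖M‖ ^ 2 := by
    rw [mul_comm, Complex.mul_conj, Complex.ofReal_re, Complex.normSq_eq_norm_sq]
  have hMφ : (starRingEnd ℂ M * φ b).re ≤ 1 := by
    refine (Complex.re_le_norm _).trans ?_
    rw [norm_mul, RCLike.norm_conj, hnorm, mul_one]
    exact hM1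
  rw [hMM]
  have hmb : 0 ≤ m b := stdSimplex.zero_le m b
  have h1 := mul_le_mul_of_nonneg_left hMφ
    (show 0 ≤ 2 * ε * (Fintype.card V * c) * m b by positivity)
  simp only [Pi.add_apply, Pi.sub_apply, Pi.smul_apply, ContinuousMap.add_apply,
    ContinuousMap.sub_apply, ContinuousMap.smul_apply, smul_eq_mul, crossFourier, normSqFourier,
    massAtWalker, massAhead, ContinuousMap.coe_mk, ← hM]
  linarith

/-- Second moment of a Fourier mode under the stationary law. -/
theorem stationary_normSqFourier_le (hS : ∀ x y, G.Adj x y ↔ y - x ∈ S)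
    (hadd : ∀ x y, φ (x + y) = φ x * φ y) (hnorm : ∀ x, ‖φ x‖ = 1) (hh : IsCorrector G h)
    (hε : (S.card : ℂ)⁻¹ * ∑ s ∈ S, φ s = 1 - ε) (hε0 : 0 < ε)
    (hκ : κ = (S.card : ℂ)⁻¹ * ∑ s ∈ S, h s * φ s) (hC : ∀ x, |h x| ≤ C) :
    stationary hG hc (fun _ => normSqFourier φ) ≤ ‖κ‖ + ε * C + ε / 2 := by
  have h1 := stationary_mono hG hc
    (stepOp_functional_le hG hS hadd hnorm hh hε hε0.le hκ hC)
  rw [stationary_stepOp] at h1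
  simp only [map_add, map_sub, map_smul, smul_eq_mul, stationary_massAtWalker,
    stationary_massAhead hG hc hS hh] at h1
  have hN := one_lt_card_of_degree_pos hG
  have hc0 : 0 < ((Fintype.card V : ℝ) - 1)⁻¹ := inv_pos.2 (by linarith)
  -- Drift and errors share the factor 2ε/(N - 1), which cancels.
  have h2 : 2 * ε * ((Fintype.card V : ℝ) - 1)⁻¹ * stationary hG hc (fun _ => normSqFourier φ) ≤
      2 * ε * ((Fintype.card V : ℝ) - 1)⁻¹ * (‖κ‖ + ε * C + ε / 2) := by linarith
  exact le_of_mul_le_mul_left h2 (by positivity)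

/-- Second moment of a slowly varying character under the stationary law, on a Cayley graph of
small diameter. -/
theorem stationary_normSqFourier_le_of_diam (hS : ∀ x y, G.Adj x y ↔ y - x ∈ S)
    (hadd : ∀ x y, φ (x + y) = φ x * φ y) (hnorm : ∀ x, ‖φ x‖ = 1) {η : ℝ} {L : ℕ}
    (hη : ∀ s ∈ S, ‖φ s - 1‖ ≤ η) (hne : ∃ s ∈ S, φ s ≠ 1)
    (hL : ∀ x, ∃ p : G.Walk 0 x, p.length ≤ L) :
    stationary hG hc (fun _ => normSqFourier φ) ≤
      (1 + 2 * S.card) * η + η ^ 2 * (1 + 2 * S.card * L) + η ^ 2 := by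
  obtain ⟨h, hh⟩ := exists_isCorrector hG hc hS
  have hD : (0 : ℝ) < S.card := by rw [← degree_eq_card hS 0]; exact_mod_cast hG 0
  have hη0 : 0 ≤ η := by
    obtain ⟨s, hs, -⟩ := hne
    exact (norm_nonneg _).trans (hη s hs)
  have hC : ∀ x, |h x| ≤ 1 + 2 * S.card * L := by
    intro x
    obtain ⟨p, hp⟩ := hL x
    refine (hh.abs_le_of_walk hG hS p).trans ?_
    have : (p.length : ℝ) ≤ L := by exact_mod_cast hp
    gcongr
  have hC1 : ∀ s ∈ S, |h s| ≤ 1 + 2 * S.card := by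
    intro s hs
    have hadj : G.Adj 0 s := by rw [hS]; simpa using hs
    simpa using hh.abs_le_of_walk hG hS (SimpleGraph.Walk.cons hadj SimpleGraph.Walk.nil)
  have hφ0 : φ 0 = 1 := by
    have h1 := hadd 0 0
    have h2 : φ 0 ≠ 0 := by rw [← norm_ne_zero_iff, hnorm]; norm_num
    rw [add_zero] at h1
    exact (mul_eq_left₀ h2).1 h1.symm
  have hneg : ∀ s, φ (-s) = starRingEnd ℂ (φ s) := by
    intro s
    have h1 : φ (-s) * φ s = 1 := by rw [← hadd, neg_add_cancel, hφ0]
    have h2 : starRingEnd ℂ (φ s) * φ s = 1 := by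
      rw [mul_comm, Complex.mul_conj, Complex.normSq_eq_norm_sq, hnorm]; norm_num
    have h3 : φ s ≠ 0 := by rw [← norm_ne_zero_iff, hnorm]; norm_num
    exact mul_right_cancel₀ h3 (h1.trans h2.symm)
  have hre : ∀ s, 1 - (φ s).re = ‖φ s - 1‖ ^ 2 / 2 := by
    intro s
    have h1 : ‖φ s‖ ^ 2 = 1 := by rw [hnorm]; norm_num
    rw [← Complex.normSq_eq_norm_sq, Complex.normSq_apply] at h1 ⊢
    simp only [Complex.sub_re, Complex.sub_im, Complex.one_re, Complex.one_im]
    linear_combination (-1 / 2) * h1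
  set ε : ℝ := (S.card : ℝ)⁻¹ * ∑ s ∈ S, (1 - (φ s).re) with hεdef
  -- The generators are symmetric, so the eigenvalue is real.
  have hsum : ∑ s ∈ S, φ s = ((∑ s ∈ S, (φ s).re : ℝ) : ℂ) := by
    have h1 : starRingEnd ℂ (∑ s ∈ S, φ s) = ∑ s ∈ S, φ s := by
      rw [map_sum, ← sum_neg_comp hS φ]
      exact Finset.sum_congr rfl fun s _ => (hneg s).symm
    rw [← Complex.re_sum]
    exact (Complex.conj_eq_iff_re.1 h1).symm
  have hε : (S.card : ℂ)⁻¹ * ∑ s ∈ S, φ s = 1 - ε := by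
    rw [hsum, hεdef, Finset.sum_sub_distrib]
    have : (S.card : ℂ) ≠ 0 := by exact_mod_cast hD.ne'
    push_cast
    simp only [Finset.sum_const, nsmul_eq_mul, mul_one]
    field_simp
    ring
  have hε0 : 0 < ε := by
    obtain ⟨s, hs, hs1⟩ := hne
    refine mul_pos (inv_pos.2 hD) (Finset.sum_pos' (fun s _ => by rw [hre]; positivity) ⟨s, hs, ?_⟩)
    rw [hre]
    have := norm_pos_iff.2 (sub_ne_zero.2 hs1)
    positivity
  -- `ε` is the mean of ‖φ s - 1‖²/2: being quadratic in `η`, it compensates the growth of the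
  -- corrector with the diameter.
  have hε2 : ε ≤ η ^ 2 := by
    rw [hεdef, inv_mul_le_iff₀ hD]
    calc ∑ s ∈ S, (1 - (φ s).re) ≤ ∑ s ∈ S, η ^ 2 := by
          refine Finset.sum_le_sum fun s hs => ?_
          rw [hre]
          have := pow_le_pow_left₀ (norm_nonneg _) (hη s hs) 2
          have := sq_nonneg (‖φ s - 1‖)
          linarith
      _ = S.card * η ^ 2 := by simp
  -- As `h` sums to zero over the generators, `φ s` may be replaced by `φ s - 1`.
  have hκ : ‖(S.card : ℂ)⁻¹ * ∑ s ∈ S, h s * φ s‖ ≤ (1 + 2 * S.card) * η := by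
    have h1 : ∑ s ∈ S, (h s : ℂ) * φ s = ∑ s ∈ S, (h s : ℂ) * (φ s - 1) := by
      have h2 : ∑ s ∈ S, (h s : ℂ) = 0 := by exact_mod_cast hh.sum_generators hG hS
      simp only [mul_sub, mul_one, Finset.sum_sub_distrib, h2, sub_zero]
    rw [h1, norm_mul, norm_inv, Complex.norm_natCast, inv_mul_le_iff₀ hD]
    refine (norm_sum_le _ _).trans ?_
    calc ∑ s ∈ S, ‖(h s : ℂ) * (φ s - 1)‖ ≤ ∑ s ∈ S, (1 + 2 * S.card) * η := by
          refine Finset.sum_le_sum fun s hs => ?_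
          rw [norm_mul, Complex.norm_real]
          exact mul_le_mul (hC1 s hs) (hη s hs) (norm_nonneg _) (by positivity)
      _ = S.card * ((1 + 2 * S.card) * η) := by simp
  refine (stationary_normSqFourier_le hG hc hS hadd hnorm hh hε hε0 rfl hC).trans ?_
  have h1 := mul_le_mul_of_nonneg_right hε2 (show (0 : ℝ) ≤ 1 + 2 * S.card * L by positivity)
  linarith

end FourierMode

/-! ### The discrete torus as a Cayley graph, and its characters -/

section Torus

variable {d n : ℕ}

/-- The embedding of the cycle in the torus along the coordinate `i`. -/
def coordHom (x : Fin d → Fin n) (i : Fin d) : SimpleGraph.cycleGraph n →g torus d n where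
  toFun a := Function.update x i a
  map_rel' {a b} hab := ⟨i, by simpa using hab, fun j hj => by simp [hj]⟩

lemma exists_walk_cycleGraph (a b : Fin n) :
    ∃ p : (SimpleGraph.cycleGraph n).Walk a b, p.length ≤ n := by
  obtain ⟨p⟩ := SimpleGraph.cycleGraph_preconnected a b
  refine ⟨p.toPath, ?_⟩
  have := p.toPath.2.length_lt
  simp only [Fintype.card_fin] at this
  exact this.le

lemma exists_walk_torus_of_agree (s : Finset (Fin d)) : ∀ x y : Fin d → Fin n,
    (∀ j ∉ s, x j = y j) → ∃ p : (torus d n).Walk x y, p.length ≤ s.card * n := by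
  induction s using Finset.induction_on with
  | empty =>
    intro x y h
    obtain rfl : x = y := funext fun j => h j (by simp)
    exact ⟨SimpleGraph.Walk.nil, by simp⟩
  | insert i s hi ih =>
    intro x y h
    obtain ⟨p, hp⟩ := exists_walk_cycleGraph (x i) (y i)
    obtain ⟨q, hq⟩ := ih (Function.update x i (y i)) y fun j hj => by
      by_cases hji : j = i
      · subst hji; simp
      · simp only [Function.update_of_ne hji]
        exact h j (by simp [hji, hj])
    have hx : coordHom x i (x i) = x := Function.update_eq_self i x
    have hy : coordHom x i (y i) = Function.update x i (y i) := rfl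
    refine ⟨((p.map (coordHom x i)).copy hx hy).append q, ?_⟩
    rw [SimpleGraph.Walk.length_append, SimpleGraph.Walk.length_copy, SimpleGraph.Walk.length_map,
      Finset.card_insert_of_notMem hi, add_mul, one_mul]
    omega

lemma exists_walk_torus (x y : Fin d → Fin n) : ∃ p : (torus d n).Walk x y, p.length ≤ d * n := by
  simpa using exists_walk_torus_of_agree Finset.univ x y (by simp)

lemma torus_preconnected : (torus d n).Preconnected := fun x y => ⟨(exists_walk_torus x y).choose⟩

variable [NeZero n]

lemma val_one_of_two_le (hn : 2 ≤ n) : ((1 : Fin n) : ℕ) = 1 := by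
  rw [Fin.val_one']
  exact Nat.mod_eq_of_lt hn

lemma torus_degree_pos (hd : 1 ≤ d) (hn : 2 ≤ n) (v : Fin d → Fin n) :
    0 < (torus d n).degree v := by
  rw [SimpleGraph.degree_pos_iff_exists_adj]
  set i : Fin d := ⟨0, hd⟩
  refine ⟨Function.update v i (v i + 1), i, ?_, fun j hj => by simp [hj]⟩
  rw [SimpleGraph.cycleGraph_adj']
  right
  simp [Nat.mod_eq_of_lt (show 1 < n from hn)]

/-- The neighbours of the origin in the torus. -/
noncomputable def torusGenerators (d n : ℕ) [NeZero n] : Finset (Fin d → Fin n) :=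
  (torus d n).neighborFinset 0

lemma torus_adj_iff (x y : Fin d → Fin n) : (torus d n).Adj x y ↔ y - x ∈ torusGenerators d n := by
  rw [torusGenerators, SimpleGraph.mem_neighborFinset]
  refine exists_congr fun i => and_congr ?_ (forall₂_congr fun j hj => ?_)
  · simp [SimpleGraph.cycleGraph_adj']
  · simp [eq_comm, sub_eq_zero]

lemma mem_torusGenerators {s : Fin d → Fin n} (hs : s ∈ torusGenerators d n) :
    ∃ i, (((s i : Fin n) : ℕ) = 1 ∨ ((-s i : Fin n) : ℕ) = 1) ∧ ∀ j, j ≠ i → s j = 0 := by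
  rw [torusGenerators, SimpleGraph.mem_neighborFinset] at hs
  obtain ⟨i, hi, hj⟩ := hs
  refine ⟨i, ?_, fun j hji => (hj j hji).symm⟩
  simpa [SimpleGraph.cycleGraph_adj', or_comm] using hi

lemma eq_one_of_val (hn : 2 ≤ n) {a : Fin n} (ha : (a : ℕ) = 1) : a = 1 :=
  Fin.ext (ha.trans (val_one_of_two_le hn).symm)

/-- The generators are the plus and minus unit vectors, which coincide when `n = 2`; an upper bound
is all that is used. -/
lemma card_torusGenerators_le (hn : 2 ≤ n) : (torusGenerators d n).card ≤ 2 * d := by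
  have hsub : torusGenerators d n ⊆ Finset.univ.image fun p : Fin d × Bool =>
      (Pi.single p.1 (if p.2 then 1 else -1) : Fin d → Fin n) := by
    intro s hs
    obtain ⟨i, hi, hj⟩ := mem_torusGenerators hs
    have hsi : s = Pi.single i (s i) := by
      ext j
      by_cases hji : j = i
      · subst hji; simp
      · simp [hji, hj j hji]
    rw [Finset.mem_image]
    rcases hi with hi | hi
    · exact ⟨(i, true), Finset.mem_univ _, by rw [hsi, eq_one_of_val hn hi]; simp⟩
    · exact ⟨(i, false), Finset.mem_univ _, by
        rw [hsi, ← neg_neg (s i), eq_one_of_val hn hi]; simp⟩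
  refine (Finset.card_le_card hsub).trans (Finset.card_image_le.trans ?_)
  simp [mul_comm]

/-- The point of the unit torus corresponding to a vertex of the discrete torus. -/
noncomputable def torusPoint (v : Fin d → Fin n) : UnitAddTorus (Fin d) :=
  fun j => ((((v j : ℕ) : ℝ) / n : ℝ) : UnitAddCircle)

lemma torusPoint_add (v w : Fin d → Fin n) : torusPoint (v + w) = torusPoint v + torusPoint w := by
  have hn : (n : ℝ) ≠ 0 := by exact_mod_cast NeZero.ne n
  funext j
  simp only [torusPoint, Pi.add_apply]
  have h1 := Nat.div_add_mod ((v j : ℕ) + w j) n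
  have h2 : (((v j + w j : Fin n) : ℕ) : ℝ) = (v j : ℕ) + (w j : ℕ) -
      n * ((((v j : ℕ) + w j) / n : ℕ) : ℝ) := by
    rw [Fin.val_add]
    have : (((n * (((v j : ℕ) + w j) / n) + ((v j : ℕ) + w j) % n : ℕ)) : ℝ) =
      (((v j : ℕ) + w j : ℕ) : ℝ) := by rw [h1]
    push_cast at this
    linarith
  have h3 : ((((((v j : ℕ) + w j) / n : ℕ) : ℝ)) : UnitAddCircle) = 0 := by
    rw [AddCircle.coe_eq_zero_iff]
    generalize ((v j : ℕ) + w j) / n = q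
    exact ⟨q, by simp⟩
  have h4 : (((v j + w j : Fin n) : ℕ) : ℝ) / n = ((v j : ℕ) : ℝ) / n + ((w j : ℕ) : ℝ) / n -
      ((((v j : ℕ) + w j) / n : ℕ) : ℝ) := by
    rw [h2]; field_simp
  rw [h4, AddCircle.coe_sub, AddCircle.coe_add, h3, sub_zero]

lemma fourier_add_apply (k : ℤ) (x y : UnitAddCircle) :
    fourier k (x + y) = fourier k x * fourier k y := by
  simp only [fourier_apply, smul_add, AddCircle.toCircle_add, Circle.coe_mul]

lemma mFourier_add_apply (k : Fin d → ℤ) (x y : UnitAddTorus (Fin d)) :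
    UnitAddTorus.mFourier k (x + y) = UnitAddTorus.mFourier k x * UnitAddTorus.mFourier k y := by
  simp only [UnitAddTorus.mFourier, ContinuousMap.coe_mk, Pi.add_apply, fourier_add_apply,
    Finset.prod_mul_distrib]

lemma norm_mFourier_apply (k : Fin d → ℤ) (x : UnitAddTorus (Fin d)) :
    ‖UnitAddTorus.mFourier k x‖ = 1 := by
  simp only [UnitAddTorus.mFourier, fourier_apply, ContinuousMap.coe_mk, norm_prod,
    Circle.norm_coe, Finset.prod_const_one]

/-- The character of the discrete torus with frequency `k`. -/
noncomputable def torusChar (k : Fin d → ℤ) (v : Fin d → Fin n) : ℂ :=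
  UnitAddTorus.mFourier k (torusPoint v)

lemma torusChar_add (k : Fin d → ℤ) (v w : Fin d → Fin n) :
    torusChar k (v + w) = torusChar k v * torusChar k w := by
  rw [torusChar, torusPoint_add, mFourier_add_apply]; rfl

lemma norm_torusChar (k : Fin d → ℤ) (v : Fin d → Fin n) : ‖torusChar k v‖ = 1 :=
  norm_mFourier_apply _ _

lemma torusChar_unit (k : Fin d → ℤ) {s : Fin d → Fin n} {i : Fin d}
    (hi : ((s i : Fin n) : ℕ) = 1) (hj : ∀ j, j ≠ i → s j = 0) :
    torusChar k s = Complex.exp (Complex.I * ((2 * Real.pi * k i / n : ℝ) : ℂ)) := by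
  simp only [torusChar, UnitAddTorus.mFourier, ContinuousMap.coe_mk, torusPoint]
  rw [Finset.prod_eq_single i, hi, fourier_coe_apply]
  · congr 1; push_cast; ring
  · intro j _ hji
    rw [hj j hji]
    simp
  · simp

lemma torusChar_zero (k : Fin d → ℤ) : torusChar k (0 : Fin d → Fin n) = 1 := by
  have h1 := torusChar_add k (0 : Fin d → Fin n) 0
  have h2 : torusChar k (0 : Fin d → Fin n) ≠ 0 := by
    rw [← norm_ne_zero_iff, norm_torusChar]; norm_num
  rw [add_zero] at h1
  exact (mul_eq_left₀ h2).1 h1.symm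

lemma norm_torusChar_neg_sub_one (k : Fin d → ℤ) (s : Fin d → Fin n) :
    ‖torusChar k (-s) - 1‖ = ‖torusChar k s - 1‖ := by
  have h1 : torusChar k s * torusChar k (-s) = 1 := by
    rw [← torusChar_add, add_neg_cancel, torusChar_zero]
  have h2 : torusChar k s * (torusChar k (-s) - 1) = -(torusChar k s - 1) := by
    rw [mul_sub, h1]; ring
  rw [← norm_neg (torusChar k s - 1), ← h2, norm_mul, norm_torusChar, one_mul]

lemma norm_torusChar_sub_one_le (hn : 2 ≤ n) (k : Fin d → ℤ) {s : Fin d → Fin n}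
    (hs : s ∈ torusGenerators d n) :
    ‖torusChar k s - 1‖ ≤ 2 * Real.pi * (∑ j, |(k j : ℝ)|) / n := by
  have key : ∀ {s : Fin d → Fin n} {i : Fin d}, ((s i : Fin n) : ℕ) = 1 →
      (∀ j, j ≠ i → s j = 0) → ‖torusChar k s - 1‖ ≤ 2 * Real.pi * (∑ j, |(k j : ℝ)|) / n := by
    intro s i hi hj
    rw [torusChar_unit k hi hj]
    refine (Real.norm_exp_I_mul_ofReal_sub_one_le).trans ?_
    rw [Real.norm_eq_abs, abs_div, abs_mul, abs_of_pos Real.two_pi_pos, Nat.abs_cast]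
    have := Finset.single_le_sum (f := fun j => |(k j : ℝ)|) (fun _ _ => abs_nonneg _)
      (Finset.mem_univ i)
    gcongr
  obtain ⟨i, hi, hj⟩ := mem_torusGenerators hs
  rcases hi with hi | hi
  · exact key hi hj
  · rw [← norm_torusChar_neg_sub_one]
    exact key (s := -s) (i := i) hi fun j hji => by simp [hj j hji]

/-- The condition `|k i| < n` excludes aliasing: a frequency divisible by `n` is invisible on the
grid. -/
lemma exists_torusChar_ne_one (hn : 2 ≤ n) (k : Fin d → ℤ) {i : Fin d} (hki : k i ≠ 0)
    (hkn : |k i| < n) : ∃ s ∈ torusGenerators d n, torusChar k s ≠ 1 := by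
  refine ⟨Pi.single i 1, ?_, ?_⟩
  · rw [torusGenerators, SimpleGraph.mem_neighborFinset]
    refine ⟨i, ?_, fun j hj => by simp [hj]⟩
    rw [SimpleGraph.cycleGraph_adj']
    right
    simp [Nat.mod_eq_of_lt (show 1 < n from hn)]
  · rw [torusChar_unit k (i := i) (by simp [Nat.mod_eq_of_lt (show 1 < n from hn)])
      fun j hj => by simp [hj]]
    intro h
    obtain ⟨m, hm⟩ := Complex.exp_eq_one_iff.1 h
    have hn0 : (n : ℂ) ≠ 0 := by exact_mod_cast NeZero.ne n
    have hpi : (Real.pi : ℂ) ≠ 0 := by exact_mod_cast Real.pi_ne_zero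
    push_cast at hm
    field_simp at hm
    have hm' : k i = n * m := by exact_mod_cast hm
    have hm0 : m ≠ 0 := by rintro rfl; simp at hm'; exact hki hm'
    rw [hm', abs_mul, Nat.abs_cast] at hkn
    have := Int.one_le_abs hm0
    nlinarith [Int.natCast_nonneg n]

/-- Fourier modes of the stationary mass configuration vanish as the size of the torus grows. -/
lemma stationary_torusFourier_le (hd : 1 ≤ d) (hn : 2 ≤ n) (k : Fin d → ℤ) {i : Fin d}
    (hki : k i ≠ 0) (hkn : |k i| < n) {a : ℝ} (ha : a = 2 * Real.pi * ∑ j, |(k j : ℝ)|) :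
    stationary (torus_degree_pos (n := n) hd hn) torus_preconnected
      (fun _ => normSqFourier (torusChar k)) ≤
        ((1 + 4 * d) * a + a ^ 2 * (2 + 4 * d ^ 2)) / n := by
  have hn1 : (1 : ℝ) ≤ n := by exact_mod_cast (by omega : 1 ≤ n)
  have ha0 : 0 ≤ a := by
    rw [ha]
    exact mul_nonneg Real.two_pi_pos.le (Finset.sum_nonneg fun _ _ => abs_nonneg _)
  refine (stationary_normSqFourier_le_of_diam (torus_degree_pos (n := n) hd hn)
    torus_preconnected torus_adj_iff (torusChar_add k) (norm_torusChar k)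
    (fun s hs => norm_torusChar_sub_one_le hn k hs) (exists_torusChar_ne_one hn k hki hkn)
    (fun x => exists_walk_torus 0 x)).trans ?_
  rw [← ha]
  have hD : ((torusGenerators d n).card : ℝ) ≤ 2 * d := by
    exact_mod_cast card_torusGenerators_le hn
  -- Here η = a/n and the diameter is at most d · n, so η² times the diameter is still of order 1/n.
  calc (1 + 2 * ((torusGenerators d n).card : ℝ)) * (a / n) +
        (a / n) ^ 2 * (1 + 2 * (torusGenerators d n).card * (d * n : ℕ)) + (a / n) ^ 2
      ≤ (1 + 2 * (2 * d)) * (a / n) + (a / n) ^ 2 * (1 + 2 * (2 * d) * (d * n : ℕ)) +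
        (a / n) ^ 2 := by gcongr
    _ = ((1 + 4 * d) * a + a ^ 2 * (2 / n + 4 * d ^ 2)) / n := by
        push_cast; field_simp; ring
    _ ≤ _ := by
        have : (2 : ℝ) / n ≤ 2 := div_le_self (by norm_num) hn1
        gcongr

end Torus

/-! ### From Fourier modes to equidistribution in the cube -/

section Equidistribution

variable {d : ℕ}

/-- The projection of the space to the unit torus. -/
def toTorus (x : Fin d → ℝ) : UnitAddTorus (Fin d) := fun i => (x i : UnitAddCircle)

lemma continuous_toTorus : Continuous (toTorus (d := d)) :=
  continuous_pi fun i => continuous_quotient_mk'.comp (continuous_apply i)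

lemma integral_Icc_fourier {k : ℤ} (hk : k ≠ 0) :
    ∫ x in Set.Icc (0 : ℝ) 1, fourier k (x : UnitAddCircle) = 0 := by
  have hc : (2 * Real.pi * Complex.I * k : ℂ) ≠ 0 := by
    simp [Real.pi_ne_zero, hk]
  have h1 : ∀ x : ℝ, fourier k (x : UnitAddCircle) =
      Complex.exp ((2 * Real.pi * Complex.I * k) * x) := fun x => by
    rw [fourier_coe_apply]; congr 1; simp
  simp only [h1]
  rw [integral_Icc_eq_integral_Ioc, ← intervalIntegral.integral_of_le zero_le_one,
    integral_exp_mul_complex hc]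
  have h2 : Complex.exp (2 * Real.pi * Complex.I * k * (1 : ℝ)) = 1 :=
    Complex.exp_eq_one_iff.2 ⟨k, by push_cast; ring⟩
  rw [h2]
  simp

lemma volume_restrict_Icc :
    (volume : Measure (Fin d → ℝ)).restrict (Set.Icc 0 1) =
      Measure.pi fun _ => (volume : Measure ℝ).restrict (Set.Icc 0 1) := by
  rw [← Measure.restrict_pi_pi, Set.pi_univ_Icc]
  rfl

instance : IsProbabilityMeasure ((volume : Measure (Fin d → ℝ)).restrict (Set.Icc 0 1)) := by
  have : IsProbabilityMeasure ((volume : Measure ℝ).restrict (Set.Icc 0 1)) :=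
    ⟨by simp⟩
  rw [volume_restrict_Icc]
  infer_instance

lemma integral_Icc_mFourier {k : Fin d → ℤ} (hk : k ≠ 0) :
    ∫ x in Set.Icc (0 : Fin d → ℝ) 1, UnitAddTorus.mFourier k (toTorus x) = 0 := by
  obtain ⟨i, hi⟩ := Function.ne_iff.1 hk
  rw [volume_restrict_Icc]
  simp only [UnitAddTorus.mFourier, ContinuousMap.coe_mk, toTorus]
  rw [integral_fintype_prod_eq_prod (𝕜 := ℂ)
    (f := fun i (x : ℝ) => fourier (k i) (x : UnitAddCircle))]
  exact Finset.prod_eq_zero (Finset.mem_univ i) (integral_Icc_fourier hi)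

variable {W : ℕ → Type*} [∀ n, Fintype (W n)]

lemma continuous_massFourier {V : Type*} [Fintype V] (φ : V → ℂ) :
    Continuous fun m : stdSimplex ℝ V => massFourier φ m := by
  unfold massFourier
  exact continuous_finsetSum _ fun v _ => continuous_const.mul
    (Complex.continuous_ofReal.comp ((continuous_apply v).comp continuous_subtype_val))

lemma integrable_of_continuous_stdSimplex {V E : Type*} [Fintype V] [NormedAddCommGroup E]
    (μ : Measure (stdSimplex ℝ V)) [IsFiniteMeasure μ] {f : stdSimplex ℝ V → E}
    (hf : Continuous f) : Integrable f μ :=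
  hf.integrable_of_hasCompactSupport (HasCompactSupport.of_compactSpace _)

/-- The random weights with law `Q n` at the points `p n v` integrate the function `g`
asymptotically like the uniform measure on the unit cube. -/
def Equidistributes (Q : ∀ n, Measure (stdSimplex ℝ (W n))) (p : ∀ n, W n → Fin d → ℝ)
    (g : (Fin d → ℝ) → ℂ) : Prop :=
  Tendsto (fun n => ∫ m, ‖massFourier (fun v => g (p n v)) m - ∫ x in Set.Icc 0 1, g x‖ ∂Q n)
    atTop (𝓝 0)

variable {Q : ∀ n, Measure (stdSimplex ℝ (W n))} [∀ n, IsProbabilityMeasure (Q n)]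
  {p : ∀ n, W n → Fin d → ℝ}

lemma massFourier_const {V : Type*} [Fintype V] (c : ℂ) (m : stdSimplex ℝ V) :
    massFourier (fun _ => c) m = c := by
  rw [massFourier, ← Finset.mul_sum, ← Complex.ofReal_sum]
  have := stdSimplex.sum_eq_one m
  rw [this]; simp

lemma integrable_deviation (n : ℕ) (φ : W n → ℂ) (c : ℂ) :
    Integrable (fun m : stdSimplex ℝ (W n) => ‖massFourier φ m - c‖) (Q n) :=
  integrable_of_continuous_stdSimplex _ ((continuous_massFourier φ).sub continuous_const).norm

lemma equidistributes_const (c : ℂ) : Equidistributes Q p fun _ => c := by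
  simp [Equidistributes, massFourier_const]

lemma Equidistributes.add {g g' : (Fin d → ℝ) → ℂ} (hg : Equidistributes Q p g)
    (hg' : Equidistributes Q p g') (hi : IntegrableOn g (Set.Icc 0 1))
    (hi' : IntegrableOn g' (Set.Icc 0 1)) : Equidistributes Q p fun x => g x + g' x := by
  have hsum := Tendsto.add hg hg'
  rw [add_zero] at hsum
  refine squeeze_zero (fun n => integral_nonneg fun _ => norm_nonneg _) (fun n => ?_) hsum
  rw [← integral_add (integrable_deviation n _ _) (integrable_deviation n _ _)]
  refine integral_mono (integrable_deviation n _ _)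
    ((integrable_deviation n _ _).add (integrable_deviation n _ _)) fun m => ?_
  have h1 : massFourier (fun v => g (p n v) + g' (p n v)) m =
      massFourier (fun v => g (p n v)) m + massFourier (fun v => g' (p n v)) m := by
    simp only [massFourier, add_mul, Finset.sum_add_distrib]
  simp only [h1, integral_add hi hi', add_sub_add_comm]
  exact norm_add_le _ _

lemma Equidistributes.smul {g : (Fin d → ℝ) → ℂ} (hg : Equidistributes Q p g) (c : ℂ) :
    Equidistributes Q p fun x => c * g x := by
  have h := Tendsto.const_mul ‖c‖ hg
  rw [mul_zero] at h
  refine h.congr fun n => ?_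
  rw [← integral_const_mul]
  refine integral_congr_ae (.of_forall fun m => ?_)
  have h1 : massFourier (fun v => c * g (p n v)) m =
      c * massFourier (fun v => g (p n v)) m := by
    simp only [massFourier, mul_assoc, Finset.mul_sum]
  simp only [h1, integral_const_mul, ← mul_sub, norm_mul]

lemma norm_massFourier_le {V : Type*} [Fintype V] {φ : V → ℂ} {b : V → ℝ}
    (h : ∀ v, ‖φ v‖ ≤ b v) (m : stdSimplex ℝ V) :
    ‖massFourier φ m‖ ≤ ‖massFourier (fun v => (b v : ℂ)) m‖ := by
  have h1 : massFourier (fun v => (b v : ℂ)) m = ((∑ v, b v * m v : ℝ) : ℂ) := by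
    simp [massFourier]
  have h0 : 0 ≤ ∑ v, b v * m v := Finset.sum_nonneg fun v _ =>
    mul_nonneg ((norm_nonneg _).trans (h v)) (stdSimplex.zero_le m v)
  rw [h1, Complex.norm_real, Real.norm_of_nonneg h0]
  refine (norm_sum_le _ _).trans (Finset.sum_le_sum fun v _ => ?_)
  rw [norm_mul, Complex.norm_real, Real.norm_of_nonneg (stdSimplex.zero_le m v)]
  exact mul_le_mul_of_nonneg_right (h v) (stdSimplex.zero_le m v)

/-- Equidistribution passes to functions which can be approximated up to an equidistributing
error with small integral. -/
lemma Equidistributes.of_approx {g : (Fin d → ℝ) → ℂ} (hi : IntegrableOn g (Set.Icc 0 1))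
    (h : ∀ ε : ℝ, 0 < ε → ∃ (g' : (Fin d → ℝ) → ℂ) (b : (Fin d → ℝ) → ℝ),
      Equidistributes Q p g' ∧ Equidistributes Q p (fun x => (b x : ℂ)) ∧
      IntegrableOn g' (Set.Icc 0 1) ∧ IntegrableOn b (Set.Icc 0 1) ∧
      (∀ n v, ‖g (p n v) - g' (p n v)‖ ≤ b (p n v)) ∧
      (∀ᵐ x ∂(volume.restrict (Set.Icc 0 1)), ‖g x - g' x‖ ≤ b x) ∧
      ∫ x in Set.Icc 0 1, b x ≤ ε) :
    Equidistributes Q p g := by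
  rw [Equidistributes, Metric.tendsto_atTop]
  intro ε hε
  obtain ⟨g', b, hg', hb, hi', hib, hpt, hae, hbε⟩ := h (ε / 4) (by positivity)
  have hlim := Tendsto.add hg' hb
  rw [add_zero, Metric.tendsto_atTop] at hlim
  obtain ⟨N, hN⟩ := hlim (ε / 2) (by positivity)
  refine ⟨N, fun n hn => ?_⟩
  have h1 := hN n hn
  rw [Real.dist_0_eq_abs] at h1 ⊢
  rw [abs_of_nonneg (integral_nonneg fun _ => norm_nonneg _)]
  -- Replacing `g` by `g'` costs the random mass of `b`, which is its deviation plus at most `ε /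
  -- 4`, and a further `ε / 4` in the limiting integral.
  have h2 : ∀ m : stdSimplex ℝ (W n),
      ‖massFourier (fun v => g (p n v)) m - ∫ x in Set.Icc 0 1, g x‖ ≤
        (‖massFourier (fun v => g' (p n v)) m - ∫ x in Set.Icc 0 1, g' x‖ +
          ‖massFourier (fun v => (b (p n v) : ℂ)) m - ∫ x in Set.Icc 0 1, (b x : ℂ)‖) +
            ε / 2 := by
    intro m
    have e1 : massFourier (fun v => g (p n v)) m - massFourier (fun v => g' (p n v)) m =
        massFourier (fun v => g (p n v) - g' (p n v)) m := by
      simp only [massFourier, sub_mul, Finset.sum_sub_distrib]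
    have e2 : ‖massFourier (fun v => g (p n v)) m - massFourier (fun v => g' (p n v)) m‖ ≤
        ‖massFourier (fun v => (b (p n v) : ℂ)) m‖ := by
      rw [e1]; exact norm_massFourier_le (hpt n) m
    have hb0 : 0 ≤ ∫ x in Set.Icc 0 1, b x :=
      integral_nonneg_of_ae (hae.mono fun x hx => (norm_nonneg _).trans hx)
    have e3 : ‖∫ x in Set.Icc 0 1, (b x : ℂ)‖ ≤ ε / 4 := by
      rw [integral_complex_ofReal, Complex.norm_real, Real.norm_of_nonneg hb0]
      exact hbε
    have e4 : ‖(∫ x in Set.Icc 0 1, g' x) - ∫ x in Set.Icc 0 1, g x‖ ≤ ε / 4 := by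
      rw [norm_sub_rev, ← integral_sub hi hi']
      exact (norm_integral_le_of_norm_le hib hae).trans hbε
    have e5 := norm_add₃_le
      (a := massFourier (fun v => g (p n v)) m - massFourier (fun v => g' (p n v)) m)
      (b := massFourier (fun v => g' (p n v)) m - ∫ x in Set.Icc 0 1, g' x)
      (c := (∫ x in Set.Icc 0 1, g' x) - ∫ x in Set.Icc 0 1, g x)
    rw [sub_add_sub_cancel, sub_add_sub_cancel] at e5
    have e6 := norm_sub_norm_le (massFourier (fun v => (b (p n v) : ℂ)) m)
      (∫ x in Set.Icc 0 1, (b x : ℂ))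
    linarith
  calc _ ≤ ∫ m, ((‖massFourier (fun v => g' (p n v)) m - ∫ x in Set.Icc 0 1, g' x‖ +
          ‖massFourier (fun v => (b (p n v) : ℂ)) m - ∫ x in Set.Icc 0 1, (b x : ℂ)‖) +
            ε / 2) ∂Q n :=
        integral_mono (integrable_deviation n _ _) (((integrable_deviation n _ _).add
          (integrable_deviation n _ _)).add (integrable_const _)) h2
    _ < ε := by
        have hi2 : Integrable (fun m : stdSimplex ℝ (W n) =>
            ‖massFourier (fun v => g' (p n v)) m - ∫ x in Set.Icc 0 1, g' x‖ +
              ‖massFourier (fun v => (b (p n v) : ℂ)) m - ∫ x in Set.Icc 0 1, (b x : ℂ)‖)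
            (Q n) := (integrable_deviation n _ _).add (integrable_deviation n _ _)
        rw [integral_add hi2 (integrable_const _), integral_add (integrable_deviation n _ _)
          (integrable_deviation n _ _)]
        simp only [integral_const, probReal_univ, one_smul]
        have := (abs_lt.1 h1).2
        linarith

lemma integrableOn_comp_toTorus (G : C(UnitAddTorus (Fin d), ℂ)) :
    IntegrableOn (fun x => G (toTorus x)) (Set.Icc 0 1) :=
  (G.continuous.comp continuous_toTorus).continuousOn.integrableOn_compact isCompact_Icc

lemma equidistributes_mFourier (k : Fin d → ℤ)
    (h : k ≠ 0 → Tendsto (fun n => ∫ m, ‖massFourier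
      (fun v => UnitAddTorus.mFourier k (toTorus (p n v))) (m : stdSimplex ℝ (W n))‖ ^ 2 ∂Q n)
        atTop (𝓝 0)) :
    Equidistributes Q p fun x => UnitAddTorus.mFourier k (toTorus x) := by
  by_cases hk : k = 0
  · subst hk
    simpa only [UnitAddTorus.mFourier_zero, ContinuousMap.one_apply] using
      equidistributes_const (1 : ℂ)
  have h := h hk
  rw [Equidistributes, Metric.tendsto_atTop]
  intro ε hε
  rw [Metric.tendsto_atTop] at h
  obtain ⟨N, hN⟩ := h (ε ^ 2) (by positivity)
  refine ⟨N, fun n hn => ?_⟩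
  have h1 := hN n hn
  rw [Real.dist_0_eq_abs] at h1 ⊢
  rw [abs_of_nonneg (integral_nonneg fun _ => by positivity)] at h1 ⊢
  simp only [integral_Icc_mFourier hk, sub_zero]
  set X : stdSimplex ℝ (W n) → ℝ := fun m => ‖massFourier
    (fun v => UnitAddTorus.mFourier k (toTorus (p n v))) m‖ with hX
  have hXc : Continuous X := (continuous_massFourier _).norm
  -- This elementary inequality passes from second moments to first moments in place of
  -- Cauchy–Schwarz.
  have h2 : ∀ m, X m ≤ ε / 2 + (2 * ε)⁻¹ * X m ^ 2 := fun m => by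
    have : ε / 2 + (2 * ε)⁻¹ * X m ^ 2 - X m = (2 * ε)⁻¹ * (X m - ε) ^ 2 := by
      field_simp; ring
    have : 0 ≤ (2 * ε)⁻¹ * (X m - ε) ^ 2 := by positivity
    linarith
  calc ∫ m, X m ∂Q n ≤ ∫ m, (ε / 2 + (2 * ε)⁻¹ * X m ^ 2) ∂Q n :=
        integral_mono (integrable_of_continuous_stdSimplex _ hXc)
          (integrable_of_continuous_stdSimplex _ (by fun_prop)) h2
    _ = ε / 2 + (2 * ε)⁻¹ * ∫ m, X m ^ 2 ∂Q n := by
        rw [integral_add (integrable_const _)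
          (integrable_of_continuous_stdSimplex _ (by fun_prop)), integral_const_mul]
        simp
    _ < ε / 2 + (2 * ε)⁻¹ * ε ^ 2 := by gcongr
    _ = ε := by field_simp; norm_num

lemma equidistributes_comp_toTorus
    (h : ∀ k : Fin d → ℤ, k ≠ 0 → Tendsto (fun n => ∫ m, ‖massFourier
      (fun v => UnitAddTorus.mFourier k (toTorus (p n v))) (m : stdSimplex ℝ (W n))‖ ^ 2 ∂Q n)
        atTop (𝓝 0)) (G : C(UnitAddTorus (Fin d), ℂ)) :
    Equidistributes Q p fun x => G (toTorus x) := by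
  refine Equidistributes.of_approx (integrableOn_comp_toTorus G) fun ε hε => ?_
  have hG : G ∈ closure (Submodule.span ℂ
      (Set.range <| UnitAddTorus.mFourier (d := Fin d)) : Set C(UnitAddTorus (Fin d), ℂ)) := by
    rw [← Submodule.topologicalClosure_coe, UnitAddTorus.span_mFourier_closure_eq_top]
    trivial
  obtain ⟨G', hG', hdist⟩ := Metric.mem_closure_iff.1 hG ε hε
  have hle : ∀ y, ‖G y - G' y‖ ≤ ε := fun y => by
    rw [dist_eq_norm] at hdist
    exact ((G - G').norm_coe_le_norm y).trans hdist.le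
  refine ⟨fun x => G' (toTorus x), fun _ => ε, ?_, equidistributes_const _,
    integrableOn_comp_toTorus G', integrable_const _, fun n v => hle _,
    .of_forall fun x => hle _, by simp⟩
  clear hdist hle
  induction hG' using Submodule.span_induction with
  | mem F hF =>
    obtain ⟨k, rfl⟩ := hF
    exact equidistributes_mFourier k (h k)
  | zero => exact equidistributes_const 0
  | add F F' _ _ hF hF' =>
    exact hF.add hF' (integrableOn_comp_toTorus F) (integrableOn_comp_toTorus F')
  | smul c F _ hF => exact hF.smul c

/-- A continuous function on the torus which vanishes on the images of the faces of the cube and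
tends to one elsewhere as `M` grows. -/
noncomputable def faceCutoff (d M : ℕ) : C(UnitAddTorus (Fin d), ℝ) :=
  ⟨fun t => ∏ i, min 1 (M * ‖t i‖), by fun_prop⟩

lemma faceCutoff_apply (M : ℕ) (t : UnitAddTorus (Fin d)) :
    faceCutoff d M t = ∏ i, min 1 (M * ‖t i‖) := rfl

lemma faceCutoff_nonneg (M : ℕ) (t : UnitAddTorus (Fin d)) : 0 ≤ faceCutoff d M t := by
  rw [faceCutoff_apply]
  exact Finset.prod_nonneg fun _ _ => le_min zero_le_one (by positivity)

lemma faceCutoff_le_one (M : ℕ) (t : UnitAddTorus (Fin d)) : faceCutoff d M t ≤ 1 := by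
  rw [faceCutoff_apply]
  exact Finset.prod_le_one (fun _ _ => le_min zero_le_one (by positivity))
    fun _ _ => min_le_left _ _

lemma ae_mem_Ioo : ∀ᵐ x ∂((volume : Measure (Fin d → ℝ)).restrict (Set.Icc 0 1)),
    ∀ i, x i ∈ Set.Ioo (0 : ℝ) 1 := by
  have h : (Set.pi Set.univ fun i => Set.Ioo ((0 : Fin d → ℝ) i) ((1 : Fin d → ℝ) i)) =ᵐ[volume]
      Set.Icc 0 1 := Measure.univ_pi_Ioo_ae_eq_Icc
  rw [← Measure.restrict_congr_set h]
  filter_upwards [ae_restrict_mem (MeasurableSet.univ_pi fun _ => measurableSet_Ioo)] with x hx i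
  exact hx i (Set.mem_univ i)

lemma norm_coe_pos {x : ℝ} (hx : x ∈ Set.Ioo (0 : ℝ) 1) : 0 < ‖(x : UnitAddCircle)‖ := by
  rw [norm_pos_iff]
  intro h
  obtain ⟨k, hk⟩ := (AddCircle.coe_eq_zero_iff 1).1 h
  simp only [zsmul_eq_mul, mul_one] at hk
  obtain ⟨h0, h1⟩ := hx
  rw [← hk] at h0 h1
  have h0' : 0 < k := by exact_mod_cast h0
  have h1' : k < 1 := by exact_mod_cast h1
  omega

lemma tendsto_integral_faceCutoff :
    Tendsto (fun M : ℕ => ∫ x in Set.Icc (0 : Fin d → ℝ) 1, (1 - faceCutoff d M (toTorus x)))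
      atTop (𝓝 0) := by
  have h0 : ∫ _ in Set.Icc (0 : Fin d → ℝ) 1, (0 : ℝ) = 0 := by simp
  rw [← h0]
  refine tendsto_integral_of_dominated_convergence (fun _ => 1) (fun M => ?_)
    (integrable_const _) (fun M => .of_forall fun x => ?_) ?_
  · exact (continuous_const.sub ((faceCutoff d M).continuous.comp
      continuous_toTorus)).aestronglyMeasurable
  · have := faceCutoff_nonneg M (toTorus x)
    have := faceCutoff_le_one M (toTorus x)
    rw [Real.norm_eq_abs, abs_le]
    constructor <;> linarith
  · filter_upwards [ae_mem_Ioo] with x hx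
    have h1 : ∀ i, ∀ᶠ M : ℕ in atTop, 1 ≤ (M : ℝ) * ‖toTorus x i‖ := fun i =>
      (tendsto_natCast_atTop_atTop.atTop_mul_const (norm_coe_pos (hx i))).eventually_ge_atTop 1
    refine tendsto_const_nhds.congr' ?_
    filter_upwards [eventually_all.2 h1] with M hM
    have : faceCutoff d M (toTorus x) = 1 := by
      rw [faceCutoff_apply]
      exact Finset.prod_eq_one fun i _ => min_eq_left (hM i)
    rw [this, sub_self]

/-- The point of the half open unit cube projecting to a given point of the torus. -/
noncomputable def torusSection (t : UnitAddTorus (Fin d)) : Fin d → ℝ :=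
  fun i => (AddCircle.equivIoc 1 0 (t i) : ℝ)

lemma torusSection_toTorus {x : Fin d → ℝ} (hx : ∀ i, x i ∈ Set.Ioc (0 : ℝ) 1) :
    torusSection (toTorus x) = x := by
  funext i
  have h : x i ∈ Set.Ioc (0 : ℝ) (0 + 1) := by simpa using hx i
  exact AddCircle.equivIoc_coe_of_mem h

lemma continuousAt_torusSection {t : UnitAddTorus (Fin d)} (ht : ∀ i, t i ≠ 0) :
    ContinuousAt torusSection t := by
  refine continuousAt_pi.2 fun i => ?_
  have h1 : ContinuousAt (fun y : UnitAddCircle => (AddCircle.equivIoc 1 0 y : ℝ)) (t i) :=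
    continuousAt_subtype_val.comp (AddCircle.continuousAt_equivIoc 1 0 (by simpa using ht i))
  exact ContinuousAt.comp (f := fun t : UnitAddTorus (Fin d) => t i) h1
    (continuous_apply i).continuousAt

/-- The product of a bounded continuous function with the cutoff, as a function on the torus. -/
noncomputable def cutoffFunction (f : (Fin d → ℝ) →ᵇ ℝ) (M : ℕ) :
    C(UnitAddTorus (Fin d), ℂ) where
  toFun t := ((f (torusSection t) * faceCutoff d M t : ℝ) : ℂ)
  continuous_toFun := by
    refine Complex.continuous_ofReal.comp (continuous_iff_continuousAt.2 fun t => ?_)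
    by_cases ht : ∀ i, t i ≠ 0
    · exact ContinuousAt.mul (f.continuous.continuousAt.comp (continuousAt_torusSection ht))
        (faceCutoff d M).continuous.continuousAt
    -- `torusSection` jumps where a coordinate is zero, but the cutoff vanishes there and `f` is
    -- bounded.
    · push Not at ht
      obtain ⟨i, hi⟩ := ht
      have h0 : faceCutoff d M t = 0 :=
        Finset.prod_eq_zero (Finset.mem_univ i) (by simp [hi])
      have hlim : Tendsto (fun s => ‖f‖ * faceCutoff d M s) (𝓝 t) (𝓝 0) := by
        have := ((faceCutoff d M).continuous.tendsto t).const_mul ‖f‖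
        rwa [h0, mul_zero] at this
      rw [ContinuousAt, h0, mul_zero]
      refine squeeze_zero_norm (fun s => ?_) hlim
      rw [norm_mul, Real.norm_of_nonneg (faceCutoff_nonneg M s)]
      exact mul_le_mul_of_nonneg_right (f.norm_coe_le_norm _) (faceCutoff_nonneg M s)

/-- **Equidistribution criterion**: if all nontrivial Fourier modes vanish in the limit, the
random weights integrate all bounded continuous functions like the uniform measure. -/
theorem equidistributes_of_fourier (hp : ∀ n v i, p n v i ∈ Set.Ioc (0 : ℝ) 1)
    (h : ∀ k : Fin d → ℤ, k ≠ 0 → Tendsto (fun n => ∫ m, ‖massFourier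
      (fun v => UnitAddTorus.mFourier k (toTorus (p n v))) (m : stdSimplex ℝ (W n))‖ ^ 2 ∂Q n)
        atTop (𝓝 0)) (f : (Fin d → ℝ) →ᵇ ℝ) :
    Equidistributes Q p fun x => (f x : ℂ) := by
  have hf : IntegrableOn (fun x => (f x : ℂ)) (Set.Icc 0 1) :=
    (Complex.continuous_ofReal.comp f.continuous).continuousOn.integrableOn_compact isCompact_Icc
  refine Equidistributes.of_approx hf fun ε hε => ?_
  have hlim := (tendsto_integral_faceCutoff (d := d)).const_mul ‖f‖
  rw [mul_zero] at hlim
  obtain ⟨M, hM⟩ := (hlim.eventually_lt_const hε).exists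
  -- On the half-open cube `torusSection` inverts `toTorus`; this cube contains all the points `p n
  -- v` and almost every point of the closed cube.
  have hbound : ∀ x : Fin d → ℝ, (∀ i, x i ∈ Set.Ioc (0 : ℝ) 1) →
      ‖(f x : ℂ) - cutoffFunction f M (toTorus x)‖ ≤
        ‖f‖ * (1 - faceCutoff d M (toTorus x)) := by
    intro x hx
    have h1 : (f x : ℂ) - cutoffFunction f M (toTorus x) =
        ((f x * (1 - faceCutoff d M (toTorus x)) : ℝ) : ℂ) := by
      simp only [cutoffFunction, ContinuousMap.coe_mk, torusSection_toTorus hx]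
      push_cast; ring
    have h2 : 0 ≤ 1 - faceCutoff d M (toTorus x) := sub_nonneg.2 (faceCutoff_le_one _ _)
    rw [h1, Complex.norm_real, norm_mul, Real.norm_of_nonneg h2]
    exact mul_le_mul_of_nonneg_right (f.norm_coe_le_norm _) h2
  -- The error bound is itself a continuous function on the torus, hence equidistributes: little
  -- random mass accumulates near the faces.
  refine ⟨fun x => cutoffFunction f M (toTorus x),
    fun x => ‖f‖ * (1 - faceCutoff d M (toTorus x)), equidistributes_comp_toTorus h _, ?_,
    integrableOn_comp_toTorus _, ?_, fun n v => hbound _ (hp n v), ?_, ?_⟩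
  · exact equidistributes_comp_toTorus h
      ⟨fun t => ((‖f‖ * (1 - faceCutoff d M t) : ℝ) : ℂ), by fun_prop⟩
  · exact (continuous_const.mul (continuous_const.sub ((faceCutoff d M).continuous.comp
      continuous_toTorus))).continuousOn.integrableOn_compact isCompact_Icc
  · filter_upwards [ae_mem_Ioo] with x hx
    exact hbound x fun i => Set.Ioo_subset_Ioc_self (hx i)
  · rw [integral_const_mul]
    exact hM.le

end Equidistribution

/-! ### Convergence in distribution to a deterministic measure -/

section RandomMeasures

/-- A bounded continuous functional on finite measures is controlled, up to a small error, by
finitely many integrals of bounded continuous functions. -/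
lemma exists_finset_abs_sub_le {E : Type*} [TopologicalSpace E] [MeasurableSpace E]
    [OpensMeasurableSpace E] (F : FiniteMeasure E →ᵇ ℝ) (Z : FiniteMeasure E) {ε : ℝ}
    (hε : 0 < ε) :
    ∃ (s : Finset (E →ᵇ ℝ)) (C : ℝ), ∀ μ : FiniteMeasure E,
      |F μ - F Z| ≤ ε + C * ∑ f ∈ s, |∫ x, f x ∂(μ : Measure E) - ∫ x, f x ∂(Z : Measure E)| := by
  -- The filter of weak convergence to `Z`, written through integrals; membership in the infimum
  -- involves only finitely many test functions.
  set L : Filter (FiniteMeasure E) := ⨅ f : E →ᵇ ℝ,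
    comap (fun μ => ∫ x, f x ∂(μ : Measure E)) (𝓝 (∫ x, f x ∂(Z : Measure E))) with hL
  have hid : Tendsto (fun μ : FiniteMeasure E => μ) L (𝓝 Z) :=
    FiniteMeasure.tendsto_of_forall_integral_tendsto fun f =>
      tendsto_comap.mono_left (iInf_le _ f)
  have hF : ∀ᶠ μ in L, |F μ - F Z| < ε := by
    have := ((F.continuous.tendsto Z).comp hid).eventually (Metric.ball_mem_nhds _ hε)
    simpa [Real.dist_eq] using this
  obtain ⟨I, hI, U, hU, hUe⟩ := mem_iInf.1 hF
  have hδ : ∀ f : I, ∃ δ > 0, ∀ μ : FiniteMeasure E,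
      |∫ x, f.1 x ∂(μ : Measure E) - ∫ x, f.1 x ∂(Z : Measure E)| < δ → μ ∈ U f := by
    intro f
    obtain ⟨A, hA, hAU⟩ := mem_comap.1 (hU f)
    obtain ⟨δ, hδ, hball⟩ := Metric.mem_nhds_iff.1 hA
    exact ⟨δ, hδ, fun μ hμ => hAU (hball (by simpa [Real.dist_eq] using hμ))⟩
  choose δ hδ0 hδU using hδ
  have : Fintype I := hI.fintype
  refine ⟨hI.toFinset, ∑ f : I, 2 * ‖F‖ / δ f, fun μ => ?_⟩
  have hterm : ∀ f : I, 0 ≤ 2 * ‖F‖ / δ f := fun f =>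
    div_nonneg (by positivity) (hδ0 f).le
  -- Either `μ` lies in the neighbourhood and the error is below `ε`, or some integral deviates by
  -- at least `δ f` and the trivial bound `2 * ‖F‖` is absorbed by the constant.
  by_cases hμ : μ ∈ ⋂ i, U i
  · rw [← hUe] at hμ
    refine (le_of_lt hμ).trans (le_add_of_nonneg_right (mul_nonneg ?_ ?_))
    · exact Finset.sum_nonneg fun f _ => hterm f
    · exact Finset.sum_nonneg fun f _ => abs_nonneg _
  · simp only [Set.mem_iInter, not_forall] at hμ
    obtain ⟨f, hf⟩ := hμ
    have h1 : δ f ≤ |∫ x, f.1 x ∂(μ : Measure E) - ∫ x, f.1 x ∂(Z : Measure E)| :=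
      not_lt.1 fun h => hf (hδU f μ h)
    have h2 : |F μ - F Z| ≤ 2 * ‖F‖ := by
      have := F.dist_le_two_norm μ Z
      rwa [Real.dist_eq] at this
    have h3 := Finset.single_le_sum (f := fun f : I => 2 * ‖F‖ / δ f) (fun f _ => hterm f)
      (Finset.mem_univ f)
    have h4 := Finset.single_le_sum (s := hI.toFinset)
      (f := fun f : E →ᵇ ℝ => |∫ x, f x ∂(μ : Measure E) - ∫ x, f x ∂(Z : Measure E)|)
      (fun f _ => abs_nonneg _) (hI.mem_toFinset.2 f.2)
    calc |F μ - F Z| ≤ 2 * ‖F‖ / δ f * δ f := by rwa [div_mul_cancel₀ _ (hδ0 f).ne']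
      _ ≤ _ := mul_le_mul h3 (h1.trans h4) (hδ0 f).le (Finset.sum_nonneg fun f _ => hterm f)
      _ ≤ _ := le_add_of_nonneg_left hε.le

/-- Random measures whose integrals against bounded continuous functions converge in mean to those
of a deterministic measure converge to it in distribution. -/
lemma tendsto_integral_of_tendsto_mean {E : Type*} [TopologicalSpace E] [MeasurableSpace E]
    [OpensMeasurableSpace E] {S : ℕ → Type*} [∀ n, MeasurableSpace (S n)] {Q : ∀ n, Measure (S n)}
    [∀ n, IsProbabilityMeasure (Q n)] {X : ∀ n, S n → FiniteMeasure E} {Z : FiniteMeasure E}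
    (hmeas : ∀ (F : FiniteMeasure E →ᵇ ℝ) n, AEStronglyMeasurable (fun ω => F (X n ω)) (Q n))
    (hint : ∀ (f : E →ᵇ ℝ) n, Integrable (fun ω => ∫ x, f x ∂(X n ω : Measure E)) (Q n))
    (hlim : ∀ f : E →ᵇ ℝ, Tendsto (fun n => ∫ ω, |∫ x, f x ∂(X n ω : Measure E) -
      ∫ x, f x ∂(Z : Measure E)| ∂Q n) atTop (𝓝 0)) (F : FiniteMeasure E →ᵇ ℝ) :
    Tendsto (fun n => ∫ ω, F (X n ω) ∂Q n) atTop (𝓝 (F Z)) := by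
  rw [Metric.tendsto_atTop']
  intro ε hε
  obtain ⟨s, C, hC⟩ := exists_finset_abs_sub_le F Z (half_pos hε)
  have hsum := (tendsto_finsetSum s fun f _ => hlim f).const_mul C
  rw [Finset.sum_const_zero, mul_zero] at hsum
  obtain ⟨N, hN⟩ := eventually_atTop.1 (hsum.eventually_lt_const (half_pos hε))
  refine ⟨N, fun n hn => ?_⟩
  have hFi : Integrable (fun ω => F (X n ω)) (Q n) :=
    Integrable.of_bound (hmeas F n) ‖F‖ (.of_forall fun ω => F.norm_coe_le_norm _)
  have hdev : ∀ f : E →ᵇ ℝ, Integrable (fun ω => |∫ x, f x ∂(X n ω : Measure E) -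
      ∫ x, f x ∂(Z : Measure E)|) (Q n) := fun f => ((hint f n).sub (integrable_const _)).abs
  have hdevsum := integrable_finsetSum s fun f _ => hdev f
  rw [Real.dist_eq]
  have e1 : ∫ ω, F (X n ω) ∂Q n - F Z = ∫ ω, (F (X n ω) - F Z) ∂Q n := by
    rw [integral_sub hFi (integrable_const _)]; simp
  calc |∫ ω, F (X n ω) ∂Q n - F Z| ≤ ∫ ω, |F (X n ω) - F Z| ∂Q n := by
        rw [e1]; exact abs_integral_le_integral_abs
    _ ≤ ∫ ω, (ε / 2 + C * ∑ f ∈ s, |∫ x, f x ∂(X n ω : Measure E) -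
          ∫ x, f x ∂(Z : Measure E)|) ∂Q n :=
        integral_mono (hFi.sub (integrable_const _)).abs
          ((integrable_const _).add (hdevsum.const_mul C)) fun ω => hC _
    _ = ε / 2 + C * ∑ f ∈ s, ∫ ω, |∫ x, f x ∂(X n ω : Measure E) -
          ∫ x, f x ∂(Z : Measure E)| ∂Q n := by
        rw [integral_add (integrable_const _) (hdevsum.const_mul C), integral_const_mul,
          integral_finsetSum _ fun f _ => hdev f]
        simp
    _ < ε := by have := hN n hn.le; linarith

end RandomMeasures

/-! ### The stationary law as a measure -/

section StationaryLaw

variable {V : Type*} [Fintype V] [DecidableEq V] [Nonempty V] {G : SimpleGraph V}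
  [DecidableRel G.Adj]

/-- The stationary law of the masses. -/
lemma exists_stationaryLaw (hG : ∀ v, 0 < G.degree v) (hc : G.Preconnected) :
    ∃ μ : Measure (stdSimplex ℝ V), IsProbabilityMeasure μ ∧
      ∀ g : C(stdSimplex ℝ V, ℝ), ∫ m, g m ∂μ = stationary hG hc fun _ => g := by
  -- Riesz–Markov applies because the simplex is compact, so every continuous function has compact
  -- support.
  let Λ : CompactlySupportedContinuousMap (stdSimplex ℝ V) ℝ →ₚ[ℝ] ℝ :=
    { toFun := fun g => stationary hG hc fun _ => g.toContinuousMap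
      map_add' := fun g g' => by rw [← map_add]; rfl
      map_smul' := fun c g => by
        rw [RingHom.id_apply, ← map_smul]; rfl
      monotone' := fun g g' h => stationary_mono hG hc fun _ => h }
  have hint : ∀ g : C(stdSimplex ℝ V, ℝ),
      ∫ m, g m ∂(RealRMK.rieszMeasure Λ) = stationary hG hc fun _ => g := fun g =>
    RealRMK.integral_rieszMeasure Λ ⟨g, HasCompactSupport.of_compactSpace _⟩
  refine ⟨RealRMK.rieszMeasure Λ, ⟨?_⟩, hint⟩
  have h1 := hint 1
  rw [show (fun _ : V => (1 : C(stdSimplex ℝ V, ℝ))) = 1 from rfl, stationary_one] at h1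
  simp only [ContinuousMap.one_apply, integral_const, smul_eq_mul, mul_one] at h1
  rw [← ENNReal.toReal_eq_one_iff]
  exact h1

end StationaryLaw

/-! ### Regularity of the map from masses to measures -/

section MassMeasure

variable {d n : ℕ}

lemma continuous_massMeasure : Continuous (massMeasure (d := d) (n := n)) := by
  unfold massMeasure
  exact continuous_finsetSum _ fun v _ =>
    (continuous_real_toNNReal.comp (continuous_apply v)).smul continuous_const

lemma toMeasure_massMeasure (m : (Fin d → Fin n) → ℝ) :
    (massMeasure m : Measure (Fin d → ℝ)) =
      ∑ v, ENNReal.ofReal (m v) • Measure.dirac (vertexPoint v) := by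
  simp only [massMeasure, FiniteMeasure.toMeasure_sum, FiniteMeasure.toMeasure_smul]
  rfl

/-- The σ-algebra on finite measures is the one inherited from `Measure`, so measurability is
checked on the masses of measurable sets and not deduced from continuity. -/
lemma measurable_massMeasure : Measurable (massMeasure (d := d) (n := n)) := by
  refine Measurable.subtype_mk (f := fun m =>
    ((massMeasure (d := d) (n := n) m : FiniteMeasure (Fin d → ℝ)) : Measure (Fin d → ℝ)))
    ?_
  refine Measure.measurable_of_measurable_coe _ fun s _ => ?_
  simp only [toMeasure_massMeasure, Measure.coe_finsetSum, Finset.sum_apply, Measure.smul_apply,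
    smul_eq_mul]
  fun_prop

lemma measurable_rescale (k : ℕ) : Measurable (rescale (d := d) k) := by
  refine Measurable.subtype_mk
    (f := fun μ : FiniteMeasure (Fin d → ℝ) => (rescale k μ : Measure (Fin d → ℝ))) ?_
  exact (Measure.measurable_map _ (by fun_prop)).comp measurable_subtype_coe

lemma continuous_rescale (k : ℕ) : Continuous (rescale (d := d) k) :=
  FiniteMeasure.continuous_map (by fun_prop)

lemma integral_rescale_massMeasure (k : ℕ) (m : stdSimplex ℝ (Fin d → Fin n))
    (f : (Fin d → ℝ) →ᵇ ℝ) :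
    ∫ x, f x ∂(rescale k (massMeasure (m : (Fin d → Fin n) → ℝ)) : Measure (Fin d → ℝ)) =
      ∑ v, f ((k : ℝ)⁻¹ • vertexPoint v) * m v := by
  rw [rescale, FiniteMeasure.toMeasure_map, integral_map (by fun_prop)
    f.continuous.aestronglyMeasurable, toMeasure_massMeasure, integral_finsetSum_measure]
  · refine Finset.sum_congr rfl fun v _ => ?_
    rw [integral_smul_measure, integral_dirac, ENNReal.toReal_ofReal (stdSimplex.zero_le m v),
      smul_eq_mul, mul_comm]
  · intro v _
    exact (integrable_dirac (by simp)).smul_measure ENNReal.ofReal_ne_top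

end MassMeasure

/-! ### The two limit theorems -/

section Limits

variable {d n : ℕ}

/-- The uniform mass configuration on the discrete torus. -/
noncomputable def uniformMass (d n : ℕ) [NeZero n] : stdSimplex ℝ (Fin d → Fin n) :=
  ⟨fun _ => 1 / (n : ℝ) ^ d, fun _ => by positivity, by
    have : (n : ℝ) ^ d ≠ 0 := pow_ne_zero _ (by exact_mod_cast NeZero.ne n)
    simp [this]⟩

/-- The law of a random mass configuration, as a law on all functions on the torus. -/
noncomputable def lawOnFunctions (μ : Measure (stdSimplex ℝ (Fin d → Fin n))) :
    Measure ((Fin d → Fin n) → ℝ) :=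
  μ.map Subtype.val

instance (μ : Measure (stdSimplex ℝ (Fin d → Fin n))) [IsProbabilityMeasure μ] :
    IsProbabilityMeasure (lawOnFunctions μ) :=
  Measure.isProbabilityMeasure_map measurable_subtype_coe.aemeasurable

lemma integral_lawOnFunctions (μ : Measure (stdSimplex ℝ (Fin d → Fin n)))
    {g : ((Fin d → Fin n) → ℝ) → ℝ} (hg : Continuous g) :
    ∫ m, g m ∂(lawOnFunctions μ) = ∫ m : stdSimplex ℝ (Fin d → Fin n), g m.1 ∂μ :=
  integral_map measurable_subtype_coe.aemeasurable hg.aestronglyMeasurable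

lemma measurable_comp_natCount {Ω β : Type*} [MeasurableSpace Ω] [MeasurableSpace β]
    {X : ℕ → Ω → β} (hX : ∀ k, Measurable (X k)) {N : Ω → ℕ} (hN : Measurable N) :
    Measurable fun ω => X (N ω) ω := by
  have hjoint : Measurable fun q : Ω × ℕ => X q.2 q.1 := measurable_from_prod_countable_left hX
  exact hjoint.comp (measurable_id.prodMk hN)

/-- The empirical measures converge in distribution to the measure with stationary masses. -/
theorem IsSimpleRandomWalk.randomMeasuresTendsto [NeZero n] (hd : 1 ≤ d) (hn : 2 ≤ n)
    {Ω : Type*} [MeasurableSpace Ω] {P : Measure Ω} [IsProbabilityMeasure P]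
    {B : ℝ → Ω → (Fin d → Fin n)} {T : ℕ → Ω → ℝ} (h : IsSimpleRandomWalk (torus d n) P B T)
    {μ : Measure (stdSimplex ℝ (Fin d → Fin n))}
    (hμ : ∀ g : C(stdSimplex ℝ (Fin d → Fin n), ℝ), ∫ m, g m ∂μ =
      stationary (torus_degree_pos (n := n) hd hn) torus_preconnected fun _ => g) :
    RandomMeasuresTendsto (fun (t : ℝ) (ω : Ω) => empiricalMeasure B T t ω) (fun _ => P) atTop
      (massMeasure (d := d) (n := n)) (lawOnFunctions μ) := by
  have hemp : ∀ t ω, empiricalMeasure B T t ω = massMeasure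
      (simplexAfterJumps (torus_degree_pos (n := n) hd hn) (uniformMass d n)
        (fun k => B (T k ω) ω) (jumpCount T t ω)).1 := fun t ω => by
    rw [empiricalMeasure, massProcess]
    exact congrArg massMeasure (coe_simplexAfterJumps _ (uniformMass d n) _ _).symm
  refine ⟨fun t => Measurable.aemeasurable ?_, measurable_massMeasure.aemeasurable, fun F => ?_⟩
  · have hskel : Measurable fun ω (k : ℕ) => B (T k ω) ω :=
      measurable_pi_lambda _ h.measurable_skeleton
    simp only [hemp]
    exact measurable_comp_natCount (fun k => (measurable_simplexAfterJumps
      (torus_degree_pos (n := n) hd hn) (uniformMass d n) k fun _ m => massMeasure m.1).comp hskel)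
      (measurable_jumpCount h.measurable_jumpTime t)
  · have hF : Continuous fun m : (Fin d → Fin n) → ℝ => F (massMeasure m) :=
      F.continuous.comp continuous_massMeasure
    let f : C(stdSimplex ℝ (Fin d → Fin n), ℝ) :=
      ⟨fun m => F (massMeasure m.1), hF.comp continuous_subtype_val⟩
    simp only [hemp, integral_lawOnFunctions μ hF]
    have := h.tendsto_integral (torus_degree_pos (n := n) hd hn) torus_preconnected
      (uniformMass d n) f
    rw [← hμ f] at this
    exact this

lemma toTorus_inv_smul_vertexPoint [NeZero n] (v : Fin d → Fin n) :
    toTorus ((n : ℝ)⁻¹ • vertexPoint v) =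
      torusPoint v + toTorus fun _ => (n : ℝ)⁻¹ := by
  funext i
  simp only [toTorus, torusPoint, vertexPoint, Pi.smul_apply, Pi.add_apply, smul_eq_mul]
  rw [← AddCircle.coe_add]
  congr 1
  ring

/-- Numbering the vertices from 1 shifts all points by 1/n, which multiplies the mode by a phase. -/
lemma norm_massFourier_vertexPoint [NeZero n] (k : Fin d → ℤ) (m : (Fin d → Fin n) → ℝ) :
    ‖massFourier (fun v => UnitAddTorus.mFourier k (toTorus ((n : ℝ)⁻¹ • vertexPoint v))) m‖ =
      ‖massFourier (torusChar k) m‖ := by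
  have h : massFourier
      (fun v => UnitAddTorus.mFourier k (toTorus ((n : ℝ)⁻¹ • vertexPoint v))) m =
      massFourier (torusChar k) m * UnitAddTorus.mFourier k (toTorus fun _ => (n : ℝ)⁻¹) := by
    simp only [massFourier, toTorus_inv_smul_vertexPoint, mFourier_add_apply, Finset.sum_mul,
      torusChar]
    exact Finset.sum_congr rfl fun v _ => by ring
  rw [h, norm_mul, norm_mFourier_apply, mul_one]

lemma inv_smul_vertexPoint_mem [NeZero n] (v : Fin d → Fin n) (i : Fin d) :
    ((n : ℝ)⁻¹ • vertexPoint v) i ∈ Set.Ioc (0 : ℝ) 1 := by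
  have hn : (0 : ℝ) < n := by exact_mod_cast Nat.pos_of_ne_zero (NeZero.ne n)
  have hv : ((v i : ℕ) : ℝ) + 1 ≤ n := by exact_mod_cast (v i).2
  simp only [Pi.smul_apply, vertexPoint, smul_eq_mul]
  constructor
  · positivity
  · rw [inv_mul_le_iff₀ hn]; linarith

/-- The rescaled stationary masses integrate bounded continuous functions asymptotically like the
uniform measure on the cube. -/
theorem equidistributes_stationary (hd : 1 ≤ d)
    {μ : ∀ n, Measure (stdSimplex ℝ (Fin d → Fin (n + 2)))} [∀ n, IsProbabilityMeasure (μ n)]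
    (hμ : ∀ n, ∀ g : C(stdSimplex ℝ (Fin d → Fin (n + 2)), ℝ), ∫ m, g m ∂μ n =
      stationary (torus_degree_pos hd (Nat.le_add_left 2 n)) torus_preconnected fun _ => g)
    (f : (Fin d → ℝ) →ᵇ ℝ) :
    Equidistributes μ (fun n v => ((n + 2 : ℕ) : ℝ)⁻¹ • vertexPoint v) fun x => (f x : ℂ) := by
  refine equidistributes_of_fourier (fun n v i => inv_smul_vertexPoint_mem v i) (fun k hk => ?_) f
  obtain ⟨i, hi⟩ := Function.ne_iff.1 hk
  simp only [norm_massFourier_vertexPoint]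
  set a := 2 * Real.pi * ∑ j, |(k j : ℝ)| with ha
  have hlim : Tendsto (fun n : ℕ => ((1 + 4 * d) * a + a ^ 2 * (2 + 4 * d ^ 2)) /
      ((n + 2 : ℕ) : ℝ)) atTop (𝓝 0) :=
    (tendsto_const_nhds.div_atTop tendsto_natCast_atTop_atTop).comp (tendsto_add_atTop_nat 2)
  refine squeeze_zero' (.of_forall fun n => integral_nonneg fun _ => by positivity) ?_ hlim
  filter_upwards [eventually_ge_atTop (k i).natAbs] with n hn
  have hkn : |k i| < ((n + 2 : ℕ) : ℤ) := by
    rw [Int.abs_eq_natAbs]; exact_mod_cast (by omega : (k i).natAbs < n + 2)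
  refine le_trans (le_of_eq ?_)
    (stationary_torusFourier_le hd (Nat.le_add_left 2 n) k hi hkn ha)
  exact hμ n (normSqFourier (torusChar k))

/-- The rescaled stationary measures converge in distribution to the uniform measure. -/
theorem tendsto_integral_rescale_stationary (hd : 1 ≤ d)
    {μ : ∀ n, Measure (stdSimplex ℝ (Fin d → Fin (n + 2)))} [∀ n, IsProbabilityMeasure (μ n)]
    (hμ : ∀ n, ∀ g : C(stdSimplex ℝ (Fin d → Fin (n + 2)), ℝ), ∫ m, g m ∂μ n =
      stationary (torus_degree_pos hd (Nat.le_add_left 2 n)) torus_preconnected fun _ => g)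
    (F : FiniteMeasure (Fin d → ℝ) →ᵇ ℝ) :
    Tendsto (fun n => ∫ m, F (rescale (n + 2) (massMeasure m.1)) ∂μ n) atTop
      (𝓝 (F (uniformCube d))) := by
  have hcont : ∀ n, Continuous fun m : stdSimplex ℝ (Fin d → Fin (n + 2)) =>
      rescale (n + 2) (massMeasure m.1) := fun n =>
    (continuous_rescale _).comp (continuous_massMeasure.comp continuous_subtype_val)
  refine tendsto_integral_of_tendsto_mean
    (X := fun n (m : stdSimplex ℝ (Fin d → Fin (n + 2))) => rescale (n + 2) (massMeasure m.1))
    (fun F n => (F.continuous.comp (hcont n)).aestronglyMeasurable)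
    (fun f n => integrable_of_continuous_stdSimplex _
      ((FiniteMeasure.continuous_integral_boundedContinuousFunction f).comp (hcont n)))
    (fun f => (equidistributes_stationary hd hμ f).congr fun n => ?_) F
  refine integral_congr_ae (.of_forall fun m => ?_)
  have h1 := integral_rescale_massMeasure (n + 2) m f
  have h2 : ∫ x, f x ∂(uniformCube d : Measure (Fin d → ℝ)) = ∫ x in Set.Icc 0 1, f x := rfl
  have h3 : massFourier (fun v => (f (((n + 2 : ℕ) : ℝ)⁻¹ • vertexPoint v) : ℂ)) m =
      ((∑ v, f (((n + 2 : ℕ) : ℝ)⁻¹ • vertexPoint v) * m v : ℝ) : ℂ) := by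
    simp [massFourier]
  simp only [h3]
  rw [integral_complex_ofReal, ← Complex.ofReal_sub, Complex.norm_real, Real.norm_eq_abs, h2]
  exact congrArg (fun y => |y - ∫ x in Set.Icc 0 1, f x|) h1.symm

/-- The stationary laws of the masses, for tori of all sizes. -/
lemma exists_stationaryLaws (hd : 1 ≤ d) :
    ∃ μ : ∀ n, Measure (stdSimplex ℝ (Fin d → Fin (n + 2))), (∀ n, IsProbabilityMeasure (μ n)) ∧
      ∀ n, ∀ g : C(stdSimplex ℝ (Fin d → Fin (n + 2)), ℝ), ∫ m, g m ∂μ n =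
        stationary (torus_degree_pos hd (Nat.le_add_left 2 n)) torus_preconnected fun _ => g := by
  choose μ h1 h2 using fun n => exists_stationaryLaw
    (torus_degree_pos (n := n + 2) hd (Nat.le_add_left 2 n)) torus_preconnected
  exact ⟨μ, h1, h2⟩

/-- A family of laws on the mass configurations, given by `μ` on the tori of size at least two. -/
noncomputable def extendLaw (μ : ∀ n, Measure (stdSimplex ℝ (Fin d → Fin (n + 2)))) :
    ∀ n, Measure ((Fin d → Fin n) → ℝ)
  -- For `n = 0` and `d ≥ 1` the simplex is empty and carries no probability measure, hence the laws
  -- on all functions. The values at 0 and 1 are arbitrary and do not affect the limit.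
  | 0 => Measure.dirac 0
  | 1 => Measure.dirac 0
  | n + 2 => lawOnFunctions (μ n)

instance (μ : ∀ n, Measure (stdSimplex ℝ (Fin d → Fin (n + 2)))) [∀ n, IsProbabilityMeasure (μ n)] :
    ∀ n, IsProbabilityMeasure (extendLaw μ n)
  | 0 => inferInstanceAs (IsProbabilityMeasure (Measure.dirac 0))
  | 1 => inferInstanceAs (IsProbabilityMeasure (Measure.dirac 0))
  | n + 2 => inferInstanceAs (IsProbabilityMeasure (lawOnFunctions (μ n)))

end Limits

end Earthworm

theorem theorem7p1 (d : ℕ) (hd : 1 ≤ d) :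
    ∃ (S : ℕ → Type) (_ : ∀ n, MeasurableSpace (S n)) (Q : ∀ n, Measure (S n))
      (_ : ∀ n, IsProbabilityMeasure (Q n))
      (Minf : ∀ n, S n → FiniteMeasure (Fin d → ℝ)),
      (∀ n : ℕ, 2 ≤ n →
        ∀ (Ω : Type*) [MeasurableSpace Ω] (P : Measure Ω) [IsProbabilityMeasure P]
          (B : ℝ → Ω → (Fin d → Fin n)) (T : ℕ → Ω → ℝ),
          Earthworm.IsSimpleRandomWalk (Earthworm.torus d n) P B T →
          Earthworm.RandomMeasuresTendsto
            (fun (t : ℝ) (ω : Ω) => Earthworm.empiricalMeasure B T t ω) (fun _ => P) atTop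
            (Minf n) (Q n)) ∧
      Earthworm.RandomMeasuresTendsto
        (fun (n : ℕ) (ω : S n) => Earthworm.rescale n (Minf n ω)) Q atTop
        (fun _ : Unit => Earthworm.uniformCube d) (Measure.dirac ()) := by
  obtain ⟨μ, hprob, hμ⟩ := Earthworm.exists_stationaryLaws hd
  -- The limit is chosen before any walk is given, so its law cannot depend on that of the starting
  -- point.
  refine ⟨fun n => (Fin d → Fin n) → ℝ, fun n => inferInstance, Earthworm.extendLaw μ,
    inferInstance, fun n => Earthworm.massMeasure, fun n hn Ω _ P _ B T h => ?_,
    ⟨fun n => ((Earthworm.measurable_rescale n).comp Earthworm.measurable_massMeasure).aemeasurable,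
      aemeasurable_const, fun F => ?_⟩⟩
  · obtain ⟨n, rfl⟩ := Nat.exists_eq_add_of_le' hn
    exact h.randomMeasuresTendsto hd hn (hμ n)
  · rw [integral_dirac, ← tendsto_add_atTop_iff_nat 2]
    refine (Earthworm.tendsto_integral_rescale_stationary hd hμ F).congr fun n => ?_
    exact (Earthworm.integral_lawOnFunctions (μ n) (F.continuous.comp
      ((Earthworm.continuous_rescale (n + 2)).comp Earthworm.continuous_massMeasure))).symm
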